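/- Let $\Omega=(0,1)^2$, let $b>0$, and let $(\Omega_{h_n})_{n\in\mathbb N}$ be a shape-regular, quasi-uniform sequence of conforming triangulations of $\overline\Omega$ with mesh sizes $h_n=\max_{K}\operatorname{diam}K\to 0$; that is, $\operatorname{diam}(K)/\rho_K\le c_0$ and $\operatorname{diam}(K)\ge c\,h_n$ for all $n$ and $K\in\Omega_{h_n}$, with constants $c_0,c>0$ independent of $n$ and $K$, where $\rho_K$ is the diameter of the largest disc inscribed in $K$. Let $\tilde V_h$ be the space of functions $u$ on $\overline\Omega$ such that for every triangle $K\in\Omega_h$ one has $u|_K\in\mathcal P_3(K)+q_K\mathcal P_1(K)+q_K^2\mathcal P_1(K)$, with $q_K\ge 0$ the cubic bubble function vanishing on $\partial K$; the degrees of freedom, namely $u(a)$ and $\nabla u(a)$ at each vertex $a$ and $\frac1{|e|}\int_e\frac{\partial u}{\partial\nu_e}\,ds$ and $\frac1{|e|}\int_e\frac{\partial^2u}{\partial\nu_e^2}\,ds$ over each edge $e$, take the same value from all triangles containing $a$, respectively $e$; and they vanish if $a$, respectively $e$, lies on $\partial\Omega$. For a piecewise $H^3$ vector field $u=(u^1,u^2)$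 let $$\|u\|_{3,\Omega_h}^2=\sum_{K\in\Omega_h}\sum_{i=1}^2\sum_{|\alpha|\le 3}\int_K|\partial^\alpha u^i|^2\,dx,$$ $$\|u\|_h^2=a_h(u,u)=\sum_{i=1}^2\sum_{K\in\Omega_h}\int_K\Big(|u^i|^2+3b|\nabla u^i|^2+3b^2|\Delta u^i|^2+b^3|\nabla\Delta u^i|^2\Big)dx .$$ Let $v\in H^3(\Omega)^2$ and $v_{h_n}\in\tilde V_{h_n}^2$ for each $n$. Let $g:S^1=\mathbb R/2\pi\mathbb Z\to\Omega$ be continuous (so that its image has positive distance to $\partial\Omega$), and suppose that for every $n$ the image $g(S^1)$ is a union of interior edges of $\Omega_{h_n}$, i.e. of edges shared by two triangles. Then $v$ has a continuous representative on $\Omega$, again denoted by $v$, and: 1. If $\|v-v_{h_n}\|_{3,\Omega_{h_n}}\to 0$, then $(v_{h_n}-v)\circ g\to 0$ pointwise almost everywhere on $S^1$ with respect to one-dimensional Lebesgue measure (for the whole sequence). 2. If $\|v-v_{h_n}\|_{h_n}\to 0$ and $g$ is moreover injective and piecewise affine, then there is a subsequence $(h_{n_k})_k$ such that $(v_{h_{n_k}}-v)\circ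 g\to 0$ pointwise almost everywhere on $S^1$. -/

import Mathlib

open Set Filter Topology MeasureTheory
open scoped ContDiff

noncomputable section

namespace TriHelmholtz

/-- The Euclidean plane. -/
abbrev Plane : Type := EuclideanSpace ℝ (Fin 2)

/-- The closed unit square. -/
def closedSquare : Set Plane := {x | ∀ i, 0 ≤ x i ∧ x i ≤ 1}

/-- The open unit square. -/
def openSquare : Set Plane := {x | ∀ i, 0 < x i ∧ x i < 1}

/-! ### Sobolev spaces through weak derivatives -/

/-- The classical partial derivative in the `i`-th coordinate direction. -/
def classicalPartial (i : Fin 2) (φ : Plane → ℝ) : Plane → ℝ :=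
  fun x => fderiv ℝ φ x (EuclideanSpace.single i 1)

/-- The classical derivative `∂^α` for the multi-index `α = (α.1, α.2)`. -/
def classicalDeriv (α : ℕ × ℕ) (φ : Plane → ℝ) : Plane → ℝ :=
  (classicalPartial 0)^[α.1] ((classicalPartial 1)^[α.2] φ)

/-- `w` is a weak derivative `∂^α f` on the open set `O`. -/
def HasWeakDeriv (O : Set Plane) (α : ℕ × ℕ) (f w : Plane → ℝ) : Prop :=
  LocallyIntegrableOn f O ∧ LocallyIntegrableOn w O ∧
    ∀ φ : Plane → ℝ, ContDiff ℝ ∞ φ → HasCompactSupport φ → tsupport φ ⊆ O →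
      ∫ x in O, f x * classicalDeriv α φ x = (-1) ^ (α.1 + α.2) * ∫ x in O, w x * φ x

open Classical in
/-- The weak derivative `∂^α f` on `O` (unique up to null sets); `0` if there is none. -/
def weakDeriv (O : Set Plane) (α : ℕ × ℕ) (f : Plane → ℝ) : Plane → ℝ :=
  if h : ∃ w, HasWeakDeriv O α f w then h.choose else 0

/-- `f ∈ H^k(O)`. -/
def MemH (k : ℕ) (O : Set Plane) (f : Plane → ℝ) : Prop :=
  ∀ α : ℕ × ℕ, α.1 + α.2 ≤ k →
    ∃ w, HasWeakDeriv O α f w ∧ MemLp w 2 (volume.restrict O)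

/-- The multi-indices of order at most `k`. -/
def multiIndices (k : ℕ) : Finset (ℕ × ℕ) :=
  (Finset.range (k + 1) ×ˢ Finset.range (k + 1)).filter fun α => α.1 + α.2 ≤ k

/-- `‖f‖²_{k,O} = ∑_{|α| ≤ k} ∫_O |∂^α f|²`. -/
def sobolevNormSq (k : ℕ) (O : Set Plane) (f : Plane → ℝ) : ℝ :=
  ∑ α ∈ multiIndices k, ∫ x in O, weakDeriv O α f x ^ 2

/-- The weak gradient on `O`. -/
def weakGrad (O : Set Plane) (f : Plane → ℝ) : Plane → Plane :=
  fun x => !₂[weakDeriv O (1, 0) f x, weakDeriv O (0, 1) f x]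

/-- The weak divergence on `O`. -/
def weakDiv (O : Set Plane) (F : Plane → Plane) : Plane → ℝ :=
  fun x => weakDeriv O (1, 0) (fun y => F y 0) x + weakDeriv O (0, 1) (fun y => F y 1) x

/-- `∑_{j=0}^3 b^j (3 choose j) ⟨D^j f, D^j f'⟩`, where `D^0 = id`, `D^1 = ∇`, `D^2 = ∇·∇`,
`D^3 = ∇(∇·∇)`. -/
def energyDensity (b : ℝ) (O : Set Plane) (f f' : Plane → ℝ) : Plane → ℝ := fun x =>
  f x * f' x
    + b * 3 * inner ℝ (weakGrad O f x) (weakGrad O f' x)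
    + b ^ 2 * 3 * (weakDiv O (weakGrad O f) x * weakDiv O (weakGrad O f') x)
    + b ^ 3 * inner ℝ (weakGrad O (weakDiv O (weakGrad O f)) x)
        (weakGrad O (weakDiv O (weakGrad O f')) x)

/-! ### Triangulations of the square -/

/-- A conforming triangulation of the closed unit square: a finite, pure two-dimensional simplicial
complex whose underlying space is the square. -/
structure Triangulation where
  complex : Geometry.SimplicialComplex ℝ Plane
  finite_faces : complex.faces.Finite
  pure : ∀ s ∈ complex.faces, ∃ K ∈ complex.faces, s ⊆ K ∧ K.card = 3
  space_eq : complex.space = closedSquare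

namespace Triangulation

/-- The elements of the mesh, each given by its set of three vertices. -/
def cells (T : Triangulation) : Finset (Finset Plane) :=
  T.finite_faces.toFinset.filter fun K => K.card = 3

/-- The interior edges `e = K ∩ K'`, each given by its set of two end points. -/
def interiorEdges (T : Triangulation) : Set (Finset Plane) :=
  {e | e.card = 2 ∧ ∃ K ∈ T.cells, ∃ K' ∈ T.cells, K ≠ K' ∧ e ⊆ K ∧ e ⊆ K'}

end Triangulation

/-- The closed triangle with vertex set `K`. -/
def tri (K : Finset Plane) : Set Plane := convexHull ℝ (K : Set Plane)

/-- The diameter of the largest disc inscribed in the triangle `K`. -/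
def inDiam (K : Finset Plane) : ℝ :=
  sSup {δ : ℝ | 0 ≤ δ ∧ ∃ x, Metric.closedBall x (δ / 2) ⊆ tri K}

/-- The mesh size `h = max_K diam K`. -/
def meshSize (T : Triangulation) : ℝ := ⨆ K : T.cells, Metric.diam (tri K.1)

/-- Shape-regularity of a family of meshes. -/
def ShapeRegular {ι : Type*} (T : ι → Triangulation) : Prop :=
  ∃ c₀ : ℝ, 0 < c₀ ∧ ∀ n, ∀ K ∈ (T n).cells, Metric.diam (tri K) / inDiam K ≤ c₀

/-- Quasi-uniformity of a family of meshes. -/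
def QuasiUniform {ι : Type*} (T : ι → Triangulation) : Prop :=
  ∃ c : ℝ, 0 < c ∧ ∀ n, ∀ K ∈ (T n).cells, c * meshSize (T n) ≤ Metric.diam (tri K)

/-- The broken norm `‖u‖_{k,Ω_h}` of a vector field. -/
def brokenNorm (k : ℕ) (T : Triangulation) (u : Plane → Plane) : ℝ :=
  √(∑ K ∈ T.cells, ∑ i : Fin 2, sobolevNormSq k (interior (tri K)) fun x => u x i)

/-- The broken bilinear form `a_h`. -/
def brokenForm (b : ℝ) (T : Triangulation) (u v : Plane → Plane) : ℝ :=
  ∑ i : Fin 2, ∑ K ∈ T.cells, ∫ x in interior (tri K),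
    energyDensity b (interior (tri K)) (fun y => u y i) (fun y => v y i) x

/-- The energy norm `‖u‖_h = √(a_h(u, u))`. -/
def energyNorm (b : ℝ) (T : Triangulation) (u : Plane → Plane) : ℝ :=
  √(brokenForm b T u u)

/-! ### The nonconforming finite element space -/

/-- Bivariate real polynomials. -/
abbrev Poly : Type := MvPolynomial (Fin 2) ℝ

/-- The value of a polynomial at a point of the plane. -/
def polyAt (p : Poly) (x : Plane) : ℝ := MvPolynomial.eval (fun i => x i) p

/-- `q` is a bubble function of the triangle `K`: a nonzero polynomial of degree at most three that
is nonnegative on `K` and vanishes on the boundary of `K`. It is unique up to a positive factor. -/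
def IsBubble (K : Finset Plane) (q : Poly) : Prop :=
  q ≠ 0 ∧ q.totalDegree ≤ 3 ∧ (∀ x ∈ tri K, 0 ≤ polyAt q x) ∧ ∀ x ∈ frontier (tri K), polyAt q x = 0

/-- The shape function space `P₃ + q_K P₁ + q_K² P₁` of the triangle `K`. -/
def InShapeSpace (K : Finset Plane) (p : Poly) : Prop :=
  ∃ q r s t : Poly, IsBubble K q ∧ r.totalDegree ≤ 3 ∧ s.totalDegree ≤ 1 ∧ t.totalDegree ≤ 1 ∧
    p = r + q * s + q ^ 2 * t

/-- The directional derivative `∂p/∂ν` of a polynomial. -/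
def dirDeriv (ν : Plane) (p : Poly) : Poly :=
  ∑ i : Fin 2, MvPolynomial.C (ν i) * MvPolynomial.pderiv i p

/-- The mean `(1/|e|) ∫_e p ds` over the edge `e` with end points `a`, `b`. -/
def edgeMean (a b : Plane) (p : Poly) : ℝ :=
  ∫ t in (0 : ℝ)..1, polyAt p (AffineMap.lineMap a b t)

/-- `ν` is a unit normal of the edge with end points `a`, `b`. -/
def IsUnitNormal (a b ν : Plane) : Prop := ‖ν‖ = 1 ∧ inner ℝ ν (b - a) = 0

/-- `u` belongs to the scalar finite element space over `T`. On each closed element `u` is a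
polynomial of the shape function space; the degrees of freedom (values and gradients at vertices,
means of the first and second normal derivatives over edges) are shared by the elements that meet in
the vertex or edge, and vanish at the vertices and edges on the boundary of the square.
(Sharing the degrees of freedom makes the pieces agree on common edges, so prescribing `u` on closed
elements is no restriction.) -/
def IsFEFunction (T : Triangulation) (u : Plane → ℝ) : Prop :=
  ∃ p : Finset Plane → Poly,
    (∀ K ∈ T.cells, InShapeSpace K (p K) ∧ ∀ x ∈ tri K, u x = polyAt (p K) x) ∧
    (∀ K ∈ T.cells, ∀ K' ∈ T.cells, ∀ a ∈ K, a ∈ K' →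
      polyAt (p K) a = polyAt (p K') a ∧
      ∀ i, polyAt (MvPolynomial.pderiv i (p K)) a = polyAt (MvPolynomial.pderiv i (p K')) a) ∧
    (∀ K ∈ T.cells, ∀ K' ∈ T.cells, ∀ a ∈ K, a ∈ K' → ∀ b ∈ K, b ∈ K' → a ≠ b →
      ∀ ν, IsUnitNormal a b ν →
        edgeMean a b (dirDeriv ν (p K)) = edgeMean a b (dirDeriv ν (p K')) ∧
        edgeMean a b (dirDeriv ν (dirDeriv ν (p K)))
          = edgeMean a b (dirDeriv ν (dirDeriv ν (p K')))) ∧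
    (∀ K ∈ T.cells, ∀ a ∈ K, a ∈ frontier closedSquare →
      polyAt (p K) a = 0 ∧ ∀ i, polyAt (MvPolynomial.pderiv i (p K)) a = 0) ∧
    (∀ K ∈ T.cells, ∀ a ∈ K, ∀ b ∈ K, a ≠ b → segment ℝ a b ⊆ frontier closedSquare →
      ∀ ν, IsUnitNormal a b ν →
        edgeMean a b (dirDeriv ν (p K)) = 0 ∧
        edgeMean a b (dirDeriv ν (dirDeriv ν (p K))) = 0)

/-- `u` belongs to the vector-valued finite element space over `T`. -/
def IsVectorFEFunction (T : Triangulation) (u : Plane → Plane) : Prop :=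
  ∀ i : Fin 2, IsFEFunction T fun x => u x i

/-! ### Curves -/

/-- The image of the curve `g` is a union of interior edges of the mesh `T`. -/
def ComprisedOfInteriorEdges (T : Triangulation) (g : ℝ → Plane) : Prop :=
  ∃ S ⊆ T.interiorEdges, range g = ⋃ e ∈ S, convexHull ℝ (e : Set Plane)

/-- `g` is affine on each interval of some finite subdivision of `[0, 2π]`. -/
def PiecewiseAffine (g : ℝ → Plane) : Prop :=
  ∃ (N : ℕ) (t : ℕ → ℝ), Monotone t ∧ t 0 = 0 ∧ t N = 2 * Real.pi ∧
    ∀ j < N, ∃ A : ℝ →ᵃ[ℝ] Plane, ∀ θ ∈ Icc (t j) (t (j + 1)), g θ = A θ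

/-- Lebesgue measure on one period of `S¹ = ℝ / 2πℤ`. -/
def circleMeasure : Measure ℝ := volume.restrict (Icc 0 (2 * Real.pi))

end TriHelmholtz

end

noncomputable section

namespace TriHelmholtz

open scoped ENNReal

section

/-! ### Piecewise smooth functions on an interval -/

/-! Everything rests on one elementary device: on an interval of positive length a function is
bounded at each point by its mean plus the integral of its derivative. Applied transversally to a
line, it turns integrals over the line into integrals over a strip or band of the square.

Continuous representative. For a smooth `F`, an increment along direction `i` is an integral of `∂_i
F` over a segment, hence is bounded by `∂_i F` and `∂_j ∂_i F` over a strip whose area is at most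
the length of the segment. By Cauchy-Schwarz the mollifications of `v` are therefore uniformly
1/2-Hölder on inner squares, and their limit is continuous (`exists_continuous_representative`).

Part 1 holds at every point of the open square. The finite element function is continuous, but its
gradient jumps across edges, so the Hölder argument does not apply to it directly. On each cell `∂_i
u` is split into the affine interpolant of its vertex values and a remainder. Since gradients are
shared at vertices, the interpolants glue to a continuous piecewise affine function, to which the
strip argument applies; the remainder is at most the cell diameter times the second derivatives. All
pointwise bounds on a cell are replaced by `L²` norms through an inverse inequality whose constant
depends on the degree alone (`exists_inverse_inequality`), and shape regularity compares diameters
with areas. The outcome is `abs_sub_pt_le_of_isPiecewise`: increments over a distance at most `δ`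
are `O(√δ)`, uniformly over all meshes of size at most `δ`. Broken `H³` convergence keeps the
constants bounded and gives `L²` convergence; a small `L²` error provides one good point in every
square of side `δ`, and the increment bound carries it to the given point (`tendsto_of_brokenSq`).

Part 2 has to work without uniform control of second derivatives, so only the `H¹` part of the
energy is kept. A finite element function is Lipschitz, so its weak gradient on the whole square is
the cell-wise gradient, and `w - u` lies in `H¹` of the square with norm bounded by the energy. An
affine piece of the curve with nonzero velocity has an `L¹` trace estimate, proved by mollification
and Fatou (`lintegral_enorm_trace_le`). Injectivity makes the velocity of each nondegenerate piece
nonzero, so the traces converge in `L¹` and a subsequence converges almost everywhere. -/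

theorem abs_sub_le_integral_of_piecewise {ι : Type*} (s : Finset ι) (J : ι → Set ℝ)
    (F : ℝ → ℝ) (G G' : ι → ℝ → ℝ) (D : ℝ → ℝ) {a b : ℝ} (hab : a ≤ b)
    (hJc : ∀ k ∈ s, IsClosed (J k)) (hJo : ∀ k ∈ s, (J k).OrdConnected)
    (hcov : Icc a b ⊆ ⋃ k ∈ s, J k)
    (hF : ∀ k ∈ s, ∀ t ∈ J k, t ∈ Icc a b → F t = G k t)
    (hG : ∀ k ∈ s, ∀ t, HasDerivAt (G k) (G' k t) t) (hG' : ∀ k ∈ s, Continuous (G' k))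
    (hD : IntegrableOn D (Icc a b))
    (hbound : ∀ k ∈ s, ∀ t ∈ J k, t ∈ Icc a b → |G' k t| ≤ D t) :
    |F b - F a| ≤ ∫ t in a..b, D t := by
  have hDi : IntervalIntegrable D volume a b :=
    (intervalIntegrable_iff_integrableOn_Icc_of_le hab).2 hD
  have hFc : ContinuousOn F (Icc a b) := by
    have h1 : Icc a b ⊆ ⋃ k : s, J k ∩ Icc a b := by
      intro t ht
      obtain ⟨k, hk, htk⟩ := mem_iUnion₂.1 (hcov ht)
      exact mem_iUnion.2 ⟨⟨k, hk⟩, htk, ht⟩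
    refine ContinuousOn.mono ?_ h1
    refine (locallyFinite_of_finite _).continuousOn_iUnion
      (fun k => (hJc k k.2).inter isClosed_Icc) fun k => ?_
    have : ContinuousOn (G k) (J k ∩ Icc a b) :=
      fun t _ => (hG k k.2 t).continuousAt.continuousWithinAt
    exact this.congr fun t ht => hF k k.2 t ht.1 ht.2
  have hPc : ContinuousOn (fun t => ∫ u in a..t, D u) (Icc a b) := by
    have := intervalIntegral.continuousOn_primitive_interval (μ := volume) (f := D) (a := a)
      (b := b)
      (by rwa [uIcc_of_le hab])
    rwa [uIcc_of_le hab] at this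
  -- Real induction: this set is closed in `[a, b]`, contains `a`, and is shown to reach beyond each
  -- of its points below `b`.
  set S : Set ℝ := {t | |F t - F a| ≤ ∫ u in a..t, D u} with hS
  have hclosed : IsClosed (S ∩ Icc a b) := by
    have : S ∩ Icc a b = {t ∈ Icc a b | |F t - F a| ≤ ∫ u in a..t, D u} := by
      ext t; simp [S, and_comm]
    rw [this]
    exact isClosed_Icc.isClosed_le (hFc.sub continuousOn_const).abs hPc
  have hsub : Icc a b ⊆ S := by
    refine hclosed.Icc_subset_of_forall_exists_gt (by simp [S]) ?_
    rintro x ⟨hxS, hx⟩ y hy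
    -- The pieces are finitely many, so one of them has points arbitrarily close to `x` from the
    -- right. It is closed, so it contains `x`, and order-convex, so it contains a whole interval to
    -- the right of `x`; there the fundamental theorem of calculus applies to a single smooth piece.
    obtain ⟨k, hk, hkx⟩ : ∃ k ∈ s, ∃ᶠ t in 𝓝[>] x, t ∈ J k := by
      by_contra! hcon
      have h2 : ∀ᶠ t in 𝓝[>] x, ∀ k ∈ s, t ∉ J k := by
        rw [Filter.eventually_all_finset]
        intro k hk
        simpa [Filter.not_frequently] using hcon k hk
      have h3 : ∀ᶠ t in 𝓝[>] x, t ∈ Ioo x b := Ioo_mem_nhdsGT hx.2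
      obtain ⟨t, ht, ht'⟩ := (h2.and h3).exists
      obtain ⟨k, hk, htk⟩ := mem_iUnion₂.1 (hcov ⟨hx.1.trans ht'.1.le, ht'.2.le⟩)
      exact ht k hk htk
    have hxk : x ∈ J k := by
      have : x ∈ closure (J k) := by
        rw [mem_closure_iff_frequently]
        exact hkx.filter_mono nhdsWithin_le_nhds
      rwa [(hJc k hk).closure_eq] at this
    obtain ⟨t, htk, ht⟩ := (hkx.and_eventually
      (Ioo_mem_nhdsGT (lt_min hy hx.2) : ∀ᶠ t in 𝓝[>] x, t ∈ Ioo x (min y b))).exists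
    have htb : t ≤ b := ht.2.le.trans (min_le_right _ _)
    have hsubJ : Icc x t ⊆ J k := (hJo k hk).out hxk htk
    have hxt : x ≤ t := ht.1.le
    have hi1 : IntervalIntegrable D volume a x :=
      hDi.mono_set (by rw [uIcc_of_le hab, uIcc_of_le hx.1]; exact Icc_subset_Icc_right hx.2.le)
    have hi2 : IntervalIntegrable D volume x t :=
      hDi.mono_set (by rw [uIcc_of_le hab, uIcc_of_le hxt]; exact Icc_subset_Icc hx.1 htb)
    have hstep : |F t - F x| ≤ ∫ u in x..t, D u := by
      rw [hF k hk t htk ⟨hx.1.trans hxt, htb⟩, hF k hk x hxk ⟨hx.1, hx.2.le⟩,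
        ← intervalIntegral.integral_eq_sub_of_hasDerivAt (fun u _ => hG k hk u)
          ((hG' k hk).intervalIntegrable _ _)]
      rw [← Real.norm_eq_abs]
      refine intervalIntegral.norm_integral_le_of_norm_le hxt ?_ hi2
      refine Eventually.of_forall fun u hu => ?_
      have hu' : u ∈ Icc x t := Ioc_subset_Icc_self hu
      exact hbound k hk u (hsubJ hu') ⟨hx.1.trans hu'.1, hu'.2.trans htb⟩
    refine ⟨t, ?_, ht.1, ht.2.le.trans (min_le_left _ _)⟩
    calc |F t - F a| ≤ |F t - F x| + |F x - F a| := abs_sub_le _ _ _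
      _ ≤ (∫ u in x..t, D u) + ∫ u in a..x, D u := add_le_add hstep hxS
      _ = ∫ u in a..t, D u := by
        rw [add_comm, intervalIntegral.integral_add_adjacent_intervals hi1 hi2]
  exact hsub (right_mem_Icc.2 hab)

/-- With values in `ℝ≥0∞` no integrability of `D` has to be supplied: an infinite integral makes the
bound trivial. -/
theorem enorm_sub_le_lintegral_of_piecewise {ι : Type*} (s : Finset ι) (J : ι → Set ℝ)
    (F : ℝ → ℝ) (G G' : ι → ℝ → ℝ) (D : ℝ → ℝ≥0∞) {a b : ℝ} (hab : a ≤ b)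
    (hJc : ∀ k ∈ s, IsClosed (J k)) (hJo : ∀ k ∈ s, (J k).OrdConnected)
    (hcov : Icc a b ⊆ ⋃ k ∈ s, J k)
    (hF : ∀ k ∈ s, ∀ t ∈ J k, t ∈ Icc a b → F t = G k t)
    (hG : ∀ k ∈ s, ∀ t, HasDerivAt (G k) (G' k t) t) (hG' : ∀ k ∈ s, Continuous (G' k))
    (hD : Measurable D) (hDtop : ∀ t, D t ≠ ⊤)
    (hbound : ∀ k ∈ s, ∀ t ∈ J k, t ∈ Icc a b → ‖G' k t‖ₑ ≤ D t) :
    ‖F b - F a‖ₑ ≤ ∫⁻ t in Icc a b, D t := by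
  by_cases htop : ∫⁻ t in Icc a b, D t = ⊤
  · rw [htop]; exact le_top
  have hDint : IntegrableOn (fun t => (D t).toReal) (Icc a b) :=
    integrable_toReal_of_lintegral_ne_top hD.aemeasurable htop
  have h := abs_sub_le_integral_of_piecewise s J F G G' (fun t => (D t).toReal) hab hJc hJo hcov hF
    hG hG' hDint fun k hk t ht ht' => by
      have := ENNReal.toReal_mono (hDtop t) (hbound k hk t ht ht')
      simpa using this
  rw [intervalIntegral.integral_of_le hab, ← integral_Icc_eq_integral_Ioc,
    integral_toReal hD.aemeasurable (Eventually.of_forall fun t => (hDtop t).lt_top)] at h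
  rw [← ofReal_norm, Real.norm_eq_abs]
  exact ENNReal.ofReal_le_of_le_toReal h

theorem enorm_sub_le_lintegral_deriv {f f' : ℝ → ℝ} {a b : ℝ} (hab : a ≤ b)
    (hf : ∀ t, HasDerivAt f (f' t) t) (hf' : Continuous f') :
    ‖f b - f a‖ₑ ≤ ∫⁻ t in Icc a b, ‖f' t‖ₑ :=
  enorm_sub_le_lintegral_of_piecewise {()} (fun _ => univ) f (fun _ => f) (fun _ => f')
    (fun t => ‖f' t‖ₑ) hab (by simp) (by simp [ordConnected_univ])
    (fun t _ => by simp) (by simp)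
    (by simpa using hf) (by simpa using hf') hf'.enorm.measurable (by simp) (by simp)

/-- If the oscillation of `f` on `[a, b]` is at most `B`, then `f` is bounded by its mean
and `B`. -/
theorem enorm_mul_le_lintegral_add {f : ℝ → ℝ} {a b c : ℝ} {B : ℝ≥0∞}
    (h : ∀ y ∈ Icc a b, ‖f c - f y‖ₑ ≤ B) :
    ‖f c‖ₑ * ENNReal.ofReal (b - a) ≤
      (∫⁻ y in Icc a b, ‖f y‖ₑ) + B * ENNReal.ofReal (b - a) := by
  have h1 : ∫⁻ _y in Icc a b, ‖f c‖ₑ ≤ ∫⁻ y in Icc a b, (‖f y‖ₑ + B) := by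
    refine setLIntegral_mono' measurableSet_Icc fun y hy => ?_
    calc ‖f c‖ₑ = ‖f y + (f c - f y)‖ₑ := by rw [add_sub_cancel]
      _ ≤ ‖f y‖ₑ + ‖f c - f y‖ₑ := enorm_add_le _ _
      _ ≤ _ := by gcongr; exact h y hy
  rw [lintegral_add_right _ measurable_const] at h1
  simpa using h1

/-- Two-sided fundamental estimate: differences of a function on an interval are bounded by the
integral of `D` as soon as this holds for ordered pairs. -/
theorem enorm_sub_le_of_le {f : ℝ → ℝ} {a b : ℝ} {D : ℝ → ℝ≥0∞}
    (h : ∀ x ∈ Icc a b, ∀ y ∈ Icc a b, x ≤ y → ‖f y - f x‖ₑ ≤ ∫⁻ t in Icc x y, D t) :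
    ∀ x ∈ Icc a b, ∀ y ∈ Icc a b, ‖f x - f y‖ₑ ≤ ∫⁻ t in Icc a b, D t := by
  intro x hx y hy
  rcases le_total x y with hxy | hxy
  · rw [← enorm_neg, neg_sub]
    exact (h x hx y hy hxy).trans (lintegral_mono_set (Icc_subset_Icc hx.1 hy.2))
  · exact (h y hy x hx hxy).trans (lintegral_mono_set (Icc_subset_Icc hy.1 hx.2))

/-! ### Coordinates -/

/-- The point whose `i`-th coordinate is `s` and whose other coordinate is `y`. -/
def pt (i : Fin 2) (s y : ℝ) : Plane := WithLp.toLp 2 fun k => if k = i then s else y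

@[simp] theorem pt_apply_self (i : Fin 2) (s y : ℝ) : pt i s y i = s := by simp [pt]

theorem pt_apply_of_ne {i k : Fin 2} (h : k ≠ i) (s y : ℝ) : pt i s y k = y := by simp [pt, h]

theorem pt_self (i j : Fin 2) (h : j ≠ i) (x : Plane) : pt i (x i) (x j) = x := by
  ext k
  by_cases hk : k = i
  · subst hk; simp
  · have : k = j := by omega
    subst this; simp [pt, hk]

theorem pt_eq (i j : Fin 2) (h : j ≠ i) (s y : ℝ) :
    pt i s y = s • EuclideanSpace.single i (1 : ℝ) + y • EuclideanSpace.single j (1 : ℝ) := by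
  ext k
  by_cases hk : k = i
  · subst hk; simp [h.symm]
  · have : k = j := by omega
    subst this; simp [pt, hk]

theorem pt_swap (i j : Fin 2) (h : j ≠ i) (s y : ℝ) : pt i s y = pt j y s := by
  rw [pt_eq i j h, pt_eq j i h.symm, add_comm]

theorem continuous_pt (i : Fin 2) : Continuous fun z : ℝ × ℝ => pt i z.1 z.2 := by
  obtain ⟨j, hj⟩ : ∃ j : Fin 2, j ≠ i := exists_ne i
  simp_rw [pt_eq i j hj]
  fun_prop

theorem measurePreserving_pt (i : Fin 2) :
    MeasurePreserving (fun z : ℝ × ℝ => pt i z.1 z.2) volume volume := by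
  have h0 : MeasurePreserving (fun z : ℝ × ℝ => pt 0 z.1 z.2) volume volume := by
    have := (PiLp.volume_preserving_toLp (Fin 2)).comp (volume_preserving_finTwoArrow ℝ).symm
    have heq : (fun z : ℝ × ℝ => pt 0 z.1 z.2) =
        WithLp.toLp 2 ∘ (MeasurableEquiv.finTwoArrow (α := ℝ)).symm := by
      funext z
      refine WithLp.ofLp_injective 2 (funext fun k => ?_)
      fin_cases k <;> rfl
    rw [heq]
    exact this
  fin_cases i
  · exact h0
  · have h1 : MeasurePreserving (Prod.swap : ℝ × ℝ → ℝ × ℝ) volume volume :=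
      Measure.measurePreserving_swap
    convert h0.comp h1 using 1
    funext z
    exact pt_swap 1 0 (by decide) _ _

theorem lintegral_eq_lintegral_pt (i : Fin 2) {F : Plane → ℝ≥0∞} (hF : Measurable F) :
    ∫⁻ x, F x = ∫⁻ s, ∫⁻ y, F (pt i s y) := by
  rw [← (measurePreserving_pt i).lintegral_comp hF, Measure.volume_eq_prod,
    lintegral_prod (fun z : ℝ × ℝ => F (pt i z.1 z.2))
      (hF.comp (continuous_pt i).measurable).aemeasurable]

theorem hasDerivAt_comp_pt {f : Plane → ℝ} {x' : Plane →L[ℝ] ℝ} (i : Fin 2) {s y : ℝ}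
    (hf : HasFDerivAt f x' (pt i s y)) :
    HasDerivAt (fun t => f (pt i t y)) (x' (EuclideanSpace.single i 1)) s := by
  obtain ⟨j, hj⟩ : ∃ j : Fin 2, j ≠ i := exists_ne i
  have h1 : HasDerivAt (fun t => pt i t y) (EuclideanSpace.single i (1 : ℝ)) s := by
    simp_rw [pt_eq i j hj]
    simpa using ((hasDerivAt_id s).smul_const (EuclideanSpace.single i (1 : ℝ))).add_const
      (y • EuclideanSpace.single j (1 : ℝ))
  exact hf.comp_hasDerivAt s h1

end

section

/-! ### Classical derivatives of test functions -/

theorem contDiff_classicalPartial {φ : Plane → ℝ} (h : ContDiff ℝ ∞ φ) (i : Fin 2) :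
    ContDiff ℝ ∞ (classicalPartial i φ) := by
  have h1 : ContDiff ℝ ∞ (fderiv ℝ φ) := h.fderiv_right (by simp)
  exact h1.clm_apply contDiff_const

theorem tsupport_classicalPartial_subset (i : Fin 2) (φ : Plane → ℝ) :
    tsupport (classicalPartial i φ) ⊆ tsupport φ := by
  refine closure_minimal (fun x hx => ?_) (isClosed_tsupport φ)
  refine tsupport_fderiv_subset ℝ (f := φ) (subset_tsupport _ ?_)
  intro h0
  apply hx
  simp [classicalPartial, h0]

theorem classicalPartial_comm {φ : Plane → ℝ} (h : ContDiff ℝ ∞ φ) (i j : Fin 2) :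
    classicalPartial i (classicalPartial j φ) = classicalPartial j (classicalPartial i φ) := by
  funext x
  have hd : ContDiff ℝ ∞ (fderiv ℝ φ) := h.fderiv_right (by simp)
  have hd' : DifferentiableAt ℝ (fderiv ℝ φ) x := hd.differentiable (by simp) x
  have hsym : IsSymmSndFDerivAt ℝ φ x :=
    (h.contDiffAt (x := x)).isSymmSndFDerivAt
      (by simp only [minSmoothness_of_isRCLikeNormedField]; exact WithTop.coe_le_coe.2 le_top)
  have key : ∀ k l : Fin 2, classicalPartial k (classicalPartial l φ) x =
      fderiv ℝ (fderiv ℝ φ) x (EuclideanSpace.single k 1) (EuclideanSpace.single l 1) := by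
    intro k l
    unfold classicalPartial
    rw [fderiv_clm_apply hd' (differentiableAt_const _)]
    simp
  rw [key, key, hsym]

theorem contDiff_iterate_classicalPartial {φ : Plane → ℝ} (h : ContDiff ℝ ∞ φ) (i : Fin 2)
    (n : ℕ) : ContDiff ℝ ∞ ((classicalPartial i)^[n] φ) := by
  induction n with
  | zero => exact h
  | succ n ih =>
    rw [Function.iterate_succ_apply']
    exact contDiff_classicalPartial ih i

theorem contDiff_classicalDeriv {φ : Plane → ℝ} (h : ContDiff ℝ ∞ φ) (α : ℕ × ℕ) :
    ContDiff ℝ ∞ (classicalDeriv α φ) :=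
  contDiff_iterate_classicalPartial (contDiff_iterate_classicalPartial h 1 _) 0 _

theorem tsupport_iterate_classicalPartial_subset (i : Fin 2) (n : ℕ) (φ : Plane → ℝ) :
    tsupport ((classicalPartial i)^[n] φ) ⊆ tsupport φ := by
  induction n with
  | zero => exact subset_rfl
  | succ n ih =>
    rw [Function.iterate_succ_apply']
    exact (tsupport_classicalPartial_subset i _).trans ih

theorem tsupport_classicalDeriv_subset (α : ℕ × ℕ) (φ : Plane → ℝ) :
    tsupport (classicalDeriv α φ) ⊆ tsupport φ :=
  (tsupport_iterate_classicalPartial_subset 0 _ _).trans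
    (tsupport_iterate_classicalPartial_subset 1 _ _)

theorem hasCompactSupport_classicalDeriv {φ : Plane → ℝ} (h : HasCompactSupport φ) (α : ℕ × ℕ) :
    HasCompactSupport (classicalDeriv α φ) :=
  h.mono' ((subset_tsupport _).trans (tsupport_classicalDeriv_subset α φ))

theorem iterate_classicalPartial_comm {φ : Plane → ℝ} (h : ContDiff ℝ ∞ φ) (i j : Fin 2)
    (m n : ℕ) : (classicalPartial i)^[m] ((classicalPartial j)^[n] φ) =
      (classicalPartial j)^[n] ((classicalPartial i)^[m] φ) := by
  have one : ∀ (n : ℕ) (ψ : Plane → ℝ), ContDiff ℝ ∞ ψ →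
      classicalPartial i ((classicalPartial j)^[n] ψ) =
        (classicalPartial j)^[n] (classicalPartial i ψ) := by
    intro n
    induction n with
    | zero => intro ψ _; rfl
    | succ n ih =>
      intro ψ hψ
      rw [Function.iterate_succ_apply, Function.iterate_succ_apply, ih _
        (contDiff_classicalPartial hψ j),
        classicalPartial_comm hψ]
  induction m with
  | zero => rfl
  | succ m ih =>
    rw [Function.iterate_succ_apply', ih, one n _ (contDiff_iterate_classicalPartial h i m),
      Function.iterate_succ_apply']

theorem classicalDeriv_classicalDeriv {φ : Plane → ℝ} (h : ContDiff ℝ ∞ φ) (α β : ℕ × ℕ) :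
    classicalDeriv α (classicalDeriv β φ) = classicalDeriv (α + β) φ := by
  unfold classicalDeriv
  rw [← iterate_classicalPartial_comm (contDiff_iterate_classicalPartial h 1 _) 0 1,
    ← Function.iterate_add_apply, ← Function.iterate_add_apply]
  rfl

/-! ### Calculus of weak derivatives -/

variable {O O' : Set Plane} {α β : ℕ × ℕ} {f f' w w' : Plane → ℝ}

theorem integrable_mul_of_tsupport_subset (hf : LocallyIntegrableOn f O)
    {φ : Plane → ℝ} (hφ : Continuous φ) (hc : HasCompactSupport φ) (hs : tsupport φ ⊆ O) :
    IntegrableOn (fun x => f x * φ x) O := by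
  have h1 : IntegrableOn f (tsupport φ) :=
    hf.integrableOn_compact_subset hs hc
  have h2 : IntegrableOn (fun x => f x * φ x) (tsupport φ) :=
    h1.mul_continuousOn hφ.continuousOn hc
  refine (h2.integrable_of_forall_notMem_eq_zero fun x hx => ?_).integrableOn
  rw [image_eq_zero_of_notMem_tsupport hx, mul_zero]

theorem setIntegral_eq_integral_of_tsupport_subset {φ : Plane → ℝ} (hs : tsupport φ ⊆ O) :
    ∫ x in O, f x * φ x = ∫ x, f x * φ x :=
  setIntegral_eq_integral_of_forall_compl_eq_zero fun x hx => by
    rw [image_eq_zero_of_notMem_tsupport fun h => hx (hs h), mul_zero]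

/-- The fundamental lemma of the calculus of variations. It allows the arbitrarily chosen
`weakDeriv` to be replaced by any explicit weak derivative. -/
theorem HasWeakDeriv.ae_eq (hO : IsOpen O) (h : HasWeakDeriv O α f w)
    (h' : HasWeakDeriv O α f w') : w =ᵐ[volume.restrict O] w' := by
  have key : ∀ᵐ x ∂volume, x ∈ O → w x - w' x = 0 := by
    refine hO.ae_eq_zero_of_integral_contDiff_smul_eq_zero (h.2.1.sub h'.2.1) fun φ hφ hc hs => ?_
    have e1 := h.2.2 φ hφ hc hs
    rw [h'.2.2 φ hφ hc hs] at e1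
    have e2 := mul_left_cancel₀ (pow_ne_zero _ (by norm_num : (-1 : ℝ) ≠ 0)) e1
    have i1 := integrable_mul_of_tsupport_subset h.2.1 hφ.continuous hc hs
    have i2 := integrable_mul_of_tsupport_subset h'.2.1 hφ.continuous hc hs
    have e3 : ∫ x, φ x • (w x - w' x) = ∫ x in O, (w x * φ x - w' x * φ x) := by
      rw [setIntegral_eq_integral_of_forall_compl_eq_zero]
      · congr 1; funext x; simp only [smul_eq_mul]; ring
      · intro x hx
        rw [image_eq_zero_of_notMem_tsupport fun h => hx (hs h)]; ring
    rw [e3, integral_sub i1 i2, e2, sub_self]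
  filter_upwards [ae_restrict_of_ae key, ae_restrict_mem hO.measurableSet] with x h1 h2
  exact sub_eq_zero.1 (h1 h2)

theorem HasWeakDeriv.weakDeriv (h : HasWeakDeriv O α f w) :
    HasWeakDeriv O α f (weakDeriv O α f) := by
  have hex : ∃ w, HasWeakDeriv O α f w := ⟨w, h⟩
  rw [TriHelmholtz.weakDeriv, dif_pos hex]
  exact hex.choose_spec

theorem HasWeakDeriv.weakDeriv_ae_eq (hO : IsOpen O) (h : HasWeakDeriv O α f w) :
    TriHelmholtz.weakDeriv O α f =ᵐ[volume.restrict O] w :=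
  h.weakDeriv.ae_eq hO h

theorem locallyIntegrableOn_congr_ae (h : LocallyIntegrableOn f O)
    (he : f =ᵐ[volume.restrict O] f') : LocallyIntegrableOn f' O := by
  intro x hx
  obtain ⟨u, hu, hfu⟩ := h x hx
  refine ⟨u ∩ O, inter_mem hu self_mem_nhdsWithin, ?_⟩
  refine (hfu.mono_set inter_subset_left).congr_fun_ae ?_
  exact ae_restrict_of_ae_restrict_of_subset inter_subset_right he

theorem HasWeakDeriv.congr (h : HasWeakDeriv O α f w)
    (hf : f =ᵐ[volume.restrict O] f') (hw : w =ᵐ[volume.restrict O] w') :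
    HasWeakDeriv O α f' w' := by
  refine ⟨locallyIntegrableOn_congr_ae h.1 hf, locallyIntegrableOn_congr_ae h.2.1 hw,
    fun φ hφ hc hs => ?_⟩
  have e1 : ∫ x in O, f' x * classicalDeriv α φ x = ∫ x in O, f x * classicalDeriv α φ x :=
    integral_congr_ae (by filter_upwards [hf] with x hx; rw [hx])
  have e2 : ∫ x in O, w' x * φ x = ∫ x in O, w x * φ x :=
    integral_congr_ae (by filter_upwards [hw] with x hx; rw [hx])
  rw [e1, e2, h.2.2 φ hφ hc hs]

/-- A test function supported in the smaller set is one for the larger set, and both identities are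
identities of integrals over the whole plane. -/
theorem HasWeakDeriv.mono (h : HasWeakDeriv O α f w) (hs : O' ⊆ O) :
    HasWeakDeriv O' α f w := by
  refine ⟨h.1.mono_set hs, h.2.1.mono_set hs, fun φ hφ hc hsφ => ?_⟩
  have e := h.2.2 φ hφ hc (hsφ.trans hs)
  have hd := (tsupport_classicalDeriv_subset α φ).trans hsφ
  rw [setIntegral_eq_integral_of_tsupport_subset hd, setIntegral_eq_integral_of_tsupport_subset hsφ]
  rwa [setIntegral_eq_integral_of_tsupport_subset (hd.trans hs),
    setIntegral_eq_integral_of_tsupport_subset (hsφ.trans hs)] at e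

theorem HasWeakDeriv.sub (h : HasWeakDeriv O α f w)
    (h' : HasWeakDeriv O α f' w') :
    HasWeakDeriv O α (fun x => f x - f' x) (fun x => w x - w' x) := by
  refine ⟨h.1.sub h'.1, h.2.1.sub h'.2.1, fun φ hφ hc hs => ?_⟩
  have hd := (tsupport_classicalDeriv_subset α φ).trans hs
  have hcd := (contDiff_classicalDeriv hφ α).continuous
  have hcc := hasCompactSupport_classicalDeriv hc α
  simp_rw [sub_mul]
  rw [integral_sub (integrable_mul_of_tsupport_subset h.1 hcd hcc hd)
    (integrable_mul_of_tsupport_subset h'.1 hcd hcc hd),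
    integral_sub (integrable_mul_of_tsupport_subset h.2.1 hφ.continuous hc hs)
    (integrable_mul_of_tsupport_subset h'.2.1 hφ.continuous hc hs),
    h.2.2 φ hφ hc hs, h'.2.2 φ hφ hc hs, mul_sub]

theorem HasWeakDeriv.add (h : HasWeakDeriv O α f w)
    (h' : HasWeakDeriv O α f' w') :
    HasWeakDeriv O α (fun x => f x + f' x) (fun x => w x + w' x) := by
  refine ⟨h.1.add h'.1, h.2.1.add h'.2.1, fun φ hφ hc hs => ?_⟩
  have hd := (tsupport_classicalDeriv_subset α φ).trans hs
  have hcd := (contDiff_classicalDeriv hφ α).continuous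
  have hcc := hasCompactSupport_classicalDeriv hc α
  simp_rw [add_mul]
  rw [integral_add (integrable_mul_of_tsupport_subset h.1 hcd hcc hd)
    (integrable_mul_of_tsupport_subset h'.1 hcd hcc hd),
    integral_add (integrable_mul_of_tsupport_subset h.2.1 hφ.continuous hc hs)
    (integrable_mul_of_tsupport_subset h'.2.1 hφ.continuous hc hs),
    h.2.2 φ hφ hc hs, h'.2.2 φ hφ hc hs, mul_add]

/-- A weak derivative of a weak derivative. -/
theorem HasWeakDeriv.of_add (h : HasWeakDeriv O α f w) (h' : HasWeakDeriv O (α + β) f w') :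
    HasWeakDeriv O β w w' := by
  refine ⟨h.2.1, h'.2.1, fun φ hφ hc hs => ?_⟩
  -- Testing `f` against `∂^α ∂^β φ` and using both weak derivatives leaves the sign `(-1)^|α|` on
  -- each side, which squares to one.
  have e1 := h.2.2 (classicalDeriv β φ) (contDiff_classicalDeriv hφ β)
    (hasCompactSupport_classicalDeriv hc β) ((tsupport_classicalDeriv_subset β φ).trans hs)
  rw [classicalDeriv_classicalDeriv hφ, h'.2.2 φ hφ hc hs] at e1
  have e2 : ((-1 : ℝ) ^ (α.1 + α.2)) * (-1) ^ (α.1 + α.2) = 1 := by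
    rw [← mul_pow]; simp
  have e3 : ((-1 : ℝ) ^ ((α + β).1 + (α + β).2)) =
      (-1) ^ (α.1 + α.2) * (-1) ^ (β.1 + β.2) := by
    rw [← pow_add]; congr 1; simp only [Prod.fst_add, Prod.snd_add]; ring
  rw [e3] at e1
  calc ∫ x in O, w x * classicalDeriv β φ x
      = ((-1 : ℝ) ^ (α.1 + α.2) * (-1) ^ (α.1 + α.2)) * ∫ x in O, w x * classicalDeriv β φ x := by
        rw [e2, one_mul]
    _ = (-1) ^ (α.1 + α.2) * ((-1) ^ (α.1 + α.2) * (-1) ^ (β.1 + β.2) * ∫ x in O, w' x * φ x) := by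
        rw [e1]; ring
    _ = ((-1 : ℝ) ^ (α.1 + α.2) * (-1) ^ (α.1 + α.2)) * ((-1) ^ (β.1 + β.2) *
          ∫ x in O, w' x * φ x) := by ring
    _ = _ := by rw [e2, one_mul]

theorem hasWeakDeriv_zero (hf : LocallyIntegrableOn f O) : HasWeakDeriv O (0, 0) f f :=
  ⟨hf, hf, fun φ _ _ _ => by simp [classicalDeriv]⟩

theorem HasWeakDeriv.ae_eq_of_zero (hO : IsOpen O) (h : HasWeakDeriv O (0, 0) f w) :
    f =ᵐ[volume.restrict O] w :=
  (hasWeakDeriv_zero h.1).ae_eq hO h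

/-! ### Polynomials -/

theorem contDiff_polyAt (p : Poly) : ContDiff ℝ ∞ (polyAt p) := by
  unfold polyAt
  induction p using MvPolynomial.induction_on with
  | C a => simpa using contDiff_const
  | add p q hp hq => simpa using hp.add hq
  | mul_X p i hp =>
    simp only [map_mul, MvPolynomial.eval_X]
    exact hp.mul (EuclideanSpace.proj i : Plane →L[ℝ] ℝ).contDiff

theorem continuous_polyAt (p : Poly) : Continuous (polyAt p) := (contDiff_polyAt p).continuous

theorem classicalPartial_polyAt (i : Fin 2) (p : Poly) :
    classicalPartial i (polyAt p) = polyAt (MvPolynomial.pderiv i p) := by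
  funext x
  unfold classicalPartial
  have hd : ∀ q : Poly, DifferentiableAt ℝ (polyAt q) x :=
    fun q => (contDiff_polyAt q).differentiable (by simp) x
  induction p using MvPolynomial.induction_on with
  | C a =>
    have : polyAt (MvPolynomial.C a) = fun _ => a := by funext y; simp [polyAt]
    rw [this]; simp [polyAt]
  | add p q hp hq =>
    have : polyAt (p + q) = fun y => polyAt p y + polyAt q y := by funext y; simp [polyAt]
    rw [this, fderiv_fun_add (hd p) (hd q), map_add]
    simp only [_root_.add_apply, hp, hq]
    simp [polyAt]
  | mul_X p k hp =>
    have hX : polyAt (MvPolynomial.X k) = (EuclideanSpace.proj k : Plane →L[ℝ] ℝ) := by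
      funext y; simp [polyAt]
    have : polyAt (p * MvPolynomial.X k) = fun y => polyAt p y * polyAt (MvPolynomial.X k) y := by
      funext y; simp [polyAt]
    rw [this, fderiv_fun_mul (hd p) (hd _)]
    simp only [_root_.add_apply, _root_.smul_apply, hp]
    rw [hX, ContinuousLinearMap.fderiv]
    simp only [Derivation.leibniz, MvPolynomial.pderiv_X]
    by_cases hik : i = k
    · subst hik; simp [polyAt]
    · simp [polyAt, Ne.symm hik]

theorem iterate_classicalPartial_polyAt (i : Fin 2) (n : ℕ) (p : Poly) :
    (classicalPartial i)^[n] (polyAt p) = polyAt ((MvPolynomial.pderiv i)^[n] p) := by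
  induction n generalizing p with
  | zero => rfl
  | succ n ih => rw [Function.iterate_succ_apply, classicalPartial_polyAt, ih,
      Function.iterate_succ_apply]

/-- The formal partial derivative of a polynomial for a multi-index. -/
def polyDeriv (α : ℕ × ℕ) (p : Poly) : Poly :=
  (MvPolynomial.pderiv 0)^[α.1] ((MvPolynomial.pderiv 1)^[α.2] p)

theorem classicalDeriv_polyAt (α : ℕ × ℕ) (p : Poly) :
    classicalDeriv α (polyAt p) = polyAt (polyDeriv α p) := by
  rw [classicalDeriv, iterate_classicalPartial_polyAt, iterate_classicalPartial_polyAt]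
  rfl

theorem integral_mul_classicalPartial {φ : Plane → ℝ} (hf : ContDiff ℝ ∞ f) (hφ : ContDiff ℝ ∞ φ)
    (hc : HasCompactSupport φ) (i : Fin 2) :
    ∫ x, f x * classicalPartial i φ x = -∫ x, classicalPartial i f x * φ x := by
  have hci : HasCompactSupport (classicalPartial i φ) :=
    hc.mono' ((subset_tsupport _).trans (tsupport_classicalPartial_subset i φ))
  refine integral_mul_fderiv_eq_neg_fderiv_mul_of_integrable ?_ ?_ ?_
    (fun x _ => hf.differentiable (by simp) x) (fun x _ => hφ.differentiable (by simp) x)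
  · exact ((contDiff_classicalPartial hf i).continuous.mul hφ.continuous).integrable_of_hasCompactSupport
      hc.mul_left
  · exact (hf.continuous.mul (contDiff_classicalPartial hφ i).continuous).integrable_of_hasCompactSupport
      hci.mul_left
  · exact (hf.continuous.mul hφ.continuous).integrable_of_hasCompactSupport hc.mul_left

theorem integral_mul_iterate_classicalPartial {φ : Plane → ℝ} (hf : ContDiff ℝ ∞ f)
    (hφ : ContDiff ℝ ∞ φ) (hc : HasCompactSupport φ) (i : Fin 2) (n : ℕ) :
    ∫ x, f x * (classicalPartial i)^[n] φ x =
      (-1) ^ n * ∫ x, (classicalPartial i)^[n] f x * φ x := by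
  induction n generalizing f with
  | zero => simp
  | succ n ih =>
    rw [Function.iterate_succ_apply', integral_mul_classicalPartial hf
      (contDiff_iterate_classicalPartial hφ i n)
      (hc.mono' ((subset_tsupport _).trans (tsupport_iterate_classicalPartial_subset i n φ))),
      ih (contDiff_classicalPartial hf i), Function.iterate_succ_apply]
    ring

/-- Integration by parts over the whole plane; nothing is needed of `O`, since the test functions
have compact support inside it. -/
theorem hasWeakDeriv_of_contDiff (hf : ContDiff ℝ ∞ f) (α : ℕ × ℕ) (O : Set Plane) :
    HasWeakDeriv O α f (classicalDeriv α f) := by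
  refine ⟨hf.continuous.locallyIntegrable.locallyIntegrableOn _,
    (contDiff_classicalDeriv hf α).continuous.locallyIntegrable.locallyIntegrableOn _,
    fun φ hφ hc hs => ?_⟩
  rw [setIntegral_eq_integral_of_tsupport_subset ((tsupport_classicalDeriv_subset α φ).trans hs),
    setIntegral_eq_integral_of_tsupport_subset hs]
  unfold classicalDeriv
  have hc1 : HasCompactSupport ((classicalPartial 1)^[α.2] φ) :=
    hc.mono' ((subset_tsupport _).trans (tsupport_iterate_classicalPartial_subset 1 _ φ))
  rw [integral_mul_iterate_classicalPartial hf (contDiff_iterate_classicalPartial hφ 1 _) hc1,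
    integral_mul_iterate_classicalPartial (contDiff_iterate_classicalPartial hf 0 _) hφ hc,
    iterate_classicalPartial_comm hf, pow_add]
  ring

theorem hasWeakDeriv_polyAt (p : Poly) (α : ℕ × ℕ) (O : Set Plane) :
    HasWeakDeriv O α (polyAt p) (polyAt (polyDeriv α p)) := by
  rw [← classicalDeriv_polyAt]
  exact hasWeakDeriv_of_contDiff (contDiff_polyAt p) α O

end

section

/-! ### Sobolev functions -/

variable {O O' : Set Plane} {α β : ℕ × ℕ} {f f' w w' : Plane → ℝ} {k : ℕ}

theorem MemH.mono (h : MemH k O f) (hs : O' ⊆ O) : MemH k O' f := fun α hα => by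
  obtain ⟨w, hw, hw2⟩ := h α hα
  exact ⟨w, hw.mono hs, hw2.mono_measure (Measure.restrict_mono_set _ hs)⟩

theorem MemH.sub (h : MemH k O f) (h' : MemH k O f') : MemH k O fun x => f x - f' x :=
  fun α hα => by
    obtain ⟨w, hw, hw2⟩ := h α hα
    obtain ⟨w', hw', hw2'⟩ := h' α hα
    exact ⟨_, hw.sub hw', hw2.sub hw2'⟩

theorem MemH.congr (h : MemH k O f) (he : f =ᵐ[volume.restrict O] f') : MemH k O f' :=
  fun α hα => by
    obtain ⟨w, hw, hw2⟩ := h α hα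
    exact ⟨w, hw.congr he (ae_eq_refl _), hw2⟩

theorem memLp_two_of_continuous (hf : Continuous f) {C : Set Plane} (hC : IsCompact C)
    (hs : O ⊆ C) : MemLp f 2 (volume.restrict O) := by
  have : IsFiniteMeasure (volume.restrict C) :=
    ⟨by simpa using hC.measure_lt_top⟩
  obtain ⟨M, hM⟩ := hC.exists_bound_of_continuousOn hf.continuousOn
  refine (MemLp.of_bound hf.aestronglyMeasurable M ?_).mono_measure
    (Measure.restrict_mono_set _ hs)
  filter_upwards [ae_restrict_mem hC.measurableSet] with x hx using hM x hx

theorem memH_polyAt (k : ℕ) {C : Set Plane} (hC : IsCompact C) (hs : O ⊆ C) (p : Poly) :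
    MemH k O (polyAt p) := fun α _ =>
  ⟨_, hasWeakDeriv_polyAt p α O, memLp_two_of_continuous (continuous_polyAt _) hC hs⟩

theorem MemH.hasWeakDeriv (h : MemH k O f) (hα : α.1 + α.2 ≤ k) :
    HasWeakDeriv O α f (weakDeriv O α f) := by
  obtain ⟨w, hw, _⟩ := h α hα
  exact hw.weakDeriv

theorem MemH.memLp_weakDeriv (hO : IsOpen O) (h : MemH k O f) (hα : α.1 + α.2 ≤ k) :
    MemLp (weakDeriv O α f) 2 (volume.restrict O) := by
  obtain ⟨w, hw, hw2⟩ := h α hα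
  exact (memLp_congr_ae (hw.weakDeriv_ae_eq hO)).2 hw2

theorem MemH.memLp (hO : IsOpen O) (h : MemH k O f) : MemLp f 2 (volume.restrict O) := by
  obtain ⟨w, hw, hw2⟩ := h (0, 0) (by simp)
  exact (memLp_congr_ae (hw.ae_eq_of_zero hO)).2 hw2

/-- The energy applies `weakDeriv` to an already chosen `weakDeriv`. Because second weak derivatives
of `f` exist, `HasWeakDeriv.of_add` identifies these iterates with them. -/
theorem weakDiv_weakGrad_ae_eq (hO : IsOpen O) (h : MemH 3 O f) :
    weakDiv O (weakGrad O f) =ᵐ[volume.restrict O]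
      fun x => weakDeriv O (2, 0) f x + weakDeriv O (0, 2) f x := by
  have h1 : HasWeakDeriv O (1, 0) (weakDeriv O (1, 0) f) (weakDeriv O (2, 0) f) :=
    (h.hasWeakDeriv (α := (1, 0)) (by simp)).of_add (h.hasWeakDeriv (α := (2, 0)) (by simp))
  have h2 : HasWeakDeriv O (0, 1) (weakDeriv O (0, 1) f) (weakDeriv O (0, 2) f) :=
    (h.hasWeakDeriv (α := (0, 1)) (by simp)).of_add (h.hasWeakDeriv (α := (0, 2)) (by simp))
  filter_upwards [h1.weakDeriv_ae_eq hO, h2.weakDeriv_ae_eq hO] with x e1 e2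
  rw [← e1, ← e2]
  rfl

/-- Needed for the integrability of the top-order term: a non-integrable energy density would have
Bochner integral zero and control nothing. -/
theorem memLp_weakGrad_weakDiv_weakGrad (hO : IsOpen O) (h : MemH 3 O f) :
    MemLp (weakDeriv O (1, 0) (weakDiv O (weakGrad O f))) 2 (volume.restrict O) ∧
      MemLp (weakDeriv O (0, 1) (weakDiv O (weakGrad O f))) 2 (volume.restrict O) := by
  have hd := (weakDiv_weakGrad_ae_eq hO h).symm
  have h20 := h.hasWeakDeriv (α := (2, 0)) (by simp)
  have h02 := h.hasWeakDeriv (α := (0, 2)) (by simp)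
  have a1 : HasWeakDeriv O (1, 0) (weakDeriv O (2, 0) f) (weakDeriv O (3, 0) f) :=
    h20.of_add (h.hasWeakDeriv (α := (3, 0)) (by simp))
  have a2 : HasWeakDeriv O (1, 0) (weakDeriv O (0, 2) f) (weakDeriv O (1, 2) f) :=
    h02.of_add (h.hasWeakDeriv (α := (1, 2)) (by simp))
  have b1 : HasWeakDeriv O (0, 1) (weakDeriv O (2, 0) f) (weakDeriv O (2, 1) f) :=
    h20.of_add (h.hasWeakDeriv (α := (2, 1)) (by simp))
  have b2 : HasWeakDeriv O (0, 1) (weakDeriv O (0, 2) f) (weakDeriv O (0, 3) f) :=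
    h02.of_add (h.hasWeakDeriv (α := (0, 3)) (by simp))
  have a3 := ((a1.add a2).congr hd (ae_eq_refl _)).weakDeriv_ae_eq hO
  have b3 := ((b1.add b2).congr hd (ae_eq_refl _)).weakDeriv_ae_eq hO
  exact ⟨(memLp_congr_ae a3).2 ((h.memLp_weakDeriv hO (by simp)).add
      (h.memLp_weakDeriv hO (by simp))),
    (memLp_congr_ae b3).2 ((h.memLp_weakDeriv hO (by simp)).add (h.memLp_weakDeriv hO (by simp)))⟩

/-- The energy controls the `H¹` norm. -/
theorem integral_le_integral_energyDensity (hO : IsOpen O) (h : MemH 3 O f) {b : ℝ} (hb : 0 < b) :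
    (∫ x in O, f x ^ 2) + 3 * b * (∫ x in O, weakDeriv O (1, 0) f x ^ 2) +
      3 * b * (∫ x in O, weakDeriv O (0, 1) f x ^ 2) ≤ ∫ x in O, energyDensity b O f f x := by
  have i0 := (h.memLp hO).integrable_sq
  have i1 := (h.memLp_weakDeriv hO (α := (1, 0)) (by simp)).integrable_sq
  have i2 := (h.memLp_weakDeriv hO (α := (0, 1)) (by simp)).integrable_sq
  have i3 : Integrable (fun x => weakDiv O (weakGrad O f) x ^ 2) (volume.restrict O) :=
    ((memLp_congr_ae (weakDiv_weakGrad_ae_eq hO h)).2 ((h.memLp_weakDeriv hO (by simp)).add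
      (h.memLp_weakDeriv hO (by simp)))).integrable_sq
  have i4 := (memLp_weakGrad_weakDiv_weakGrad hO h).1.integrable_sq
  have i5 := (memLp_weakGrad_weakDiv_weakGrad hO h).2.integrable_sq
  -- The `H¹` part comes first; the remaining terms are nonnegative and get dropped.
  have e : ∀ x, energyDensity b O f f x = (f x ^ 2 + 3 * b * weakDeriv O (1, 0) f x ^ 2 +
      3 * b * weakDeriv O (0, 1) f x ^ 2) + (3 * b ^ 2 * weakDiv O (weakGrad O f) x ^ 2 +
      b ^ 3 * weakDeriv O (1, 0) (weakDiv O (weakGrad O f)) x ^ 2 +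
      b ^ 3 * weakDeriv O (0, 1) (weakDiv O (weakGrad O f)) x ^ 2) := by
    intro x
    simp only [energyDensity, weakGrad, PiLp.inner_apply, Fin.sum_univ_two]
    simp
    ring
  simp_rw [e]
  have j1 := (i0.add (i1.const_mul (3 * b))).add (i2.const_mul (3 * b))
  have j2 := ((i3.const_mul (3 * b ^ 2)).add (i4.const_mul (b ^ 3))).add (i5.const_mul (b ^ 3))
  have e' := integral_add (i0.add (i1.const_mul (3 * b))) (i2.const_mul (3 * b))
  rw [integral_const_mul] at e'
  simp only [Pi.add_apply] at e'
  rw [integral_add i0 (i1.const_mul _), integral_const_mul] at e'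
  rw [← e']
  refine integral_mono j1 (j1.add j2) fun x => ?_
  have : 0 ≤ 3 * b ^ 2 * weakDiv O (weakGrad O f) x ^ 2 +
      b ^ 3 * weakDeriv O (1, 0) (weakDiv O (weakGrad O f)) x ^ 2 +
      b ^ 3 * weakDeriv O (0, 1) (weakDiv O (weakGrad O f)) x ^ 2 := by positivity
  linarith

theorem integral_sq_weakDeriv_le_sobolevNormSq (hα : α ∈ multiIndices k) :
    ∫ x in O, weakDeriv O α f x ^ 2 ≤ sobolevNormSq k O f :=
  Finset.single_le_sum (f := fun α => ∫ x in O, weakDeriv O α f x ^ 2)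
    (fun _ _ => integral_nonneg fun _ => sq_nonneg _) hα

theorem sobolevNormSq_nonneg : 0 ≤ sobolevNormSq k O f :=
  Finset.sum_nonneg fun _ _ => integral_nonneg fun _ => sq_nonneg _

/-! ### The square -/

theorem isOpen_openSquare : IsOpen openSquare := by
  have : openSquare = ⋂ i : Fin 2, {x : Plane | 0 < x i ∧ x i < 1} := by
    ext x; simp [openSquare]
  rw [this]
  refine isOpen_iInter_of_finite fun i => ?_
  exact isOpen_Ioo.preimage (f := fun x : Plane => x i) (by fun_prop)

theorem openSquare_subset_closedSquare : openSquare ⊆ closedSquare :=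
  fun _ hx i => ⟨(hx i).1.le, (hx i).2.le⟩

theorem convex_closedSquare : Convex ℝ closedSquare := by
  intro x hx y hy a b ha hb hab i
  have h1 := hx i
  have h2 := hy i
  simp only [PiLp.add_apply, PiLp.smul_apply, smul_eq_mul]
  constructor <;> nlinarith

theorem volume_box (i j : Fin 2) (hij : j ≠ i) (a b c d : ℝ) :
    volume {x : Plane | x i ∈ Icc a b ∧ x j ∈ Icc c d} =
      ENNReal.ofReal (b - a) * ENNReal.ofReal (d - c) := by
  have hm : MeasurableSet {x : Plane | x i ∈ Icc a b ∧ x j ∈ Icc c d} := by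
    refine IsClosed.measurableSet ?_
    exact (isClosed_Icc.preimage (by fun_prop)).inter (isClosed_Icc.preimage (by fun_prop))
  rw [← (measurePreserving_pt i).measure_preimage hm.nullMeasurableSet]
  have : (fun z : ℝ × ℝ => pt i z.1 z.2) ⁻¹' {x : Plane | x i ∈ Icc a b ∧ x j ∈ Icc c d} =
      Icc a b ×ˢ Icc c d := by
    ext z
    simp only [mem_preimage, mem_ofPred_eq, mem_prod, pt_apply_self, pt_apply_of_ne hij]
  rw [this, Measure.volume_eq_prod, Measure.prod_prod, Real.volume_Icc, Real.volume_Icc]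

theorem volume_closedSquare : volume closedSquare = 1 := by
  have := volume_box 0 1 (by decide) 0 1 0 1
  have e : closedSquare = {x : Plane | x 0 ∈ Icc (0 : ℝ) 1 ∧ x 1 ∈ Icc (0 : ℝ) 1} := by
    ext x; simp [closedSquare]
  rw [e, this]; simp

instance isFiniteMeasure_restrict_openSquare : IsFiniteMeasure (volume.restrict openSquare) :=
  ⟨by
    rw [Measure.restrict_apply_univ]
    exact (measure_mono openSquare_subset_closedSquare).trans_lt (by simp [volume_closedSquare])⟩

theorem volume_closedSquare_diff_openSquare : volume (closedSquare \ openSquare) = 0 := by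
  have hsub : closedSquare \ openSquare ⊆
      ({x : Plane | x 0 ∈ Icc (0 : ℝ) 0 ∧ x 1 ∈ Icc (0 : ℝ) 1} ∪
        {x : Plane | x 0 ∈ Icc (1 : ℝ) 1 ∧ x 1 ∈ Icc (0 : ℝ) 1}) ∪
      ({x : Plane | x 0 ∈ Icc (0 : ℝ) 1 ∧ x 1 ∈ Icc (0 : ℝ) 0} ∪
        {x : Plane | x 0 ∈ Icc (0 : ℝ) 1 ∧ x 1 ∈ Icc (1 : ℝ) 1}) := by
    rintro x ⟨hx, hx'⟩
    have h0 := hx 0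
    have h1 := hx 1
    simp only [openSquare, mem_ofPred_eq, Fin.forall_fin_two] at hx'
    simp only [mem_union, mem_ofPred_eq, mem_Icc]
    grind
  refine measure_mono_null hsub ?_
  rw [measure_union_null_iff, measure_union_null_iff, measure_union_null_iff,
    volume_box 0 1 (by decide), volume_box 0 1 (by decide), volume_box 0 1 (by decide),
    volume_box 0 1 (by decide)]
  simp

end

section

/-! ### Mollification -/

open scoped Convolution in
/-- The mollification of `g` by the normalized bump function `φ`. -/
def mollify (φ : ContDiffBump (0 : Plane)) (g : Plane → ℝ) : Plane → ℝ :=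
  g ⋆[ContinuousLinearMap.lsmul ℝ ℝ, volume] φ.normed volume

variable {O : Set Plane} {f g w : Plane → ℝ} (φ : ContDiffBump (0 : Plane))

theorem mollify_apply (g : Plane → ℝ) (x : Plane) :
    mollify φ g x = ∫ t, g t * φ.normed volume (x - t) := rfl

theorem mollify_apply_swap (g : Plane → ℝ) (x : Plane) :
    mollify φ g x = ∫ t, g (x - t) * φ.normed volume t := by
  rw [mollify, convolution_lsmul_swap]; rfl

open scoped Convolution in
theorem mollify_eq (g : Plane → ℝ) :
    mollify φ g = φ.normed volume ⋆[ContinuousLinearMap.lsmul ℝ ℝ, volume] g := by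
  funext x
  rw [mollify_apply, convolution_lsmul_swap]
  simp [mul_comm]

theorem contDiff_mollify (hg : LocallyIntegrable g) : ContDiff ℝ ∞ (mollify φ g) :=
  φ.hasCompactSupport_normed.contDiff_convolution_right (n := ⊤) _ hg φ.contDiff_normed

theorem classicalPartial_mollify (hg : LocallyIntegrable g) (i : Fin 2) (x : Plane) :
    classicalPartial i (mollify φ g) x =
      ∫ t, g t * classicalPartial i (φ.normed volume) (x - t) := by
  unfold classicalPartial mollify
  have h1 : ContDiff ℝ ∞ (φ.normed volume) := φ.contDiff_normed (n := ⊤)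
  rw [(φ.hasCompactSupport_normed.hasFDerivAt_convolution_right _ hg (h1.of_le (by simp)) x).fderiv,
    convolution_precompR_apply _ hg (φ.hasCompactSupport_normed.fderiv ℝ)
      (h1.continuous_fderiv (by simp))]
  rfl

/-- The multi-index of the partial derivative in direction `i`. -/
def unitIndex (i : Fin 2) : ℕ × ℕ := if i = 0 then (1, 0) else (0, 1)

theorem classicalDeriv_unitIndex (i : Fin 2) (ψ : Plane → ℝ) :
    classicalDeriv (unitIndex i) ψ = classicalPartial i ψ := by
  fin_cases i <;> simp [unitIndex, classicalDeriv]

theorem neg_one_pow_unitIndex (i : Fin 2) :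
    (-1 : ℝ) ^ ((unitIndex i).1 + (unitIndex i).2) = -1 := by
  fin_cases i <;> simp [unitIndex]

theorem unitIndex_add (i : Fin 2) : (unitIndex i).1 + (unitIndex i).2 = 1 := by
  fin_cases i <;> simp [unitIndex]

theorem classicalPartial_comp_sub (ψ : Plane → ℝ) (hψ : ContDiff ℝ ∞ ψ) (i : Fin 2) (x t : Plane) :
    classicalPartial i (fun t => ψ (x - t)) t = -classicalPartial i ψ (x - t) := by
  unfold classicalPartial
  have h := ((hψ.differentiable (by simp) (x - t)).hasFDerivAt).comp t
    ((hasFDerivAt_id t).const_sub x)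
  have h' : HasFDerivAt (fun t => ψ (x - t)) _ t := h
  rw [h'.fderiv]
  simp

/-- When the ball of radius `rOut` about `x` lies in `O`, the reflected kernel `t ↦ φ(x - t)` is an
admissible test function. The sign from the reflection cancels the sign from the weak derivative. -/
theorem classicalPartial_mollify_of_hasWeakDeriv (hO : IsOpen O) {i : Fin 2}
    (h : HasWeakDeriv O (unitIndex i) f w) (hf : LocallyIntegrable (O.indicator f)) {x : Plane}
    (hx : Metric.closedBall x φ.rOut ⊆ O) :
    classicalPartial i (mollify φ (O.indicator f)) x = mollify φ (O.indicator w) x := by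
  have h1 : ContDiff ℝ ∞ (φ.normed volume) := φ.contDiff_normed (n := ⊤)
  set ψ : Plane → ℝ := fun t => φ.normed volume (x - t) with hψ
  have hψd : ContDiff ℝ ∞ ψ := h1.comp (contDiff_const.sub contDiff_id)
  have hsupp : tsupport ψ ⊆ Metric.closedBall x φ.rOut := by
    refine closure_minimal (fun t ht => ?_) Metric.isClosed_closedBall
    have : x - t ∈ Function.support (φ.normed volume) := ht
    rw [φ.support_normed_eq] at this
    rw [Metric.mem_closedBall, dist_comm, dist_eq_norm]
    simpa using (mem_ball_zero_iff.1 this).le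
  have hψc : HasCompactSupport ψ :=
    HasCompactSupport.intro (isCompact_closedBall x φ.rOut) fun t ht =>
      image_eq_zero_of_notMem_tsupport fun h => ht (hsupp h)
  have key := h.2.2 ψ hψd hψc (hsupp.trans hx)
  rw [neg_one_pow_unitIndex, classicalDeriv_unitIndex] at key
  rw [classicalPartial_mollify φ hf, mollify_apply]
  have e1 : ∫ t, O.indicator f t * classicalPartial i (φ.normed volume) (x - t) =
      -∫ t in O, f t * classicalPartial i ψ t := by
    rw [← integral_indicator hO.measurableSet, ← integral_neg]
    refine integral_congr_ae (Eventually.of_forall fun t => ?_)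
    by_cases ht : t ∈ O
    · simp only [indicator_of_mem ht, hψ, classicalPartial_comp_sub _ h1]; ring
    · simp only [indicator_of_notMem ht]; simp
  have e2 : ∫ t, O.indicator w t * φ.normed volume (x - t) = ∫ t in O, w t * ψ t := by
    rw [← integral_indicator hO.measurableSet]
    refine integral_congr_ae (Eventually.of_forall fun t => ?_)
    by_cases ht : t ∈ O
    · simp only [indicator_of_mem ht, hψ]
    · simp only [indicator_of_notMem ht]; simp
  rw [e1, e2, key]; ring

theorem lintegral_enorm_le_eLpNorm_mul (hg : AEStronglyMeasurable g) (S : Set Plane) :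
    ∫⁻ x in S, ‖g x‖ₑ ≤ eLpNorm g 2 volume * volume S ^ (1 / 2 : ℝ) := by
  have h := eLpNorm_le_eLpNorm_mul_rpow_measure_univ (p := 1) (q := 2) (μ := volume.restrict S)
    (f := g) (by norm_num) hg.restrict
  rw [eLpNorm_one_eq_lintegral_enorm, Measure.restrict_apply_univ] at h
  refine h.trans ?_
  have e : (1 / (1 : ℝ≥0∞).toReal - 1 / (2 : ℝ≥0∞).toReal) = (1 / 2 : ℝ) := by norm_num
  rw [e]
  gcongr
  exact Measure.restrict_le_self

/-- A mollification is an average of translates with weight of total mass one. Each translate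
satisfies the Cauchy-Schwarz bound with the same translation-invariant norm, so the estimate does
not depend on the radius. -/
theorem lintegral_enorm_mollify_le (hg : AEStronglyMeasurable g) (S : Set Plane) :
    ∫⁻ x in S, ‖mollify φ g x‖ₑ ≤ eLpNorm g 2 volume * volume S ^ (1 / 2 : ℝ) := by
  set B := eLpNorm g 2 volume * volume S ^ (1 / 2 : ℝ) with hB
  have hshift : ∀ t, ∫⁻ x in S, ‖g (x - t)‖ₑ ≤ B := by
    intro t
    have hmp : MeasurePreserving (fun x : Plane => x - t) volume volume :=
      measurePreserving_sub_right volume t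
    refine (lintegral_enorm_le_eLpNorm_mul (hg.comp_measurePreserving hmp) S).trans ?_
    rw [eLpNorm_comp_measurePreserving hg hmp]
  calc ∫⁻ x in S, ‖mollify φ g x‖ₑ
      ≤ ∫⁻ x in S, ∫⁻ t, ‖φ.normed volume t‖ₑ * ‖g (x - t)‖ₑ := by
        refine lintegral_mono fun x => ?_
        rw [mollify_apply_swap]
        refine (enorm_integral_le_lintegral_enorm _).trans_eq (lintegral_congr fun t => ?_)
        rw [enorm_mul, mul_comm]
    _ = ∫⁻ t, ∫⁻ x in S, ‖φ.normed volume t‖ₑ * ‖g (x - t)‖ₑ := by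
        refine lintegral_lintegral_swap ?_
        have h1 : AEMeasurable (fun p : Plane × Plane => ‖g (p.1 - p.2)‖ₑ)
            ((volume.restrict S).prod volume) := by
          have : AEStronglyMeasurable (fun p : Plane × Plane => g (p.1 - p.2))
              (volume.prod volume) :=
            hg.comp_quasiMeasurePreserving (quasiMeasurePreserving_sub_of_right_invariant _ _)
          exact (this.mono_ac (Measure.AbsolutelyContinuous.prod
            Measure.restrict_le_self.absolutelyContinuous
            Measure.AbsolutelyContinuous.rfl)).enorm
        exact ((φ.continuous_normed.enorm.measurable.comp measurable_snd).aemeasurable).mul h1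
    _ = ∫⁻ t, ‖φ.normed volume t‖ₑ * ∫⁻ x in S, ‖g (x - t)‖ₑ := by
        refine lintegral_congr fun t => ?_
        rw [lintegral_const_mul' _ _ (by simp)]
    _ ≤ ∫⁻ t, ‖φ.normed volume t‖ₑ * B := by
        gcongr with t
        exact hshift t
    _ = (∫⁻ t, ‖φ.normed volume t‖ₑ) * B := by
        rw [lintegral_mul_const _ φ.continuous_normed.enorm.measurable]
    _ = B := by
        have h1 : ∫⁻ t, ‖φ.normed volume t‖ₑ = 1 := by
          have e : ∀ t, ‖φ.normed volume t‖ₑ = ENNReal.ofReal (φ.normed volume t) := fun t =>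
            Real.enorm_of_nonneg (φ.nonneg_normed t)
          simp_rw [e]
          rw [← ofReal_integral_eq_lintegral_ofReal φ.integrable_normed
            (Eventually.of_forall φ.nonneg_normed), φ.integral_normed, ENNReal.ofReal_one]
        rw [h1, one_mul]

/-- A sequence of bump functions with shrinking supports. -/
def bumpSeq (n : ℕ) : ContDiffBump (0 : Plane) where
  rIn := 1 / (n + 1)
  rOut := 2 * (1 / (n + 1))
  rIn_pos := by positivity
  rIn_lt_rOut := by
    have : (0 : ℝ) < 1 / (n + 1) := by positivity
    linarith

theorem tendsto_rOut_bumpSeq : Tendsto (fun n => (bumpSeq n).rOut) atTop (𝓝 0) := by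
  have := tendsto_one_div_add_atTop_nhds_zero_nat (𝕜 := ℝ)
  simpa [bumpSeq] using this.const_mul 2

theorem ae_tendsto_mollify (hg : LocallyIntegrable g) :
    ∀ᵐ x, Tendsto (fun n => mollify (bumpSeq n) g x) atTop (𝓝 (g x)) := by
  -- Lebesgue differentiation needs the ratio `rOut / rIn` to stay bounded; for `bumpSeq` it is
  -- constantly 2.
  have := ContDiffBump.ae_convolution_tendsto_right_of_locallyIntegrable (μ := volume)
    tendsto_rOut_bumpSeq (K := 2) (Eventually.of_forall fun n => le_rfl) hg
  filter_upwards [this] with x hx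
  simpa only [mollify_eq] using hx

theorem tendsto_mollify_of_continuousAt (hg : LocallyIntegrable g) {x : Plane}
    (hx : ContinuousAt g x) :
    Tendsto (fun n => mollify (bumpSeq n) g x) atTop (𝓝 (g x)) := by
  have := ContDiffBump.convolution_tendsto_right (μ := volume) (g := fun _ => g) (k := fun _ => x)
    tendsto_rOut_bumpSeq (Eventually.of_forall fun _ => hg.aestronglyMeasurable)
    (hx.tendsto.comp tendsto_snd) tendsto_const_nhds
  simpa only [mollify_eq] using this

/-! ### Boxes and strips -/

theorem setLIntegral_box (i j : Fin 2) (hij : j ≠ i) (a b c d : ℝ) {G : Plane → ℝ≥0∞}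
    (hG : Measurable G) :
    ∫⁻ x in {x : Plane | x i ∈ Icc a b ∧ x j ∈ Icc c d}, G x =
      ∫⁻ s in Icc a b, ∫⁻ y in Icc c d, G (pt i s y) := by
  have hm : MeasurableSet {x : Plane | x i ∈ Icc a b ∧ x j ∈ Icc c d} := by
    refine IsClosed.measurableSet ?_
    exact (isClosed_Icc.preimage (by fun_prop)).inter (isClosed_Icc.preimage (by fun_prop))
  rw [← lintegral_indicator hm, lintegral_eq_lintegral_pt i (hG.indicator hm),
    ← lintegral_indicator measurableSet_Icc]
  refine lintegral_congr fun s => ?_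
  by_cases hs : s ∈ Icc a b
  · rw [indicator_of_mem hs, ← lintegral_indicator measurableSet_Icc]
    refine lintegral_congr fun y => ?_
    by_cases hy : y ∈ Icc c d
    · rw [indicator_of_mem hy, indicator_of_mem]
      exact ⟨by simpa using hs, by simpa [pt_apply_of_ne hij] using hy⟩
    · rw [indicator_of_notMem hy, indicator_of_notMem]
      rintro ⟨_, h2⟩
      exact hy (by simpa only [pt_apply_of_ne hij] using h2)
  · rw [indicator_of_notMem hs]
    refine (lintegral_congr fun y => ?_).trans lintegral_zero
    rw [indicator_of_notMem]
    rintro ⟨h1, _⟩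
    exact hs (by simpa only [pt_apply_self] using h1)

theorem hasDerivAt_pt_of_contDiff {F : Plane → ℝ} (hF : ContDiff ℝ ∞ F) (i : Fin 2) (s y : ℝ) :
    HasDerivAt (fun t => F (pt i t y)) (classicalPartial i F (pt i s y)) s :=
  hasDerivAt_comp_pt i (hF.differentiable (by simp) _).hasFDerivAt

theorem enorm_sub_pt_le {F : Plane → ℝ} (hF : ContDiff ℝ ∞ F) (i : Fin 2) {a b : ℝ} (hab : a ≤ b)
    (y : ℝ) :
    ‖F (pt i b y) - F (pt i a y)‖ₑ ≤ ∫⁻ t in Icc a b, ‖classicalPartial i F (pt i t y)‖ₑ := by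
  refine enorm_sub_le_lintegral_deriv hab (fun t => hasDerivAt_pt_of_contDiff hF i t y) ?_
  exact (contDiff_classicalPartial hF i).continuous.comp
    ((continuous_pt i).comp (continuous_id.prodMk continuous_const))

theorem enorm_pt_mul_le {F : Plane → ℝ} (hF : ContDiff ℝ ∞ F) (j : Fin 2)
    {c d u : ℝ} (hu : u ∈ Icc c d) (y : ℝ) :
    ‖F (pt j u y)‖ₑ * ENNReal.ofReal (d - c) ≤ (∫⁻ t in Icc c d, ‖F (pt j t y)‖ₑ) +
      (∫⁻ t in Icc c d, ‖classicalPartial j F (pt j t y)‖ₑ) * ENNReal.ofReal (d - c) := by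
  refine enorm_mul_le_lintegral_add fun v hv => ?_
  exact enorm_sub_le_of_le (f := fun t => F (pt j t y))
    (fun x _ z _ hxz => enorm_sub_pt_le hF j hxz y)
    u hu v hv

/-- Differences along a coordinate direction are bounded by mixed second derivatives on a box. -/
theorem enorm_sub_pt_le_box {F : Plane → ℝ} (hF : ContDiff ℝ ∞ F) (i j : Fin 2) (hij : j ≠ i)
    {a b c d y : ℝ} (hab : a ≤ b) (hy : y ∈ Icc c d) (hcd : 1 / 2 ≤ d - c) :
    ‖F (pt i b y) - F (pt i a y)‖ₑ ≤
      2 * (∫⁻ x in {x : Plane | x i ∈ Icc a b ∧ x j ∈ Icc c d}, ‖classicalPartial i F x‖ₑ) +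
      ∫⁻ x in {x : Plane | x i ∈ Icc a b ∧ x j ∈ Icc c d},
        ‖classicalPartial j (classicalPartial i F) x‖ₑ := by
  have hFi := contDiff_classicalPartial hF i
  have hFij := contDiff_classicalPartial hFi j
  have m1 := hFi.continuous.enorm.measurable
  have m2 := hFij.continuous.enorm.measurable
  refine (enorm_sub_pt_le hF i hab y).trans ?_
  rw [setLIntegral_box i j hij a b c d m1, setLIntegral_box i j hij a b c d m2,
    ← lintegral_const_mul' _ _ (by simp), ← lintegral_add_left]
  · refine lintegral_mono fun t => ?_
    have h := enorm_pt_mul_le hFi j hy t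
    simp_rw [← pt_swap i j hij] at h
    set A := ∫⁻ u in Icc c d, ‖classicalPartial i F (pt i t u)‖ₑ
    set B := ∫⁻ u in Icc c d, ‖classicalPartial j (classicalPartial i F) (pt i t u)‖ₑ
    set l := ENNReal.ofReal (d - c) with hl
    have hl0 : l ≠ 0 := by rw [hl]; simp; linarith
    have hlt : l ≠ ⊤ := ENNReal.ofReal_ne_top
    -- The transversal side has length at least `1/2`; this is the origin of the factor 2.
    have hinv : l⁻¹ ≤ 2 := by
      rw [ENNReal.inv_le_iff_inv_le, hl]
      have : (2 : ℝ≥0∞)⁻¹ = ENNReal.ofReal (1 / 2) := by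
        rw [one_div, ENNReal.ofReal_inv_of_pos (by norm_num)]; simp
      rw [this]
      exact ENNReal.ofReal_le_ofReal hcd
    calc ‖classicalPartial i F (pt i t y)‖ₑ
        = ‖classicalPartial i F (pt i t y)‖ₑ * l * l⁻¹ := by
          rw [mul_assoc, ENNReal.mul_inv_cancel hl0 hlt, mul_one]
      _ ≤ (A + B * l) * l⁻¹ := by gcongr
      _ = l⁻¹ * A + B := by
          rw [add_mul, mul_assoc, ENNReal.mul_inv_cancel hl0 hlt, mul_one, mul_comm]
      _ ≤ 2 * A + B := by gcongr
  · refine Measurable.const_mul ?_ 2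
    exact Measurable.lintegral_prod_right' (ν := volume.restrict (Icc c d))
      (f := fun z : ℝ × ℝ => ‖classicalPartial i F (pt i z.1 z.2)‖ₑ)
      (m1.comp (continuous_pt i).measurable)

end

section

/-! ### Continuous representatives -/

/-- The closed square of the points at distance at least `m` from the boundary of the unit
square. -/
def innerSquare (m : ℝ) : Set Plane := {x | ∀ k, x k ∈ Icc m (1 - m)}

theorem isClosed_innerSquare (m : ℝ) : IsClosed (innerSquare m) := by
  have : innerSquare m = ⋂ i : Fin 2, {x : Plane | x i ∈ Icc m (1 - m)} := by
    ext x; simp [innerSquare]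
  rw [this]
  exact isClosed_iInter fun i => isClosed_Icc.preimage (f := fun x : Plane => x i) (by fun_prop)

theorem innerSquare_subset_openSquare {m : ℝ} (hm : 0 < m) : innerSquare m ⊆ openSquare :=
  fun _ hx k => ⟨hm.trans_le (hx k).1, (hx k).2.trans_lt (by linarith)⟩

theorem volume_innerSquare_le {m : ℝ} (hm : 0 < m) : volume (innerSquare m) ≤ 1 := by
  rw [← volume_closedSquare]
  exact measure_mono ((innerSquare_subset_openSquare hm).trans openSquare_subset_closedSquare)

theorem abs_apply_sub_le_dist (x y : Plane) (k : Fin 2) : |x k - y k| ≤ dist x y := by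
  rw [dist_eq_norm, ← Real.norm_eq_abs]
  exact PiLp.norm_apply_le (x - y) k

theorem closedBall_subset_openSquare {m r : ℝ} (hr : r < m) {x : Plane} (hx : x ∈ innerSquare m) :
    Metric.closedBall x r ⊆ openSquare := by
  intro y hy k
  have h1 := (abs_apply_sub_le_dist y x k).trans (Metric.mem_closedBall.1 hy)
  have h2 := hx k
  rw [abs_le] at h1
  constructor
  · linarith [h2.1]
  · linarith [h2.2]

theorem exists_innerSquare_mem_nhds {x : Plane} (hx : x ∈ openSquare) :
    ∃ m, 0 < m ∧ m ≤ 1 / 4 ∧ innerSquare m ∈ 𝓝 x := by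
  have h0 := hx 0
  have h1 := hx 1
  -- The cap `1/4` keeps the side `1 - 2m` of the inner square at least `1/2`. The halved distance
  -- to the boundary leaves room for a ball of radius `m` about `x`.
  set m := min (1 / 4) (min (min (x 0) (1 - x 0)) (min (x 1) (1 - x 1)) / 2) with hm
  have hmpos : 0 < m := by
    refine lt_min (by norm_num) (half_pos (lt_min (lt_min h0.1 ?_) (lt_min h1.1 ?_))) <;> linarith
  refine ⟨m, hmpos, min_le_left _ _, ?_⟩
  have hm2 : 2 * m ≤ min (min (x 0) (1 - x 0)) (min (x 1) (1 - x 1)) := by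
    have : m ≤ _ := min_le_right _ _
    linarith
  simp only [le_min_iff] at hm2
  refine Filter.mem_of_superset (Metric.closedBall_mem_nhds x hmpos) fun y hy => ?_
  have key : ∀ k, |y k - x k| ≤ m := fun k =>
    (abs_apply_sub_le_dist y x k).trans (Metric.mem_closedBall.1 hy)
  have k0 := abs_le.1 (key 0)
  have k1 := abs_le.1 (key 1)
  rw [innerSquare, mem_ofPred_eq, Fin.forall_fin_two]
  exact ⟨⟨by linarith, by linarith⟩, ⟨by linarith, by linarith⟩⟩

/-- Convergence on a dense set and an equicontinuity modulus give Cauchy sequences at every point,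
and the limit inherits the modulus. For each `m` the modulus is required only for large `n`, since a
mollification radius has to be below `m` first. -/
theorem exists_continuousOn_of_equicontinuous {F : ℕ → Plane → ℝ} {f : Plane → ℝ} {C : ℝ}
    (hH : ∀ m, 0 < m → m ≤ 1 / 4 → ∀ᶠ n in atTop, ∀ x ∈ innerSquare m, ∀ y ∈ innerSquare m,
      |F n x - F n y| ≤ C * √(dist x y))
    (hae : ∀ᵐ x, x ∈ openSquare → Tendsto (fun n => F n x) atTop (𝓝 (f x))) :
    ∃ w : Plane → ℝ, ContinuousOn w openSquare ∧ w =ᵐ[volume.restrict openSquare] f := by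
  have hdense := Measure.dense_of_ae hae
  have hconv : ∀ x ∈ openSquare, ∃ l, Tendsto (fun n => F n x) atTop (𝓝 l) := by
    intro x hx
    refine cauchySeq_tendsto_of_complete (Metric.cauchySeq_iff.2 fun ε hε => ?_)
    obtain ⟨m, hm, hm4, hmx⟩ := exists_innerSquare_mem_nhds hx
    have hcont : Tendsto (fun z => C * √(dist x z)) (𝓝 x) (𝓝 0) := by
      have : Continuous fun z => C * √(dist x z) := by fun_prop
      simpa using this.tendsto x
    have hev : ∀ᶠ z in 𝓝 x, C * √(dist x z) < ε / 4 ∧ z ∈ innerSquare m ∧ z ∈ openSquare :=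
      (hcont.eventually_lt_const (by positivity)).and
        (Filter.Eventually.and hmx (isOpen_openSquare.mem_nhds hx))
    obtain ⟨V, hV, hVo, hxV⟩ := eventually_nhds_iff.1 hev
    obtain ⟨z, hzV, hz⟩ := hdense.exists_mem_open hVo ⟨x, hxV⟩
    obtain ⟨hz1, hz2, hz3⟩ := hV z hz
    obtain ⟨N1, hN1⟩ := Metric.cauchySeq_iff.1 (hzV hz3).cauchySeq (ε / 2) (by positivity)
    obtain ⟨N2, hN2⟩ := eventually_atTop.1 (hH m hm hm4)
    refine ⟨max N1 N2, fun k hk l hl => ?_⟩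
    have a1 := hN1 k ((le_max_left _ _).trans hk) l ((le_max_left _ _).trans hl)
    have a2 := hN2 k ((le_max_right _ _).trans hk) x (mem_of_mem_nhds hmx) z hz2
    have a3 := hN2 l ((le_max_right _ _).trans hl) x (mem_of_mem_nhds hmx) z hz2
    rw [Real.dist_eq] at a1 ⊢
    rw [abs_lt] at a1 ⊢
    rw [abs_le] at a2 a3
    constructor <;> linarith
  choose! w hw using hconv
  refine ⟨w, ?_, ?_⟩
  · intro x hx
    obtain ⟨m, hm, hm4, hmx⟩ := exists_innerSquare_mem_nhds hx
    refine ContinuousAt.continuousWithinAt ?_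
    rw [ContinuousAt, tendsto_iff_dist_tendsto_zero]
    have hcont : Tendsto (fun z => C * √(dist z x)) (𝓝 x) (𝓝 0) := by
      have : Continuous fun z => C * √(dist z x) := by fun_prop
      simpa using this.tendsto x
    refine squeeze_zero' (Eventually.of_forall fun _ => dist_nonneg) ?_ hcont
    filter_upwards [hmx] with z hz
    rw [Real.dist_eq]
    refine le_of_tendsto (((hw z (innerSquare_subset_openSquare hm hz)).sub (hw x hx)).abs) ?_
    filter_upwards [hH m hm hm4] with n hn
    exact hn z hz x (mem_of_mem_nhds hmx)
  · filter_upwards [ae_restrict_of_ae hae, ae_restrict_mem isOpen_openSquare.measurableSet]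
      with x hx hxO
    exact tendsto_nhds_unique (hw x hxO) (hx hxO)

variable {v : Plane → ℝ}

theorem integrable_indicator_of_memLp {f : Plane → ℝ}
    (hf : MemLp f 2 (volume.restrict openSquare)) :
    Integrable (openSquare.indicator f) := by
  rw [integrable_indicator_iff isOpen_openSquare.measurableSet]
  exact hf.integrable (by norm_num)

theorem eLpNorm_indicator_lt_top {f : Plane → ℝ}
    (hf : MemLp f 2 (volume.restrict openSquare)) :
    eLpNorm (openSquare.indicator f) 2 volume < ⊤ := by
  rw [eLpNorm_indicator_eq_eLpNorm_restrict isOpen_openSquare.measurableSet]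
  exact hf.2

theorem eventually_closedBall_subset_openSquare {m r : ℝ} (hr : r < m) {x : Plane}
    (hx : x ∈ innerSquare m) : ∀ᶠ y in 𝓝 x, Metric.closedBall y r ⊆ openSquare := by
  have hpos : 0 < (m - r) / 2 := by linarith
  filter_upwards [Metric.ball_mem_nhds x hpos] with y hy
  refine (Metric.closedBall_subset_closedBall' ?_).trans
    (closedBall_subset_openSquare (r := r + (m - r) / 2) (by linarith) hx)
  have := (Metric.mem_ball.1 hy).le
  linarith

/-- On the strip of length `b - a` across the inner square, the derivatives of the mollification are
mollifications of weak derivatives. The area of the strip is at most `b - a`, and Cauchy-Schwarz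
turns it into the square root. -/
theorem enorm_mollify_sub_le {W W' : Plane → ℝ} {i j : Fin 2} (hij : j ≠ i)
    (hv : MemLp v 2 (volume.restrict openSquare))
    (hW : HasWeakDeriv openSquare (unitIndex i) v W)
    (hW' : HasWeakDeriv openSquare (unitIndex j) W W')
    (hW2 : MemLp W 2 (volume.restrict openSquare)) (hW2' : MemLp W' 2 (volume.restrict openSquare))
    {m : ℝ} (hm : 0 < m) (hm4 : m ≤ 1 / 4) (φ : ContDiffBump (0 : Plane)) (hφ : φ.rOut < m)
    {a b y : ℝ} (ha : m ≤ a) (hab : a ≤ b) (hb : b ≤ 1 - m) (hy : y ∈ Icc m (1 - m)) :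
    ‖mollify φ (openSquare.indicator v) (pt i b y) -
      mollify φ (openSquare.indicator v) (pt i a y)‖ₑ ≤
      (2 * eLpNorm (openSquare.indicator W) 2 volume + eLpNorm (openSquare.indicator W') 2 volume) *
        ENNReal.ofReal (b - a) ^ (1 / 2 : ℝ) := by
  have iv := (integrable_indicator_of_memLp hv).locallyIntegrable
  have iW := (integrable_indicator_of_memLp hW2).locallyIntegrable
  have iW' := (integrable_indicator_of_memLp hW2').locallyIntegrable
  refine (enorm_sub_pt_le_box (contDiff_mollify φ iv) i j hij hab hy (by linarith)).trans ?_
  set S : Set Plane := {x | x i ∈ Icc a b ∧ x j ∈ Icc m (1 - m)} with hS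
  have hSin : S ⊆ innerSquare m := by
    intro x hx k
    by_cases hk : k = i
    · subst hk; exact ⟨ha.trans hx.1.1, hx.1.2.trans hb⟩
    · have : k = j := by omega
      subst this; exact hx.2
  have hSm : MeasurableSet S := by
    refine IsClosed.measurableSet ?_
    exact (isClosed_Icc.preimage (by fun_prop)).inter (isClosed_Icc.preimage (by fun_prop))
  have hvol : volume S ≤ ENNReal.ofReal (b - a) := by
    rw [hS, volume_box i j hij]
    refine mul_le_of_le_one_right' ?_
    rw [← ENNReal.ofReal_one]
    exact ENNReal.ofReal_le_ofReal (by linarith)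
  -- Equality at `x` alone would not suffice: the identity is differentiated once more in `e2`, so
  -- it must hold in a neighbourhood.
  have e1 : ∀ x ∈ S, ∀ᶠ z in 𝓝 x, classicalPartial i (mollify φ (openSquare.indicator v)) z =
      mollify φ (openSquare.indicator W) z := by
    intro x hx
    filter_upwards [eventually_closedBall_subset_openSquare hφ (hSin hx)] with z hz
    exact classicalPartial_mollify_of_hasWeakDeriv φ isOpen_openSquare hW iv hz
  have e2 : ∀ x ∈ S, classicalPartial j (classicalPartial i (mollify φ
    (openSquare.indicator v))) x =
      mollify φ (openSquare.indicator W') x := by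
    intro x hx
    rw [← classicalPartial_mollify_of_hasWeakDeriv φ isOpen_openSquare hW' iW
      (closedBall_subset_openSquare hφ (hSin hx))]
    have := Filter.EventuallyEq.fderiv_eq (𝕜 := ℝ) (e1 x hx)
    simp only [classicalPartial] at this ⊢
    rw [this]
  rw [setLIntegral_congr_fun hSm
      (f := fun x => ‖classicalPartial i (mollify φ (openSquare.indicator v)) x‖ₑ)
      (g := fun x => ‖mollify φ (openSquare.indicator W) x‖ₑ)
      (fun x hx => by simp only [(e1 x hx).self_of_nhds]),
    setLIntegral_congr_fun hSm
      (f := fun x => ‖classicalPartial j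
        (classicalPartial i (mollify φ (openSquare.indicator v))) x‖ₑ)
      (g := fun x => ‖mollify φ (openSquare.indicator W') x‖ₑ)
      (fun x hx => by simp only [e2 x hx])]
  calc _ ≤ 2 * (eLpNorm (openSquare.indicator W) 2 volume * volume S ^ (1 / 2 : ℝ)) +
        eLpNorm (openSquare.indicator W') 2 volume * volume S ^ (1 / 2 : ℝ) := by
        gcongr
        · exact lintegral_enorm_mollify_le φ iW.aestronglyMeasurable S
        · exact lintegral_enorm_mollify_le φ iW'.aestronglyMeasurable S
    _ = (2 * eLpNorm (openSquare.indicator W) 2 volume +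
          eLpNorm (openSquare.indicator W') 2 volume) * volume S ^ (1 / 2 : ℝ) := by ring
    _ ≤ _ := by gcongr

/-- A function whose increments along the coordinate directions are controlled by the square root
of the step is `1/2`-Hölder. -/
theorem abs_sub_le_sqrt_dist {F : Plane → ℝ} {A m : ℝ}
    (h : ∀ i : Fin 2, ∀ a b y, m ≤ a → a ≤ b → b ≤ 1 - m → y ∈ Icc m (1 - m) →
      |F (pt i b y) - F (pt i a y)| ≤ A * √(b - a)) (hA : 0 ≤ A)
    {x z : Plane} (hx : x ∈ innerSquare m) (hz : z ∈ innerSquare m) :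
    |F x - F z| ≤ 2 * A * √(dist x z) := by
  have h' : ∀ i : Fin 2, ∀ a ∈ Icc m (1 - m), ∀ b ∈ Icc m (1 - m), ∀ y ∈ Icc m (1 - m),
      |F (pt i b y) - F (pt i a y)| ≤ A * √|b - a| := by
    intro i a ha b hb y hy
    rcases le_total a b with hab | hab
    · rw [abs_of_nonneg (sub_nonneg.2 hab)]
      exact h i a b y ha.1 hab hb.2 hy
    · rw [abs_sub_comm, abs_sub_comm b a, abs_of_nonneg (sub_nonneg.2 hab)]
      exact h i b a y hb.1 hab ha.2 hy
  -- The path from `x` to `z` turns at the corner `(z 0, x 1)`.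
  have h1 := h' 0 (z 0) (hz 0) (x 0) (hx 0) (x 1) (hx 1)
  have h2 := h' 1 (z 1) (hz 1) (x 1) (hx 1) (z 0) (hz 0)
  rw [pt_self 0 1 (by decide)] at h1
  rw [pt_self 1 0 (by decide), pt_swap 1 0 (by decide)] at h2
  have d0 : A * √|x 0 - z 0| ≤ A * √(dist x z) :=
    mul_le_mul_of_nonneg_left (Real.sqrt_le_sqrt (abs_apply_sub_le_dist x z 0)) hA
  have d1 : A * √|x 1 - z 1| ≤ A * √(dist x z) :=
    mul_le_mul_of_nonneg_left (Real.sqrt_le_sqrt (abs_apply_sub_le_dist x z 1)) hA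
  have := abs_sub_le (F x) (F (pt 0 (z 0) (x 1))) (F z)
  linarith

/-- Mollifications converge almost everywhere to `v` and, by `enorm_mollify_sub_le`, share one
Hölder constant. -/
theorem exists_continuous_representative (hv : MemH 3 openSquare v) :
    ∃ w : Plane → ℝ, ContinuousOn w openSquare ∧ w =ᵐ[volume.restrict openSquare] v := by
  -- Summing over all pairs of directions gives one finite constant that serves every coordinate
  -- increment.
  set A : ℝ≥0∞ := ∑ i : Fin 2, ∑ j : Fin 2,
    (2 * eLpNorm (openSquare.indicator (weakDeriv openSquare (unitIndex i) v)) 2 volume +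
      eLpNorm (openSquare.indicator
        (weakDeriv openSquare (unitIndex i + unitIndex j) v)) 2 volume) with hA
  have hle : ∀ i j : Fin 2, (unitIndex i + unitIndex j).1 + (unitIndex i + unitIndex j).2 ≤ 3 := by
    decide
  have hle1 : ∀ i : Fin 2, (unitIndex i).1 + (unitIndex i).2 ≤ 3 := by decide
  have hAtop : A ≠ ⊤ := by
    rw [hA]
    refine (ENNReal.sum_lt_top.2 fun i _ => ENNReal.sum_lt_top.2 fun j _ => ?_).ne
    exact ENNReal.add_lt_top.2 ⟨ENNReal.mul_lt_top (by simp)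
      (eLpNorm_indicator_lt_top (hv.memLp_weakDeriv isOpen_openSquare (hle1 i))),
      eLpNorm_indicator_lt_top (hv.memLp_weakDeriv isOpen_openSquare (hle i j))⟩
  have hvL := hv.memLp isOpen_openSquare
  have iv := (integrable_indicator_of_memLp hvL).locallyIntegrable
  refine exists_continuousOn_of_equicontinuous
    (F := fun n => mollify (bumpSeq n) (openSquare.indicator v)) (C := 2 * A.toReal) ?_ ?_
  · intro m hm hm4
    filter_upwards [tendsto_rOut_bumpSeq.eventually_lt_const hm] with n hn x hx z hz
    refine abs_sub_le_sqrt_dist (fun i a b y ha hab hb hy => ?_) ENNReal.toReal_nonneg hx hz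
    obtain ⟨j, hij⟩ : ∃ j : Fin 2, j ≠ i := exists_ne i
    have h1 := hv.hasWeakDeriv (hle1 i)
    have h := enorm_mollify_sub_le hij hvL h1 (h1.of_add (hv.hasWeakDeriv (hle i j)))
      (hv.memLp_weakDeriv isOpen_openSquare (hle1 i))
      (hv.memLp_weakDeriv isOpen_openSquare (hle i j)) hm hm4 (bumpSeq n) hn ha hab hb hy
    have hAle : 2 * eLpNorm (openSquare.indicator (weakDeriv openSquare (unitIndex i) v)) 2 volume +
      eLpNorm (openSquare.indicator
        (weakDeriv openSquare (unitIndex i + unitIndex j) v)) 2 volume ≤ A := by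
      rw [hA]
      refine le_trans ?_ (Finset.single_le_sum (fun _ _ => zero_le) (Finset.mem_univ i))
      exact Finset.single_le_sum (f := fun j => 2 * eLpNorm (openSquare.indicator
        (weakDeriv openSquare (unitIndex i) v)) 2 volume +
        eLpNorm (openSquare.indicator
        (weakDeriv openSquare (unitIndex i + unitIndex j) v)) 2 volume) (fun _ _ => zero_le)
          (Finset.mem_univ j)
    have h2 := h.trans (mul_le_mul_left hAle _)
    rw [ENNReal.ofReal_rpow_of_nonneg (sub_nonneg.2 hab) (by norm_num), ← Real.sqrt_eq_rpow,
      ← ENNReal.ofReal_toReal hAtop, ← ENNReal.ofReal_mul ENNReal.toReal_nonneg,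
      ← ofReal_norm, Real.norm_eq_abs] at h2
    exact (ENNReal.ofReal_le_ofReal_iff (by positivity)).1 h2
  · filter_upwards [ae_tendsto_mollify iv] with x hx hxO
    simpa [indicator_of_mem hxO] using hx

/-! ### Traces on affine curves -/

theorem lintegral_comp_affine {H : ℝ → ℝ≥0∞} (hH : Measurable H) (a : ℝ) {α : ℝ} (hα : α ≠ 0) :
    ∫⁻ θ, H (a + θ * α) = ENNReal.ofReal |α⁻¹| * ∫⁻ y, H y := by
  have h1 : ∫⁻ θ, H (a + θ * α) = ∫⁻ y, H (a + y) ∂(Measure.map (fun θ => θ * α) volume) := by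
    rw [lintegral_map (f := fun y => H (a + y)) (hH.comp (measurable_const_add a))
      (measurable_mul_const α)]
  rw [h1, Real.map_volume_mul_right hα, lintegral_smul_measure, lintegral_add_left_eq_self H a,
    smul_eq_mul]

/-- The value on the curve is compared with the mean over a vertical segment of length `ε` starting
there. As `θ` varies these segments sweep out a band inside `E`, and substituting `y = a + θ α` in
the `i`-th coordinate costs the factor `|α⁻¹|`. -/
theorem lintegral_enorm_affine_le {F : Plane → ℝ} (hF : ContDiff ℝ ∞ F) {i j : Fin 2}
    (hij : j ≠ i) {a α c γ t₀ t₁ ε : ℝ} (hα : α ≠ 0) (hε : 0 < ε) {E : Set Plane}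
    (hE : MeasurableSet E)
    (hin : ∀ θ ∈ Icc t₀ t₁, ∀ u ∈ Icc (c + θ * γ) (c + θ * γ + ε), pt i (a + θ * α) u ∈ E) :
    (∫⁻ θ in Icc t₀ t₁, ‖F (pt i (a + θ * α) (c + θ * γ))‖ₑ) * ENNReal.ofReal ε ≤
      ENNReal.ofReal |α⁻¹| * ((∫⁻ x in E, ‖F x‖ₑ) +
        (∫⁻ x in E, ‖classicalPartial j F x‖ₑ) * ENNReal.ofReal ε) := by
  have key : ∀ G : Plane → ℝ≥0∞, Measurable G →
      ∫⁻ θ in Icc t₀ t₁, ∫⁻ u in Icc (c + θ * γ) (c + θ * γ + ε), G (pt i (a + θ * α) u) ≤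
        ENNReal.ofReal |α⁻¹| * ∫⁻ x in E, G x := by
    intro G hG
    have hGE := hG.indicator hE
    have hHm : Measurable fun y => ∫⁻ u, E.indicator G (pt i y u) :=
      Measurable.lintegral_prod_right' (f := fun z : ℝ × ℝ => E.indicator G (pt i z.1 z.2))
        (hGE.comp (continuous_pt i).measurable)
    calc _ ≤ ∫⁻ θ in Icc t₀ t₁, ∫⁻ u, E.indicator G (pt i (a + θ * α) u) := by
          refine setLIntegral_mono' measurableSet_Icc fun θ hθ => ?_
          rw [← lintegral_indicator measurableSet_Icc]
          refine lintegral_mono fun u => ?_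
          by_cases hu : u ∈ Icc (c + θ * γ) (c + θ * γ + ε)
          · rw [indicator_of_mem hu, indicator_of_mem (hin θ hθ u hu)]
          · rw [indicator_of_notMem hu]; exact zero_le
      _ ≤ ∫⁻ θ, ∫⁻ u, E.indicator G (pt i (a + θ * α) u) := setLIntegral_le_lintegral _ _
      _ = ENNReal.ofReal |α⁻¹| * ∫⁻ y, ∫⁻ u, E.indicator G (pt i y u) :=
          lintegral_comp_affine hHm a hα
      _ = ENNReal.ofReal |α⁻¹| * ∫⁻ x in E, G x := by
          rw [← lintegral_eq_lintegral_pt i hGE, lintegral_indicator hE]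
  have m0 := hF.continuous.enorm.measurable
  have m1 := (contDiff_classicalPartial hF j).continuous.enorm.measurable
  rw [← lintegral_mul_const' _ _ ENNReal.ofReal_ne_top]
  have hpt : ∀ θ, ‖F (pt i (a + θ * α) (c + θ * γ))‖ₑ * ENNReal.ofReal ε ≤
      (∫⁻ u in Icc (c + θ * γ) (c + θ * γ + ε), ‖F (pt i (a + θ * α) u)‖ₑ) +
      (∫⁻ u in Icc (c + θ * γ) (c + θ * γ + ε), ‖classicalPartial j F (pt i (a + θ * α) u)‖ₑ) *
        ENNReal.ofReal ε := by
    intro θ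
    have h := enorm_pt_mul_le hF j (c := c + θ * γ) (d := c + θ * γ + ε)
      (left_mem_Icc.2 (by linarith)) (a + θ * α)
    simp_rw [← pt_swap i j hij] at h
    rwa [add_sub_cancel_left] at h
  refine (lintegral_mono hpt).trans ?_
  have hmeas : Measurable fun θ : ℝ =>
      ∫⁻ u in Icc (c + θ * γ) (c + θ * γ + ε), ‖F (pt i (a + θ * α) u)‖ₑ := by
    -- Translating to the fixed interval `[0, ε]` makes the inner integral visibly measurable in
    -- `θ`.
    have e : ∀ θ : ℝ, ∫⁻ u in Icc (c + θ * γ) (c + θ * γ + ε), ‖F (pt i (a + θ * α) u)‖ₑ =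
        ∫⁻ s in Icc 0 ε, ‖F (pt i (a + θ * α) (c + θ * γ + s))‖ₑ := by
      intro θ
      have hmp : MeasurePreserving (fun s => c + θ * γ + s) volume volume :=
        measurePreserving_add_left volume (c + θ * γ)
      have hemb : MeasurableEmbedding (fun s : ℝ => c + θ * γ + s) :=
        measurableEmbedding_addLeft _
      rw [← hmp.setLIntegral_comp_preimage_emb hemb]
      simp
    simp_rw [e]
    refine Measurable.lintegral_prod_right' (ν := volume.restrict (Icc 0 ε))
      (f := fun z : ℝ × ℝ => ‖F (pt i (a + z.1 * α) (c + z.1 * γ + z.2))‖ₑ) ?_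
    refine m0.comp (Continuous.measurable ?_)
    exact (continuous_pt i).comp (g := fun z : ℝ × ℝ => pt i z.1 z.2)
      (f := fun z : ℝ × ℝ => (a + z.1 * α, c + z.1 * γ + z.2)) (by fun_prop)
  rw [lintegral_add_left hmeas, lintegral_mul_const' _ _ ENNReal.ofReal_ne_top, mul_add,
    ← mul_assoc]
  gcongr
  · exact key _ m0
  · exact key _ m1

/-- The smooth estimate holds for mollifications of small radius with bounds independent of the
radius. By continuity of `u` they converge at every point of the curve, and Fatou passes to the
limit. -/
theorem lintegral_enorm_trace_le {u U : Plane → ℝ} {i j : Fin 2} (hij : j ≠ i)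
    (hu : ContinuousOn u openSquare) (hu2 : MemLp u 2 (volume.restrict openSquare))
    (hU : HasWeakDeriv openSquare (unitIndex j) u U)
    (hU2 : MemLp U 2 (volume.restrict openSquare))
    {a α c γ t₀ t₁ ε m : ℝ} (hα : α ≠ 0) (hε : 0 < ε) (hm : 0 < m)
    (hin : ∀ θ ∈ Icc t₀ t₁, ∀ s ∈ Icc (c + θ * γ) (c + θ * γ + ε),
      pt i (a + θ * α) s ∈ innerSquare m) :
    (∫⁻ θ in Icc t₀ t₁, ‖u (pt i (a + θ * α) (c + θ * γ))‖ₑ) * ENNReal.ofReal ε ≤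
      ENNReal.ofReal |α⁻¹| * (eLpNorm u 2 (volume.restrict openSquare) +
        eLpNorm U 2 (volume.restrict openSquare) * ENNReal.ofReal ε) := by
  have iu := (integrable_indicator_of_memLp hu2).locallyIntegrable
  have iU := (integrable_indicator_of_memLp hU2).locallyIntegrable
  set B := ENNReal.ofReal |α⁻¹| * (eLpNorm u 2 (volume.restrict openSquare) +
        eLpNorm U 2 (volume.restrict openSquare) * ENNReal.ofReal ε) with hB
  have hE := (isClosed_innerSquare m).measurableSet
  have hvol : volume (innerSquare m) ^ (1 / 2 : ℝ) ≤ 1 :=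
    ENNReal.rpow_le_one (volume_innerSquare_le hm) (by norm_num)
  have hF : ∀ n, ContDiff ℝ ∞ (mollify (bumpSeq n) (openSquare.indicator u)) :=
    fun n => contDiff_mollify _ iu
  have hn : ∀ᶠ n in atTop, (∫⁻ θ in Icc t₀ t₁,
      ‖mollify (bumpSeq n) (openSquare.indicator u) (pt i (a + θ * α) (c + θ * γ))‖ₑ) *
        ENNReal.ofReal ε ≤ B := by
    filter_upwards [tendsto_rOut_bumpSeq.eventually_lt_const hm] with n hn
    refine (lintegral_enorm_affine_le (hF n) hij hα hε hE hin).trans ?_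
    have e1 : ∀ x ∈ innerSquare m,
        classicalPartial j (mollify (bumpSeq n) (openSquare.indicator u)) x =
          mollify (bumpSeq n) (openSquare.indicator U) x := fun x hx =>
      classicalPartial_mollify_of_hasWeakDeriv _ isOpen_openSquare hU iu
        (closedBall_subset_openSquare hn hx)
    rw [setLIntegral_congr_fun hE
      (f := fun x => ‖classicalPartial j (mollify (bumpSeq n) (openSquare.indicator u)) x‖ₑ)
      (g := fun x => ‖mollify (bumpSeq n) (openSquare.indicator U) x‖ₑ)
      (fun x hx => by simp only [e1 x hx]), hB,
      ← eLpNorm_indicator_eq_eLpNorm_restrict isOpen_openSquare.measurableSet,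
      ← eLpNorm_indicator_eq_eLpNorm_restrict isOpen_openSquare.measurableSet]
    gcongr
    · exact (lintegral_enorm_mollify_le _ iu.aestronglyMeasurable _).trans
        (mul_le_of_le_one_right' hvol)
    · exact (lintegral_enorm_mollify_le _ iU.aestronglyMeasurable _).trans
        (mul_le_of_le_one_right' hvol)
  have hlim : ∀ θ ∈ Icc t₀ t₁, Tendsto (fun n => ‖mollify (bumpSeq n) (openSquare.indicator u)
      (pt i (a + θ * α) (c + θ * γ))‖ₑ) atTop (𝓝 ‖u (pt i (a + θ * α) (c + θ * γ))‖ₑ) := by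
    intro θ hθ
    have hxO : pt i (a + θ * α) (c + θ * γ) ∈ openSquare :=
      innerSquare_subset_openSquare hm (hin θ hθ _ (left_mem_Icc.2 (by linarith)))
    have hnhds := isOpen_openSquare.mem_nhds hxO
    have hc : ContinuousAt (openSquare.indicator u) (pt i (a + θ * α) (c + θ * γ)) := by
      refine (hu.continuousAt hnhds).congr ?_
      filter_upwards [hnhds] with z hz
      rw [indicator_of_mem hz]
    have := (tendsto_mollify_of_continuousAt iu hc).enorm
    rwa [indicator_of_mem hxO] at this
  have hfatou : ∫⁻ θ in Icc t₀ t₁, ‖u (pt i (a + θ * α) (c + θ * γ))‖ₑ ≤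
      liminf (fun n => ∫⁻ θ in Icc t₀ t₁, ‖mollify (bumpSeq n) (openSquare.indicator u)
        (pt i (a + θ * α) (c + θ * γ))‖ₑ) atTop := by
    refine le_trans (le_of_eq ?_) (lintegral_liminf_le fun n => ?_)
    · exact setLIntegral_congr_fun measurableSet_Icc fun θ hθ => (hlim θ hθ).liminf_eq.symm
    · refine ((hF n).continuous.comp ?_).enorm.measurable
      exact (continuous_pt i).comp (g := fun z : ℝ × ℝ => pt i z.1 z.2)
        (f := fun θ : ℝ => (a + θ * α, c + θ * γ)) (by fun_prop)
  have hε0 : ENNReal.ofReal ε ≠ 0 := by simpa using hε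
  rw [← ENNReal.le_div_iff_mul_le (Or.inl hε0) (Or.inl ENNReal.ofReal_ne_top)]
  refine hfatou.trans ?_
  refine (liminf_le_liminf (hn.mono fun n h => ?_)).trans_eq (liminf_const _)
  exact (ENNReal.le_div_iff_mul_le (Or.inl hε0) (Or.inl ENNReal.ofReal_ne_top)).2 h

end

section

/-! ### Geometry of triangulations -/

variable {T : Triangulation} {K K' : Finset Plane}

theorem Triangulation.mem_cells : K ∈ T.cells ↔ K ∈ T.complex.faces ∧ K.card = 3 := by
  simp [Triangulation.cells]

theorem convex_tri (K : Finset Plane) : Convex ℝ (tri K) := convex_convexHull ℝ _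

theorem isCompact_tri (K : Finset Plane) : IsCompact (tri K) :=
  K.finite_toSet.isCompact_convexHull (𝕜 := ℝ)

theorem measurableSet_tri (K : Finset Plane) : MeasurableSet (tri K) :=
  (isCompact_tri K).measurableSet

theorem mem_tri_of_mem {a : Plane} (ha : a ∈ K) : a ∈ tri K := subset_convexHull ℝ _ ha

theorem tri_subset_closedSquare (hK : K ∈ T.cells) : tri K ⊆ closedSquare := by
  rw [← T.space_eq]
  exact T.complex.convexHull_subset_space (Triangulation.mem_cells.1 hK).1

theorem exists_mem_tri (T : Triangulation) {x : Plane} (hx : x ∈ closedSquare) :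
    ∃ K ∈ T.cells, x ∈ tri K := by
  rw [← T.space_eq, Geometry.SimplicialComplex.mem_space_iff] at hx
  obtain ⟨s, hs, hxs⟩ := hx
  obtain ⟨K, hK, hsK, hc⟩ := T.pure s hs
  exact ⟨K, Triangulation.mem_cells.2 ⟨hK, hc⟩, convexHull_mono (by exact_mod_cast hsK) hxs⟩

theorem affineSpan_eq_top_iff_card {s : Finset Plane}
    (hi : AffineIndependent ℝ ((↑) : s → Plane)) :
    affineSpan ℝ (s : Set Plane) = ⊤ ↔ s.card = 3 := by
  have h := hi.affineSpan_eq_top_iff_card_eq_finrank_add_one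
  simp only [Subtype.range_coe_subtype, Fintype.card_coe, finrank_euclideanSpace,
    Fintype.card_fin] at h
  exact h

theorem affineSpan_cell (hK : K ∈ T.cells) : affineSpan ℝ (K : Set Plane) = ⊤ :=
  (affineSpan_eq_top_iff_card (T.complex.indep (Triangulation.mem_cells.1 hK).1)).2
    (Triangulation.mem_cells.1 hK).2

theorem interior_tri_nonempty (hK : K ∈ T.cells) : (interior (tri K)).Nonempty :=
  interior_convexHull_nonempty_iff_affineSpan_eq_top.2 (affineSpan_cell hK)

theorem tri_inter_tri (hK : K ∈ T.cells) (hK' : K' ∈ T.cells) :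
    tri K ∩ tri K' ⊆ convexHull ℝ ((K : Set Plane) ∩ K') :=
  T.complex.inter_subset_convexHull (Triangulation.mem_cells.1 hK).1
    (Triangulation.mem_cells.1 hK').1

/-- Distinct cells share at most two vertices, so their intersection lies in a proper affine
subspace. -/
theorem volume_tri_inter_tri (hK : K ∈ T.cells) (hK' : K' ∈ T.cells) (hne : K ≠ K') :
    volume (tri K ∩ tri K') = 0 := by
  classical
  refine measure_mono_null ((tri_inter_tri hK hK').trans (convexHull_subset_affineSpan _)) ?_
  refine Measure.addHaar_affineSubspace _ _ fun htop => hne ?_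
  have hsub : K ∩ K' ⊆ K := Finset.inter_subset_left
  have hi : AffineIndependent ℝ ((↑) : (K ∩ K' : Finset Plane) → Plane) :=
    (T.complex.indep (Triangulation.mem_cells.1 hK).1).mono (by exact_mod_cast hsub)
  rw [← Finset.coe_inter, affineSpan_eq_top_iff_card hi] at htop
  have h1 := Finset.eq_of_subset_of_card_le hsub (by
    rw [htop, (Triangulation.mem_cells.1 hK).2])
  have h2 := Finset.eq_of_subset_of_card_le (Finset.inter_subset_right : K ∩ K' ⊆ K') (by
    rw [htop, (Triangulation.mem_cells.1 hK').2])
  rw [← h1, h2]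

theorem pairwise_aedisjoint_tri (T : Triangulation) :
    (T.cells : Set (Finset Plane)).Pairwise (Function.onFun (AEDisjoint volume) tri) :=
  fun _ hK _ hK' hne => volume_tri_inter_tri hK hK' hne

theorem sum_volume_inter_le (T : Triangulation) (s : Finset (Finset Plane)) (hs : s ⊆ T.cells)
    (S : Set Plane) (hS : MeasurableSet S) :
    ∑ K ∈ s, volume (tri K ∩ S) ≤ volume S := by
  rw [← measure_biUnion_finset₀]
  · exact measure_mono (iUnion₂_subset fun _ _ => inter_subset_right)
  · intro K hK K' hK' hne
    exact (pairwise_aedisjoint_tri T (hs hK) (hs hK') hne).mono inter_subset_left inter_subset_left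
  · exact fun K _ => ((measurableSet_tri K).inter hS).nullMeasurableSet

theorem interior_tri_ae_eq (K : Finset Plane) : interior (tri K) =ᵐ[volume] tri K :=
  interior_ae_eq_of_null_frontier ((convex_tri K).addHaar_frontier volume)

theorem closedSquare_eq_biUnion (T : Triangulation) : closedSquare = ⋃ K ∈ T.cells, tri K := by
  refine subset_antisymm (fun x hx => ?_) (iUnion₂_subset fun K hK => tri_subset_closedSquare hK)
  obtain ⟨K, hK, hxK⟩ := exists_mem_tri T hx
  exact mem_iUnion₂.2 ⟨K, hK, hxK⟩

theorem openSquare_ae_eq : openSquare =ᵐ[volume] closedSquare :=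
  openSquare_subset_closedSquare.eventuallyLE.antisymm
    (ae_le_set.2 volume_closedSquare_diff_openSquare)

theorem interior_tri_subset_openSquare (hK : K ∈ T.cells) : interior (tri K) ⊆ openSquare := by
  have h1 : interior (tri K) ⊆ interior closedSquare := interior_mono (tri_subset_closedSquare hK)
  refine h1.trans fun x hx k => ?_
  have hx' := mem_interior_iff_mem_nhds.1 hx
  have hc : Tendsto (fun t : ℝ => x + t • EuclideanSpace.single k (1 : ℝ)) (𝓝 0) (𝓝 x) := by
    have : Continuous fun t : ℝ => x + t • EuclideanSpace.single k (1 : ℝ) := by fun_prop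
    simpa using this.tendsto 0
  have hev := hc.eventually hx'
  obtain ⟨ε, hε, hb⟩ := Metric.eventually_nhds_iff.1 hev
  have h2 := hb (y := ε / 2) (by rw [Real.dist_eq, sub_zero, abs_of_pos] <;> linarith) k
  have h3 := hb (y := -(ε / 2)) (by rw [Real.dist_eq, sub_zero, abs_neg, abs_of_pos] <;> linarith) k
  simp at h2 h3
  constructor <;> linarith

theorem lintegral_openSquare_eq_sum (T : Triangulation) (G : Plane → ℝ≥0∞) :
    ∫⁻ x in openSquare, G x = ∑ K ∈ T.cells, ∫⁻ x in interior (tri K), G x := by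
  rw [setLIntegral_congr openSquare_ae_eq, closedSquare_eq_biUnion T,
    lintegral_biUnion_finset₀ (pairwise_aedisjoint_tri T)
      (fun K _ => (measurableSet_tri K).nullMeasurableSet)]
  exact Finset.sum_congr rfl fun K _ => setLIntegral_congr (interior_tri_ae_eq K).symm

theorem dist_le_diam_tri {x y : Plane} (hx : x ∈ tri K) (hy : y ∈ tri K) :
    dist x y ≤ Metric.diam (tri K) :=
  Metric.dist_le_diam_of_mem (isCompact_tri K).isBounded hx hy

theorem diam_tri_le_meshSize (hK : K ∈ T.cells) : Metric.diam (tri K) ≤ meshSize T :=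
  le_ciSup (f := fun K : T.cells => Metric.diam (tri K.1)) (Set.finite_range _).bddAbove ⟨K, hK⟩

/-- A shape-regular triangle contains a disc of comparable size. -/
theorem exists_closedBall_subset_tri (hK : K ∈ T.cells) {c₀ : ℝ}
    (hc : Metric.diam (tri K) / inDiam K ≤ c₀) :
    ∃ x r, 0 < r ∧ Metric.closedBall x r ⊆ tri K ∧ Metric.diam (tri K) ≤ 4 * c₀ * r := by
  set D : Set ℝ := {δ : ℝ | 0 ≤ δ ∧ ∃ x, Metric.closedBall x (δ / 2) ⊆ tri K} with hD
  have hbdd : BddAbove D := by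
    refine ⟨Metric.diam (tri K), ?_⟩
    rintro δ ⟨hδ, x, hx⟩
    have e : ‖(EuclideanSpace.single 0 (1 : ℝ) : Plane)‖ = 1 := by simp
    have h1 : x + (δ / 2) • (EuclideanSpace.single 0 (1 : ℝ) : Plane) ∈ tri K := hx (by
      rw [Metric.mem_closedBall, dist_eq_norm, add_sub_cancel_left, norm_smul, e, Real.norm_eq_abs,
        abs_of_nonneg (by linarith), mul_one])
    have h2 : x - (δ / 2) • (EuclideanSpace.single 0 (1 : ℝ) : Plane) ∈ tri K := hx (by
      rw [Metric.mem_closedBall, dist_eq_norm, sub_sub_cancel_left, norm_neg, norm_smul, e,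
        Real.norm_eq_abs, abs_of_nonneg (by linarith), mul_one])
    have h3 := dist_le_diam_tri h1 h2
    rw [dist_eq_norm, add_sub_sub_cancel, ← add_smul, norm_smul, e, Real.norm_eq_abs,
      abs_of_nonneg (by linarith), mul_one] at h3
    linarith
  -- Positivity of `inDiam K` must come first: division by zero would yield zero and empty the shape
  -- condition of content.
  obtain ⟨δ₀, hδ₀, hδ₀D⟩ : ∃ δ > 0, δ ∈ D := by
    obtain ⟨x, hx⟩ := interior_tri_nonempty hK
    obtain ⟨ε, hε, hb⟩ := Metric.nhds_basis_closedBall.mem_iff.1 (mem_interior_iff_mem_nhds.1 hx)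
    exact ⟨2 * ε, by positivity, by positivity, x, by rwa [mul_div_cancel_left₀ _ two_ne_zero]⟩
  have hpos : 0 < inDiam K := hδ₀.trans_le (le_csSup hbdd hδ₀D)
  -- A disc of diameter `δ` above half the supremum gives `diam ≤ c₀ * inDiam ≤ 2 c₀ δ`, which is `4
  -- c₀` times the radius.
  obtain ⟨δ, ⟨_, x, hx⟩, hδ⟩ := exists_lt_of_lt_csSup (s := D) ⟨δ₀, hδ₀D⟩
    (show inDiam K / 2 < sSup D from half_lt_self hpos)
  refine ⟨x, δ / 2, by linarith, hx, ?_⟩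
  rw [div_le_iff₀ hpos] at hc
  have hc0 : 0 ≤ c₀ := by
    by_contra! h
    have := mul_neg_of_neg_of_pos h hpos
    linarith [Metric.diam_nonneg (s := tri K)]
  nlinarith

/-- An axis-parallel square of side `r` with the same centre fits into the disc. -/
theorem sq_le_volume_of_closedBall_subset {x : Plane} {r : ℝ} (hr : 0 < r)
    (h : Metric.closedBall x r ⊆ tri K) : r ^ 2 ≤ (volume (tri K)).toReal := by
  have hsub : {y : Plane | y 0 ∈ Icc (x 0 - r / 2) (x 0 + r / 2) ∧
      y 1 ∈ Icc (x 1 - r / 2) (x 1 + r / 2)} ⊆ tri K := by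
    rintro y ⟨h0, h1⟩
    refine h ?_
    rw [Metric.mem_closedBall, EuclideanSpace.dist_eq, Fin.sum_univ_two]
    refine Real.sqrt_le_iff.2 ⟨hr.le, ?_⟩
    simp only [Real.dist_eq, sq_abs]
    have a0 : (y 0 - x 0) ^ 2 ≤ (r / 2) ^ 2 := sq_le_sq' (by linarith [h0.1]) (by linarith [h0.2])
    have a1 : (y 1 - x 1) ^ 2 ≤ (r / 2) ^ 2 := sq_le_sq' (by linarith [h1.1]) (by linarith [h1.2])
    nlinarith
  have h2 := measure_mono (μ := volume) hsub
  rw [volume_box 0 1 (by decide), ← ENNReal.ofReal_mul (by linarith)] at h2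
  have h3 := (ENNReal.ofReal_le_iff_le_toReal (isCompact_tri K).measure_ne_top).1 h2
  calc r ^ 2 = (x 0 + r / 2 - (x 0 - r / 2)) * (x 1 + r / 2 - (x 1 - r / 2)) := by ring
    _ ≤ _ := h3

end

section

/-! ### Inverse inequalities for polynomials -/

/-- The value at the origin of a univariate polynomial of bounded degree is controlled by a
weighted `L²` norm on the unit interval. -/
theorem exists_sq_le_mul_integral (m : ℕ) : ∃ C : ℝ, 0 < C ∧ ∀ c : Fin (m + 1) → ℝ,
    c 0 ^ 2 ≤ C * ∫ t in (0 : ℝ)..1, t ^ 2 * (∑ k, c k * t ^ (k : ℕ)) ^ 2 := by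
  -- A positive definite quadratic form on a finite-dimensional space. The weight `t ^ 2`
  -- anticipates the Jacobian of a homothety of ratio `t` in the plane.
  set N : (Fin (m + 1) → ℝ) → ℝ :=
    fun c => ∫ t in (0 : ℝ)..1, t ^ 2 * (∑ k, c k * t ^ (k : ℕ)) ^ 2 with hN
  have hcont : Continuous N := by
    refine intervalIntegral.continuous_parametric_intervalIntegral_of_continuous'
      (f := fun (c : Fin (m + 1) → ℝ) (t : ℝ) => t ^ 2 * (∑ k, c k * t ^ (k : ℕ)) ^ 2) ?_ 0 1
    unfold Function.uncurry
    fun_prop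
  have hpos : ∀ c, c ≠ 0 → 0 < N c := by
    intro c hc
    set q : Polynomial ℝ := ∑ k : Fin (m + 1), Polynomial.C (c k) * Polynomial.X ^ (k : ℕ) with hq
    have hqe : ∀ t, q.eval t = ∑ k, c k * t ^ (k : ℕ) := by
      intro t; simp [hq, Polynomial.eval_finsetSum]
    have hq0 : q ≠ 0 := by
      intro h0
      apply hc
      funext k
      have : q.coeff k = 0 := by rw [h0]; simp
      rw [hq, Polynomial.finsetSum_coeff] at this
      simp only [Polynomial.coeff_C_mul, Polynomial.coeff_X_pow] at this
      rw [Finset.sum_eq_single k] at this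
      · simpa using this
      · intro b _ hb
        have : (k : ℕ) ≠ b := fun h => hb (Fin.ext h.symm)
        simp [this]
      · simp
    obtain ⟨t, ht, hqt⟩ : ∃ t ∈ Ioo (0 : ℝ) 1, q.eval t ≠ 0 := by
      by_contra! hcon
      exact hq0 (Polynomial.eq_zero_of_infinite_isRoot q
        ((Ioo_infinite (zero_lt_one' ℝ)).mono hcon))
    refine intervalIntegral.integral_pos zero_lt_one (by fun_prop) (fun t _ => by positivity)
      ⟨t, Ioo_subset_Icc_self ht, ?_⟩
    have ht0 := ht.1
    rw [← hqe]
    positivity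
  -- Compactness of the unit sphere gives a positive minimum, and homogeneity of degree two extends
  -- the bound to all coefficient vectors.
  obtain ⟨c₀, hc₀, hmin⟩ := (isCompact_sphere (0 : Fin (m + 1) → ℝ) 1).exists_isMinOn
    (NormedSpace.sphere_nonempty.2 zero_le_one) hcont.continuousOn
  have hc₀ne : c₀ ≠ 0 := by
    rintro rfl
    simp at hc₀
  have hκ := hpos c₀ hc₀ne
  refine ⟨(N c₀)⁻¹, inv_pos.2 hκ, fun c => ?_⟩
  change c 0 ^ 2 ≤ (N c₀)⁻¹ * N c
  rw [inv_mul_eq_div, le_div_iff₀ hκ]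
  by_cases hc : c = 0
  · subst hc; simp [hN]
  have hnorm : 0 < ‖c‖ := norm_pos_iff.2 hc
  have hsph : ‖c‖⁻¹ • c ∈ Metric.sphere (0 : Fin (m + 1) → ℝ) 1 := by
    simp [norm_smul, hnorm.ne']
  have h1 : N c₀ ≤ N (‖c‖⁻¹ • c) := hmin hsph
  have h2 : N (‖c‖⁻¹ • c) = (‖c‖⁻¹) ^ 2 * N c := by
    simp only [hN]
    rw [← intervalIntegral.integral_const_mul]
    congr 1
    funext t
    simp only [Pi.smul_apply, smul_eq_mul, mul_assoc]
    rw [← Finset.mul_sum]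
    ring
  have h3 : c 0 ^ 2 ≤ ‖c‖ ^ 2 := by
    rw [← sq_abs]
    exact pow_le_pow_left₀ (abs_nonneg _) (norm_le_pi_norm c 0) 2
  rw [h2] at h1
  calc c 0 ^ 2 * N c₀ ≤ ‖c‖ ^ 2 * ((‖c‖⁻¹) ^ 2 * N c) := by
        gcongr
    _ = N c := by field_simp

/-- The restriction of a bivariate polynomial to a line. -/
theorem exists_coeff_polyAt_line {p : Poly} {m : ℕ} (hp : p.totalDegree ≤ m) (x d : Plane) :
    ∃ c : Fin (m + 1) → ℝ, ∀ t : ℝ, polyAt p (x + t • d) = ∑ k, c k * t ^ (k : ℕ) := by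
  set q : Polynomial ℝ := MvPolynomial.aeval
    (fun i : Fin 2 => Polynomial.C (x i) + Polynomial.C (d i) * Polynomial.X) p with hq
  have hdeg : q.natDegree < m + 1 := by
    have := MvPolynomial.aeval_natDegree_le p hp
      (fun i : Fin 2 => Polynomial.C (x i) + Polynomial.C (d i) * Polynomial.X) (n := 1)
        (fun i => by
        rw [add_comm]; exact Polynomial.natDegree_linear_le)
    rw [mul_one] at this
    exact Nat.lt_succ_of_le this
  refine ⟨fun k => q.coeff k, fun t => ?_⟩
  have h1 : polyAt p (x + t • d) = q.eval t := by
    rw [hq, polyAt, ← Polynomial.coe_evalRingHom, MvPolynomial.map_aeval]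
    simp only [map_add, map_mul, Polynomial.coe_evalRingHom, Polynomial.eval_C, Polynomial.eval_X]
    rw [MvPolynomial.eval]
    congr 1
    ext i
    · simp
    · simp [mul_comm]
  rw [h1, Polynomial.eval_eq_sum_range' hdeg, Finset.sum_range]

theorem lintegral_homothety {P : Plane → ℝ≥0∞} (hP : Measurable P) (x : Plane) {t : ℝ}
    (ht : 0 < t) : ENNReal.ofReal (t ^ 2) * ∫⁻ y, P (x + t • (y - x)) = ∫⁻ z, P z := by
  have h1 : ∫⁻ y, P (x + t • (y - x)) = ∫⁻ y, P (x + t • y) :=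
    lintegral_sub_right_eq_self (fun y => P (x + t • y)) x
  have h2 : ∫⁻ y, P (x + t • y) = ∫⁻ y, P (x + y) ∂(Measure.map (t • ·) volume) := by
    rw [lintegral_map (f := fun y => P (x + y)) (hP.comp (measurable_const_add x))
      (measurable_const_smul t)]
  rw [h1, h2, Measure.map_addHaar_smul _ ht.ne', lintegral_smul_measure,
    lintegral_add_left_eq_self P x, smul_eq_mul, ← mul_assoc, ← ENNReal.ofReal_mul (by positivity)]
  rw [finrank_euclideanSpace, Fintype.card_fin, abs_of_nonneg (by positivity),
    mul_inv_cancel₀ (by positivity), ENNReal.ofReal_one, one_mul]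

/-- The univariate inequality is applied along the segment from `x` to each `y ∈ S`, and the result
is integrated over `y`. After exchanging integrals, the homothety with centre `x` and ratio `t` has
Jacobian `t ^ 2`, which the weight cancels, so each `t` contributes at most the integral of `p ^ 2`
over `S`. The constant thus depends on the degree only and not on the size or shape of `S`. -/
theorem exists_inverse_inequality (m : ℕ) : ∃ C : ℝ, 0 < C ∧ ∀ p : Poly, p.totalDegree ≤ m →
    ∀ S : Set Plane, Convex ℝ S → IsCompact S → ∀ x ∈ S,
      (volume S).toReal * polyAt p x ^ 2 ≤ C * ∫ y in S, polyAt p y ^ 2 := by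
  obtain ⟨C, hC, hCc⟩ := exists_sq_le_mul_integral m
  refine ⟨C, hC, fun p hp S hS hSc x hx => ?_⟩
  have hSm := hSc.measurableSet
  have hcont := continuous_polyAt p
  have hDint : IntegrableOn (fun y => polyAt p y ^ 2) S :=
    (hcont.pow 2).continuousOn.integrableOn_compact hSc
  set P : Plane → ℝ≥0∞ := S.indicator fun y => ENNReal.ofReal (polyAt p y ^ 2) with hPdef
  have hPm : Measurable P := (hcont.pow 2).measurable.ennreal_ofReal.indicator hSm
  have hPint : ∫⁻ z, P z = ENNReal.ofReal (∫ y in S, polyAt p y ^ 2) := by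
    rw [hPdef, lintegral_indicator hSm, ofReal_integral_eq_lintegral_ofReal hDint
      (Eventually.of_forall fun y => sq_nonneg _)]
  have hline : ∀ y ∈ S, ENNReal.ofReal (polyAt p x ^ 2) ≤ ENNReal.ofReal C *
      ∫⁻ t in Ioc (0 : ℝ) 1, ENNReal.ofReal (t ^ 2) * P (x + t • (y - x)) := by
    intro y hy
    obtain ⟨c, hc⟩ := exists_coeff_polyAt_line hp x (y - x)
    have h0 : c 0 = polyAt p x := by
      have := hc 0
      rw [zero_smul, add_zero] at this
      rw [this, Fin.sum_univ_succ]
      simp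
    have h1 := hCc c
    rw [h0] at h1
    simp_rw [← hc] at h1
    refine (ENNReal.ofReal_le_ofReal h1).trans ?_
    rw [ENNReal.ofReal_mul hC.le]
    gcongr
    have hc' : Continuous fun t : ℝ => t ^ 2 * polyAt p (x + t • (y - x)) ^ 2 := by fun_prop
    rw [intervalIntegral.integral_of_le zero_le_one, ofReal_integral_eq_lintegral_ofReal
      (hc'.integrableOn_Ioc) (Eventually.of_forall fun t => by positivity)]
    refine setLIntegral_mono' measurableSet_Ioc fun t ht => ?_
    have hmem : x + t • (y - x) ∈ S := hS.add_smul_sub_mem hx hy ⟨ht.1.le, ht.2⟩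
    rw [hPdef, indicator_of_mem hmem, ← ENNReal.ofReal_mul (sq_nonneg t)]
  have key : ENNReal.ofReal (polyAt p x ^ 2) * volume S ≤
      ENNReal.ofReal C * ENNReal.ofReal (∫ y in S, polyAt p y ^ 2) := by
    calc ENNReal.ofReal (polyAt p x ^ 2) * volume S
        = ∫⁻ _y in S, ENNReal.ofReal (polyAt p x ^ 2) := by rw [setLIntegral_const]
      _ ≤ ∫⁻ y in S, ENNReal.ofReal C *
          ∫⁻ t in Ioc (0 : ℝ) 1, ENNReal.ofReal (t ^ 2) * P (x + t • (y - x)) :=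
          setLIntegral_mono' hSm hline
      _ ≤ ∫⁻ y, ENNReal.ofReal C *
          ∫⁻ t in Ioc (0 : ℝ) 1, ENNReal.ofReal (t ^ 2) * P (x + t • (y - x)) :=
          setLIntegral_le_lintegral _ _
      _ = ENNReal.ofReal C * ∫⁻ y,
          ∫⁻ t in Ioc (0 : ℝ) 1, ENNReal.ofReal (t ^ 2) * P (x + t • (y - x)) := by
          rw [lintegral_const_mul' _ _ ENNReal.ofReal_ne_top]
      _ = ENNReal.ofReal C * ∫⁻ t in Ioc (0 : ℝ) 1,
          ∫⁻ y, ENNReal.ofReal (t ^ 2) * P (x + t • (y - x)) := by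
          rw [lintegral_lintegral_swap]
          refine Measurable.aemeasurable ?_
          refine Measurable.mul ?_ (hPm.comp ?_)
          · exact (measurable_snd.pow_const 2).ennreal_ofReal
          · have : Continuous fun z : Plane × ℝ => x + z.2 • (z.1 - x) := by fun_prop
            exact this.measurable
      _ = ENNReal.ofReal C * ∫⁻ _t in Ioc (0 : ℝ) 1, ∫⁻ z, P z := by
          congr 1
          refine setLIntegral_congr_fun measurableSet_Ioc fun t ht => ?_
          rw [lintegral_const_mul' _ _ ENNReal.ofReal_ne_top, lintegral_homothety hPm x ht.1]
      _ = _ := by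
          rw [setLIntegral_const, hPint]; simp
  rw [← ENNReal.ofReal_mul hC.le] at key
  have h2 := ENNReal.toReal_mono ENNReal.ofReal_ne_top key
  rw [ENNReal.toReal_mul, ENNReal.toReal_ofReal (sq_nonneg _), ENNReal.toReal_ofReal
    (mul_nonneg hC.le (integral_nonneg fun _ => sq_nonneg _)), mul_comm] at h2
  exact h2

theorem totalDegree_pderiv_le (i : Fin 2) (p : Poly) :
    (MvPolynomial.pderiv i p).totalDegree ≤ p.totalDegree := by
  conv_lhs => rw [p.as_sum, map_sum]
  refine (MvPolynomial.totalDegree_finsetSum _ _).trans (Finset.sup_le fun s hs => ?_)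
  rw [MvPolynomial.pderiv_monomial]
  refine (MvPolynomial.totalDegree_monomial_le _ _).trans ?_
  refine le_trans ?_ (MvPolynomial.le_totalDegree hs)
  exact Finsupp.degree_mono tsub_le_self

/-- The extreme case is `q ^ 2 * t`, of degree at most `2 * 3 + 1`. -/
theorem InShapeSpace.totalDegree_le {K : Finset Plane} {p : Poly} (h : InShapeSpace K p) :
    p.totalDegree ≤ 7 := by
  obtain ⟨q, r, s, t, hq, hr, hs, ht, rfl⟩ := h
  have hq3 := hq.2.1
  have h1 := MvPolynomial.totalDegree_mul q s
  have h2 := MvPolynomial.totalDegree_mul (q ^ 2) t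
  have h3 := MvPolynomial.totalDegree_pow q 2
  have h4 := MvPolynomial.totalDegree_add (r + q * s) (q ^ 2 * t)
  have h5 := MvPolynomial.totalDegree_add r (q * s)
  refine h4.trans (max_le (h5.trans (max_le ?_ ?_)) ?_) <;> omega

/-- First and second derivatives of a polynomial on a cell are bounded by a constant whose square
is controlled by `L²` norms. -/
theorem exists_derivative_bound : ∃ C : ℝ, 0 < C ∧ ∀ p : Poly, p.totalDegree ≤ 7 →
    ∀ S : Set Plane, Convex ℝ S → IsCompact S → S.Nonempty → ∃ N : ℝ, 0 ≤ N ∧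
      (∀ x ∈ S, ∀ i, |polyAt (MvPolynomial.pderiv i p) x| ≤ N) ∧
      (∀ x ∈ S, ∀ i j, |polyAt (MvPolynomial.pderiv j (MvPolynomial.pderiv i p)) x| ≤ N) ∧
      (volume S).toReal * N ^ 2 ≤ C * ((∑ i, ∫ y in S, polyAt (MvPolynomial.pderiv i p) y ^ 2) +
        ∑ i, ∑ j, ∫ y in S, polyAt (MvPolynomial.pderiv j (MvPolynomial.pderiv i p)) y ^ 2) := by
  obtain ⟨C, hC, hinv⟩ := exists_inverse_inequality 7
  -- `N` will be the sum of the maxima of the two first and four second derivatives; the square of a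
  -- sum of six terms costs the factor 6.
  refine ⟨6 * C, by positivity, fun p hp S hS hSc hne => ?_⟩
  have hmax : ∀ q : Poly, ∃ z ∈ S, ∀ x ∈ S, |polyAt q x| ≤ |polyAt q z| := fun q =>
    hSc.exists_isMaxOn hne (continuous_polyAt q).abs.continuousOn
  choose z hz hzmax using hmax
  have hd1 : ∀ i, (MvPolynomial.pderiv i p).totalDegree ≤ 7 := fun i =>
    (totalDegree_pderiv_le i p).trans hp
  have hd2 : ∀ i j, (MvPolynomial.pderiv j (MvPolynomial.pderiv i p)).totalDegree ≤ 7 := fun i j =>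
    (totalDegree_pderiv_le j _).trans (hd1 i)
  set M : Poly → ℝ := fun q => |polyAt q (z q)| with hM
  have hM0 : ∀ q, 0 ≤ M q := fun q => abs_nonneg _
  have hMi : ∀ q : Poly, q.totalDegree ≤ 7 →
      (volume S).toReal * M q ^ 2 ≤ C * ∫ y in S, polyAt q y ^ 2 := fun q hq => by
    rw [hM, sq_abs]; exact hinv q hq S hS hSc _ (hz q)
  refine ⟨(∑ i, M (MvPolynomial.pderiv i p)) +
    ∑ i, ∑ j, M (MvPolynomial.pderiv j (MvPolynomial.pderiv i p)), ?_, ?_, ?_, ?_⟩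
  · exact add_nonneg (Finset.sum_nonneg fun _ _ => hM0 _)
      (Finset.sum_nonneg fun _ _ => Finset.sum_nonneg fun _ _ => hM0 _)
  · intro x hx i
    refine (hzmax _ x hx).trans (le_add_of_le_of_nonneg ?_
      (Finset.sum_nonneg fun _ _ => Finset.sum_nonneg fun _ _ => hM0 _))
    exact Finset.single_le_sum (f := fun i => M (MvPolynomial.pderiv i p)) (fun _ _ => hM0 _)
      (Finset.mem_univ i)
  · intro x hx i j
    refine (hzmax _ x hx).trans (le_add_of_nonneg_of_le (Finset.sum_nonneg fun _ _ => hM0 _) ?_)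
    refine (Finset.single_le_sum (f := fun j => M (MvPolynomial.pderiv j (MvPolynomial.pderiv i p)))
      (fun _ _ => hM0 _) (Finset.mem_univ j)).trans ?_
    exact Finset.single_le_sum
      (f := fun i => ∑ j, M (MvPolynomial.pderiv j (MvPolynomial.pderiv i p)))
      (fun _ _ => Finset.sum_nonneg fun _ _ => hM0 _) (Finset.mem_univ i)
  · have a0 := hMi _ (hd1 0)
    have a1 := hMi _ (hd1 1)
    have b00 := hMi _ (hd2 0 0)
    have b01 := hMi _ (hd2 0 1)
    have b10 := hMi _ (hd2 1 0)
    have b11 := hMi _ (hd2 1 1)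
    simp only [Fin.sum_univ_two]
    have hV : 0 ≤ (volume S).toReal := ENNReal.toReal_nonneg
    have hsq : ∀ a b c d e f : ℝ, (a + b + (c + d + (e + f))) ^ 2 ≤
        6 * (a ^ 2 + b ^ 2 + (c ^ 2 + d ^ 2 + (e ^ 2 + f ^ 2))) := by
      intro a b c d e f
      have := sq_sum_le_card_mul_sum_sq (s := Finset.univ) (f := ![a, b, c, d, e, f])
      simp [Fin.sum_univ_succ] at this
      linarith [this]
    refine (mul_le_mul_of_nonneg_left (hsq _ _ _ _ _ _) hV).trans ?_
    linarith

end

section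

/-! ### Affine interpolation on a cell -/

variable {T : Triangulation} {K K' : Finset Plane}

theorem exists_affine_interpolation (hK : K ∈ T.cells) (q : Plane → ℝ) :
    ∃ A : Plane →ᵃ[ℝ] ℝ, ∀ a ∈ K, A a = q a := by
  classical
  let b : AffineBasis K ℝ Plane :=
    ⟨((↑) : K → Plane), T.complex.indep (Triangulation.mem_cells.1 hK).1, by
      have := affineSpan_cell hK
      simpa using this⟩
  refine ⟨∑ a : K, q a • b.coord a, fun a ha => ?_⟩
  have : ∀ x : K, b.coord x a = if x = ⟨a, ha⟩ then 1 else 0 := fun x =>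
    b.coord_apply x ⟨a, ha⟩
  have hsum : ∀ (s : Finset K), (∑ x ∈ s, q x • b.coord x : Plane →ᵃ[ℝ] ℝ) a =
      ∑ x ∈ s, q x * b.coord x a := by
    intro s
    induction s using Finset.induction_on with
    | empty => simp
    | insert x s hx ih =>
      rw [Finset.sum_insert hx, Finset.sum_insert hx, AffineMap.coe_add, Pi.add_apply, ih]
      rfl
  rw [hsum]
  simp [this]

theorem abs_affine_sub_le {A : Plane →ᵃ[ℝ] ℝ} {c M : ℝ} (h : ∀ a ∈ K, |A a - c| ≤ M) {x : Plane}
    (hx : x ∈ tri K) : |A x - c| ≤ M := by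
  have hconv : Convex ℝ (A ⁻¹' Icc (c - M) (c + M)) := (convex_Icc _ _).affine_preimage A
  have hsub : tri K ⊆ A ⁻¹' Icc (c - M) (c + M) := convexHull_min (fun a ha => by
    have := abs_le.1 (h a ha)
    exact ⟨by linarith, by linarith⟩) hconv
  have := hsub hx
  exact abs_le.2 ⟨by linarith [this.1], by linarith [this.2]⟩

theorem fderiv_polyAt_apply (q : Poly) (x v : Plane) :
    fderiv ℝ (polyAt q) x v = ∑ i, v i * polyAt (MvPolynomial.pderiv i q) x := by
  have hv : v = ∑ i : Fin 2, v i • EuclideanSpace.single i (1 : ℝ) := by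
    ext k; fin_cases k <;> simp [Fin.sum_univ_two]
  conv_lhs => rw [hv]
  rw [map_sum]
  refine Finset.sum_congr rfl fun i _ => ?_
  rw [map_smul, smul_eq_mul, ← classicalPartial_polyAt]
  rfl

theorem abs_polyAt_sub_le {q : Poly} {S : Set Plane} (hS : Convex ℝ S) {N : ℝ} (hN : 0 ≤ N)
    (h : ∀ x ∈ S, ∀ i, |polyAt (MvPolynomial.pderiv i q) x| ≤ N) {x y : Plane} (hx : x ∈ S)
    (hy : y ∈ S) : |polyAt q x - polyAt q y| ≤ 2 * N * dist x y := by
  have hb : ∀ z ∈ S, ‖fderiv ℝ (polyAt q) z‖ ≤ 2 * N := by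
    intro z hz
    refine ContinuousLinearMap.opNorm_le_bound _ (by positivity) fun v => ?_
    rw [fderiv_polyAt_apply, Fin.sum_univ_two, Real.norm_eq_abs]
    have a0 : |v 0 * polyAt (MvPolynomial.pderiv 0 q) z| ≤ ‖v‖ * N := by
      rw [abs_mul]
      exact mul_le_mul (PiLp.norm_apply_le v 0) (h z hz 0) (abs_nonneg _) (norm_nonneg _)
    have a1 : |v 1 * polyAt (MvPolynomial.pderiv 1 q) z| ≤ ‖v‖ * N := by
      rw [abs_mul]
      exact mul_le_mul (PiLp.norm_apply_le v 1) (h z hz 1) (abs_nonneg _) (norm_nonneg _)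
    refine (abs_add_le _ _).trans ?_
    linarith
  have := hS.norm_image_sub_le_of_norm_fderiv_le
    (fun z _ => (contDiff_polyAt q).differentiable (by simp) z) hb hy hx
  rwa [Real.norm_eq_abs, ← dist_eq_norm] at this

/-- Bounds for the affine interpolation of a polynomial whose gradient is bounded by `N`. -/
theorem affine_interpolation_bounds {q : Poly} {A : Plane →ᵃ[ℝ] ℝ} (hA : ∀ a ∈ K, A a = polyAt q a)
    {N c₀ r : ℝ} {z : Plane} (hN : 0 ≤ N) (hq : ∀ x ∈ tri K, |polyAt q x| ≤ N)
    (hq' : ∀ x ∈ tri K, ∀ i, |polyAt (MvPolynomial.pderiv i q) x| ≤ N)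
    (hr : 0 < r) (hball : Metric.closedBall z r ⊆ tri K)
    (hd : Metric.diam (tri K) ≤ 4 * c₀ * r) :
    (∀ x ∈ tri K, |A x| ≤ N) ∧
    (∀ x ∈ tri K, |polyAt q x - A x| ≤ 2 * Metric.diam (tri K) * N) ∧
    ∀ j, |A.linear (EuclideanSpace.single j 1)| ≤ 16 * c₀ * N := by
  -- At vertices `A` takes values of `q`, and `q` oscillates by at most `2 N diam` on the cell; an
  -- affine map stays between its vertex values.
  have hosc : ∀ x ∈ tri K, ∀ y ∈ tri K, |A x - polyAt q y| ≤ 2 * Metric.diam (tri K) * N := by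
    intro x hx y hy
    refine abs_affine_sub_le (fun a ha => ?_) hx
    rw [hA a ha]
    refine (abs_polyAt_sub_le (convex_tri K) hN hq' (mem_tri_of_mem ha) hy).trans ?_
    have := dist_le_diam_tri (mem_tri_of_mem ha) hy
    nlinarith
  refine ⟨fun x hx => ?_, fun x hx => ?_, fun j => ?_⟩
  · have := abs_affine_sub_le (A := A) (c := 0) (M := N) (K := K) (fun a ha => by
      rw [hA a ha, sub_zero]; exact hq a (mem_tri_of_mem ha)) hx
    rwa [sub_zero] at this
  · rw [abs_sub_comm]; exact hosc x hx x hx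
  · have hz : z ∈ tri K := hball (Metric.mem_closedBall_self hr.le)
    have hz' : z + r • EuclideanSpace.single j (1 : ℝ) ∈ tri K := hball (by
      rw [Metric.mem_closedBall, dist_eq_norm, add_sub_cancel_left, norm_smul]
      simp [abs_of_pos hr])
    have e : A (z + r • EuclideanSpace.single j (1 : ℝ)) - A z =
        r * A.linear (EuclideanSpace.single j 1) := by
      have := A.map_vadd z (r • EuclideanSpace.single j (1 : ℝ))
      simp only [vadd_eq_add, map_smul, smul_eq_mul] at this
      rw [add_comm z, this]; ring
    have h1 := hosc _ hz' z hz
    have h2 := hosc z hz z hz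
    -- A step of length `r` from the centre of the inscribed disc stays in the cell, so the slope is
    -- at most `4 diam N / r`; then `diam ≤ 4 c₀ r` gives `16 c₀ N`.
    have h3 : |r * A.linear (EuclideanSpace.single j 1)| ≤ 4 * Metric.diam (tri K) * N := by
      rw [← e]
      have := abs_sub_le (A (z + r • EuclideanSpace.single j (1 : ℝ))) (polyAt q z) (A z)
      rw [abs_sub_comm (polyAt q z)] at this
      linarith
    rw [abs_mul, abs_of_pos hr] at h3
    have h4 : r * |A.linear (EuclideanSpace.single j 1)| ≤ r * (16 * c₀ * N) := by
      refine h3.trans ?_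
      nlinarith
    exact le_of_mul_le_mul_left h4 hr

/-! ### Oscillation of finite element functions -/

/-- `u` is piecewise polynomial with pieces `p K`, and the gradients of the pieces agree at common
vertices. -/
structure IsPiecewise (T : Triangulation) (u : Plane → ℝ) (p : Finset Plane → Poly) : Prop where
  eq : ∀ K ∈ T.cells, ∀ x ∈ tri K, u x = polyAt (p K) x
  degree : ∀ K ∈ T.cells, (p K).totalDegree ≤ 7
  grad : ∀ K ∈ T.cells, ∀ K' ∈ T.cells, ∀ a ∈ K, a ∈ K' → ∀ i,
    polyAt (MvPolynomial.pderiv i (p K)) a = polyAt (MvPolynomial.pderiv i (p K')) a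

theorem IsFEFunction.exists_isPiecewise {u : Plane → ℝ} (h : IsFEFunction T u) :
    ∃ p, IsPiecewise T u p := by
  obtain ⟨p, h1, h2, -⟩ := h
  exact ⟨p, fun K hK => (h1 K hK).2, fun K hK => (h1 K hK).1.totalDegree_le,
    fun K hK K' hK' a ha ha' => (h2 K hK K' hK' a ha ha').2⟩

theorem isClosed_pt_preimage_tri (K : Finset Plane) (i : Fin 2) (y : ℝ) :
    IsClosed {t : ℝ | pt i t y ∈ tri K} :=
  (isCompact_tri K).isClosed.preimage
    ((continuous_pt i).comp (continuous_id.prodMk continuous_const))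

theorem convex_pt_preimage {S : Set Plane} (hS : Convex ℝ S) (i : Fin 2) (y : ℝ) :
    Convex ℝ {t : ℝ | pt i t y ∈ S} := by
  obtain ⟨j, hj⟩ : ∃ j : Fin 2, j ≠ i := exists_ne i
  intro s hs t ht a b ha hb hab
  have := hS hs ht ha hb hab
  have e : a • pt i s y + b • pt i t y = pt i (a • s + b • t) y := by
    rw [pt_eq i j hj, pt_eq i j hj, pt_eq i j hj]
    have : y = a * y + b * y := by rw [← add_mul, hab, one_mul]
    conv_rhs => rw [this]
    simp only [smul_eq_mul]
    module
  rw [e] at this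
  exact this

theorem hasDerivAt_affine_pt (A : Plane →ᵃ[ℝ] ℝ) (i : Fin 2) (s y : ℝ) :
    HasDerivAt (fun t => A (pt i t y)) (A.linear (EuclideanSpace.single i 1)) s := by
  obtain ⟨j, hj⟩ : ∃ j : Fin 2, j ≠ i := exists_ne i
  have e : ∀ t, A (pt i t y) = t * A.linear (EuclideanSpace.single i 1) +
      A (y • EuclideanSpace.single j (1 : ℝ)) := by
    intro t
    have := A.map_vadd (y • EuclideanSpace.single j (1 : ℝ)) (t • EuclideanSpace.single i (1 : ℝ))
    simp only [vadd_eq_add, map_smul, smul_eq_mul] at this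
    rw [pt_eq i j hj, this]
  simp_rw [e]
  simpa using ((hasDerivAt_id s).mul_const (A.linear (EuclideanSpace.single i 1))).add_const
    (A (y • EuclideanSpace.single j (1 : ℝ)))

theorem pt_mem_closedSquare {i : Fin 2} {s y : ℝ} (hs : s ∈ Icc (0 : ℝ) 1) (hy : y ∈ Icc
    (0 : ℝ) 1) :
    pt i s y ∈ closedSquare := by
  intro k
  by_cases hk : k = i
  · subst hk; simpa using hs
  · rw [pt_apply_of_ne hk]; exact hy

/-- The step function with value `c K` on the cell `K`. -/
def cellSum (T : Triangulation) (c : Finset Plane → ℝ≥0∞) (x : Plane) : ℝ≥0∞ :=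
  ∑ K ∈ T.cells, (tri K).indicator (fun _ => c K) x

theorem measurable_cellSum (T : Triangulation) (c : Finset Plane → ℝ≥0∞) :
    Measurable (cellSum T c) :=
  Finset.measurable_sum _ fun K _ => measurable_const.indicator (measurableSet_tri K)

theorem le_cellSum (hK : K ∈ T.cells) (c : Finset Plane → ℝ≥0∞) {x : Plane} (hx : x ∈ tri K) :
    c K ≤ cellSum T c x := by
  refine le_trans (le_of_eq ?_) (Finset.single_le_sum (f := fun K => (tri K).indicator
    (fun _ => c K) x) (fun _ _ => zero_le) hK)
  rw [indicator_of_mem hx]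

theorem cellSum_ne_top {c : Finset Plane → ℝ≥0∞} (hc : ∀ K, c K ≠ ⊤) (x : Plane) :
    cellSum T c x ≠ ⊤ := by
  refine (ENNReal.sum_lt_top.2 fun K _ => ?_).ne
  by_cases hx : x ∈ tri K
  · rw [indicator_of_mem hx]; exact (hc K).lt_top
  · rw [indicator_of_notMem hx]; exact ENNReal.zero_lt_top

theorem setLIntegral_cellSum (c : Finset Plane → ℝ≥0∞) (S : Set Plane) :
    ∫⁻ x in S, cellSum T c x = ∑ K ∈ T.cells, c K * volume (tri K ∩ S) := by
  unfold cellSum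
  rw [lintegral_finsetSum _ fun K _ => measurable_const.indicator (measurableSet_tri K)]
  refine Finset.sum_congr rfl fun K _ => ?_
  rw [lintegral_indicator_const (measurableSet_tri K), Measure.restrict_apply (measurableSet_tri K)]

-- A line meets a cell in a set of length at most its diameter, and cells missed by the segment
-- contribute nothing.
open Classical in
theorem lintegral_pt_cellSum_le (c : Finset Plane → ℝ≥0∞) (i : Fin 2) (a b y : ℝ) :
    ∫⁻ t in Icc a b, cellSum T c (pt i t y) ≤
      ∑ K ∈ T.cells.filter (fun K => ∃ t ∈ Icc a b, pt i t y ∈ tri K),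
        c K * ENNReal.ofReal (Metric.diam (tri K)) := by
  have hm : ∀ K, MeasurableSet {t : ℝ | pt i t y ∈ tri K} := fun K =>
    (isClosed_pt_preimage_tri K i y).measurableSet
  have e : ∀ t, cellSum T c (pt i t y) =
      ∑ K ∈ T.cells, {t : ℝ | pt i t y ∈ tri K}.indicator (fun _ => c K) t := fun t => rfl
  simp_rw [e]
  rw [lintegral_finsetSum _ fun K _ => measurable_const.indicator (hm K), Finset.sum_filter]
  refine Finset.sum_le_sum fun K _ => ?_
  rw [lintegral_indicator_const (hm K), Measure.restrict_apply (hm K)]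
  split_ifs with hK
  · gcongr
    refine (Real.volume_le_diam _).trans (Metric.ediam_le fun s hs t ht => ?_)
    rw [edist_dist]
    refine ENNReal.ofReal_le_ofReal (le_trans ?_ (dist_le_diam_tri hs.1 ht.1))
    have := abs_apply_sub_le_dist (pt i s y) (pt i t y) i
    simpa [Real.dist_eq] using this
  · have : {t : ℝ | pt i t y ∈ tri K} ∩ Icc a b = ∅ := by
      ext t
      simp only [mem_inter_iff, mem_ofPred_eq, mem_empty_iff_false, iff_false, not_and]
      exact fun h1 h2 => hK ⟨t, h2, h1⟩
    rw [this]; simp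

/-- Cauchy-Schwarz for cell-wise constants. -/
theorem sum_mul_volume_le {s : Finset (Finset Plane)} (hs : s ⊆ T.cells) {N : Finset Plane → ℝ}
    {S : Set Plane} (hS : MeasurableSet S) {V : ℝ} (hV : 0 ≤ V) (hSV : volume S ≤ ENNReal.ofReal V)
    {B : ℝ} (hB : ∑ K ∈ T.cells, (volume (tri K)).toReal * N K ^ 2 ≤ B) :
    ∑ K ∈ s, N K * (volume (tri K ∩ S)).toReal ≤ √V * √B := by
  have hB0 : 0 ≤ B := le_trans (Finset.sum_nonneg fun K _ => by positivity) hB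
  have h1 := Finset.sum_sq_le_sum_mul_sum_of_sq_le_mul s
    (r := fun K => N K * (volume (tri K ∩ S)).toReal) (f := fun K => (volume (tri K ∩ S)).toReal)
    (g := fun K => (volume (tri K ∩ S)).toReal * N K ^ 2) (fun _ _ => ENNReal.toReal_nonneg)
    (fun _ _ => by positivity) (fun _ _ => le_of_eq (by ring))
  have h2 : ∑ K ∈ s, (volume (tri K ∩ S)).toReal ≤ V := by
    rw [← ENNReal.toReal_sum fun K _ => ((measure_mono inter_subset_left).trans_lt
      (isCompact_tri K).measure_lt_top).ne]
    exact ENNReal.toReal_le_of_le_ofReal hV ((sum_volume_inter_le T s hs S hS).trans hSV)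
  have h3 : ∑ K ∈ s, (volume (tri K ∩ S)).toReal * N K ^ 2 ≤ B := by
    refine le_trans (Finset.sum_le_sum fun K _ => ?_) ((Finset.sum_le_sum_of_subset_of_nonneg hs
      fun K _ _ => by positivity).trans hB)
    gcongr
    · exact (isCompact_tri K).measure_ne_top
    · exact inter_subset_left
  rw [← Real.sqrt_mul hV]
  refine Real.le_sqrt_of_sq_le (h1.trans ?_)
  exact mul_le_mul h2 h3 (Finset.sum_nonneg fun K _ => by positivity) hV

end

/-! ### Glued interpolants of derivatives and the resulting increment estimate. -/

section

variable {T : Triangulation} {K K' : Finset Plane}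

/-- The interpolation of a partial derivative by continuous piecewise affine functions, bounded
along a line by integrals over the square. -/
theorem enorm_affine_le_lintegral_cellSum {A : Finset Plane → Plane →ᵃ[ℝ] ℝ}
    (hA : ∀ K ∈ T.cells, ∀ K' ∈ T.cells, ∀ a ∈ K, a ∈ K' → A K a = A K' a)
    {N : Finset Plane → ℝ} {c : ℝ} (hc : 0 ≤ c) (hN : ∀ K, 0 ≤ N K)
    (hAN : ∀ K ∈ T.cells, ∀ x ∈ tri K, |A K x| ≤ N K) {i j : Fin 2} (hij : j ≠ i)
    (hAL : ∀ K ∈ T.cells, |(A K).linear (EuclideanSpace.single j 1)| ≤ c * N K)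
    {t y : ℝ} (ht : t ∈ Icc (0 : ℝ) 1) (hy : y ∈ Icc (0 : ℝ) 1) (hK : K ∈ T.cells)
    (hx : pt i t y ∈ tri K) :
    ‖A K (pt i t y)‖ₑ ≤
      ∫⁻ s in Icc (0 : ℝ) 1, cellSum T (fun K => ENNReal.ofReal ((1 + c) * N K)) (pt i t s) := by
  -- Conformity: two cells meet inside the convex hull of their common vertices, where affine maps
  -- with equal vertex values coincide. Hence `L` below is a continuous piecewise affine function on
  -- the square.
  have hagree : ∀ K ∈ T.cells, ∀ K' ∈ T.cells, ∀ x ∈ tri K, x ∈ tri K' → A K x = A K' x := by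
    intro K hK K' hK' x hx hx'
    have hconv : Convex ℝ ((A K - A K') ⁻¹' {0}) := (convex_singleton 0).affine_preimage _
    have hsub := convexHull_min (fun a ha => sub_eq_zero.2 (hA K hK K' hK' a ha.1 ha.2)) hconv
      (tri_inter_tri hK hK' ⟨hx, hx'⟩)
    exact sub_eq_zero.1 hsub
  choose! κ hκ using fun (x : Plane) (hx : x ∈ closedSquare) => exists_mem_tri T hx
  set L : Plane → ℝ := fun x => A (κ x) x with hL
  have hLeq : ∀ K ∈ T.cells, ∀ x ∈ tri K, L x = A K x := fun K hK x hx =>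
    have hxs := tri_subset_closedSquare hK hx
    hagree _ (hκ x hxs).1 K hK x (hκ x hxs).2 hx
  have hsq : ∀ s ∈ Icc (0 : ℝ) 1, pt i t s ∈ closedSquare := fun s hs => pt_mem_closedSquare ht hs
  have hptm : Measurable fun s : ℝ => pt i t s :=
    ((continuous_pt i).comp (continuous_const.prodMk continuous_id)).measurable
  set D : ℝ → ℝ≥0∞ := fun s => cellSum T (fun K => ENNReal.ofReal (c * N K)) (pt i t s) with hD
  have hosc := enorm_sub_le_of_le (f := fun s => L (pt i t s)) (a := 0) (b := 1) (D := D)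
    (fun s hs s' hs' hss => by
      refine enorm_sub_le_lintegral_of_piecewise T.cells (fun K => {s | pt j s t ∈ tri K})
        (fun s => L (pt i t s)) (fun K s => A K (pt j s t))
        (fun K _ => (A K).linear (EuclideanSpace.single j 1)) D hss
        (fun K _ => isClosed_pt_preimage_tri K j t)
        (fun K _ => (convex_pt_preimage (convex_tri K) j t).ordConnected) ?_ ?_ ?_ ?_ ?_ ?_ ?_
      · intro z hz
        obtain ⟨K, hK, hzK⟩ := exists_mem_tri T (hsq z ⟨hs.1.trans hz.1, hz.2.trans hs'.2⟩)
        refine mem_iUnion₂.2 ⟨K, hK, ?_⟩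
        rwa [pt_swap i j hij] at hzK
      · intro K hK z hz _
        rw [mem_ofPred_eq, ← pt_swap i j hij] at hz
        simp only [← pt_swap i j hij]
        exact hLeq K hK _ hz
      · exact fun K _ z => hasDerivAt_affine_pt (A K) j z t
      · exact fun K _ => continuous_const
      · exact (measurable_cellSum T _).comp hptm
      · exact fun z => cellSum_ne_top (fun _ => ENNReal.ofReal_ne_top) _
      · intro K hK z hz _
        rw [mem_ofPred_eq, ← pt_swap i j hij] at hz
        refine le_trans ?_ (le_cellSum hK _ hz)
        rw [← ofReal_norm, Real.norm_eq_abs]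
        exact ENNReal.ofReal_le_ofReal (hAL K hK))
  -- The transversal segment has length one, so the mean over it needs no normalisation.
  have h1 := enorm_mul_le_lintegral_add (f := fun s => L (pt i t s)) (a := 0) (b := 1) (c := y)
    (fun s hs => hosc y hy s hs)
  simp only [sub_zero, ENNReal.ofReal_one, mul_one] at h1
  rw [hLeq K hK _ hx] at h1
  refine h1.trans ?_
  have hDm : Measurable D := (measurable_cellSum T _).comp hptm
  rw [← lintegral_add_right _ hDm]
  refine setLIntegral_mono' measurableSet_Icc fun s hs => ?_
  have h2 : ‖L (pt i t s)‖ₑ ≤ cellSum T (fun K => ENNReal.ofReal (N K)) (pt i t s) := by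
    obtain ⟨hk, hxk⟩ := hκ _ (hsq s hs)
    refine le_trans ?_ (le_cellSum hk _ hxk)
    rw [← ofReal_norm, Real.norm_eq_abs]
    exact ENNReal.ofReal_le_ofReal (hAN _ hk _ hxk)
  refine (add_le_add_left h2 _).trans (le_of_eq ?_)
  simp only [hD]
  unfold cellSum
  rw [← Finset.sum_add_distrib]
  refine Finset.sum_congr rfl fun K _ => ?_
  by_cases hxK : pt i t s ∈ tri K
  · simp only [indicator_of_mem hxK]
    rw [← ENNReal.ofReal_add (hN K) (mul_nonneg hc (hN K))]
    congr 1; ring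
  · simp only [indicator_of_notMem hxK, add_zero]

theorem ofReal_sum_mul {s : Finset (Finset Plane)} {N : Finset Plane → ℝ} (hN : ∀ K, 0 ≤ N K)
    {c : ℝ} (hc : 0 ≤ c) (S : Set Plane) :
    ∑ K ∈ s, ENNReal.ofReal (c * N K) * volume (tri K ∩ S) =
      ENNReal.ofReal (c * ∑ K ∈ s, N K * (volume (tri K ∩ S)).toReal) := by
  rw [Finset.mul_sum, ENNReal.ofReal_sum_of_nonneg fun K _ =>
    mul_nonneg hc (mul_nonneg (hN K) ENNReal.toReal_nonneg)]
  refine Finset.sum_congr rfl fun K _ => ?_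
  rw [← mul_assoc, ENNReal.ofReal_mul (mul_nonneg hc (hN K)), ENNReal.ofReal_toReal
    ((measure_mono inter_subset_left).trans_lt (isCompact_tri K).measure_lt_top).ne]

theorem measurableSet_box (i j : Fin 2) (a b c d : ℝ) :
    MeasurableSet {x : Plane | x i ∈ Icc a b ∧ x j ∈ Icc c d} := by
  refine IsClosed.measurableSet ?_
  exact (isClosed_Icc.preimage (by fun_prop)).inter (isClosed_Icc.preimage (by fun_prop))

open Classical in
/-- Increments of finite element functions along coordinate directions. -/
theorem abs_sub_pt_le_of_isPiecewise {u : Plane → ℝ} {p : Finset Plane → Poly}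
    (hp : IsPiecewise T u p) {c₀ : ℝ} (hc₀ : 0 < c₀)
    (hshape : ∀ K ∈ T.cells, Metric.diam (tri K) / inDiam K ≤ c₀) {N : Finset Plane → ℝ}
    (hN0 : ∀ K, 0 ≤ N K)
    (hN1 : ∀ K ∈ T.cells, ∀ x ∈ tri K, ∀ i, |polyAt (MvPolynomial.pderiv i (p K)) x| ≤ N K)
    (hN2 : ∀ K ∈ T.cells, ∀ x ∈ tri K, ∀ i j,
      |polyAt (MvPolynomial.pderiv j (MvPolynomial.pderiv i (p K))) x| ≤ N K)
    {B : ℝ} (hB : ∑ K ∈ T.cells, (volume (tri K)).toReal * N K ^ 2 ≤ B)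
    {δ : ℝ} (hδ : 0 < δ) (hδ1 : δ ≤ 1) (hmesh : meshSize T ≤ δ) (i : Fin 2) {a b y : ℝ}
    (ha : 0 ≤ a) (hab : a ≤ b) (hb : b ≤ 1) (hbδ : b - a ≤ δ) (hy : y ∈ Icc (0 : ℝ) 1) :
    |u (pt i b y) - u (pt i a y)| ≤ (1 + 16 * c₀ + 96 * c₀ ^ 2) * (√δ * √B) := by
  obtain ⟨j, hij⟩ : ∃ j : Fin 2, j ≠ i := exists_ne i
  have hball := fun K (hK : K ∈ T.cells) => exists_closedBall_subset_tri hK (hshape K hK)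
  choose! z r hr hzr hdr using hball
  have hA' := fun K (hK : K ∈ T.cells) =>
    exists_affine_interpolation hK (polyAt (MvPolynomial.pderiv i (p K)))
  choose! A hA using hA'
  have hbd := fun K (hK : K ∈ T.cells) => affine_interpolation_bounds (hA K hK) (hN0 K)
    (fun x hx => hN1 K hK x hx i) (fun x hx k => hN2 K hK x hx i k) (hr K hK) (hzr K hK) (hdr K hK)
  have hAA : ∀ K ∈ T.cells, ∀ K' ∈ T.cells, ∀ a ∈ K, a ∈ K' → A K a = A K' a :=
    fun K hK K' hK' a ha ha' => by
      rw [hA K hK a ha, hA K' hK' a ha', hp.grad K hK K' hK' a ha ha' i]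
  set H : Plane → ℝ≥0∞ := cellSum T fun K => ENNReal.ofReal ((1 + 16 * c₀) * N K) with hH
  have hHm : Measurable H := measurable_cellSum T _
  set R : Plane → ℝ≥0∞ := cellSum T fun K => ENNReal.ofReal (2 * Metric.diam (tri K) * N K) with hR
  have hRm : Measurable R := measurable_cellSum T _
  -- The first term bounds the continuous interpolant of `∂_i u` through the transversal line, the
  -- second one the interpolation error at the point itself.
  set D : ℝ → ℝ≥0∞ := fun t => (∫⁻ s in Icc (0 : ℝ) 1, H (pt i t s)) + R (pt i t y) with hD
  have hIm : Measurable fun t => ∫⁻ s in Icc (0 : ℝ) 1, H (pt i t s) :=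
    Measurable.lintegral_prod_right' (ν := volume.restrict (Icc (0 : ℝ) 1))
      (f := fun z : ℝ × ℝ => H (pt i z.1 z.2)) (hHm.comp (continuous_pt i).measurable)
  have hptm : Measurable fun t : ℝ => pt i t y :=
    ((continuous_pt i).comp (continuous_id.prodMk continuous_const)).measurable
  have hHtop : ∀ t, ∫⁻ s in Icc (0 : ℝ) 1, H (pt i t s) ≠ ⊤ := by
    intro t
    have hle : ∀ x, H x ≤ ∑ K ∈ T.cells, ENNReal.ofReal ((1 + 16 * c₀) * N K) := fun x =>
      Finset.sum_le_sum fun K _ => indicator_le_self' (fun _ _ => zero_le) x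
    refine ((lintegral_mono fun s => hle (pt i t s)).trans_lt ?_).ne
    rw [setLIntegral_const]
    refine ENNReal.mul_lt_top (ENNReal.sum_lt_top.2 fun K _ => ENNReal.ofReal_lt_top) ?_
    simp
  have hline : ‖u (pt i b y) - u (pt i a y)‖ₑ ≤ ∫⁻ t in Icc a b, D t := by
    refine enorm_sub_le_lintegral_of_piecewise T.cells (fun K => {t | pt i t y ∈ tri K})
      (fun t => u (pt i t y)) (fun K t => polyAt (p K) (pt i t y))
      (fun K t => polyAt (MvPolynomial.pderiv i (p K)) (pt i t y)) D hab
      (fun K _ => isClosed_pt_preimage_tri K i y)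
      (fun K _ => (convex_pt_preimage (convex_tri K) i y).ordConnected) ?_ ?_ ?_ ?_ ?_ ?_ ?_
    · intro t ht
      obtain ⟨K, hK, htK⟩ := exists_mem_tri T (pt_mem_closedSquare (i := i)
        (⟨ha.trans ht.1, ht.2.trans hb⟩ : t ∈ Icc (0 : ℝ) 1) hy)
      exact mem_iUnion₂.2 ⟨K, hK, htK⟩
    · exact fun K hK t ht _ => hp.eq K hK _ ht
    · intro K _ t
      have := hasDerivAt_pt_of_contDiff (contDiff_polyAt (p K)) i t y
      rwa [classicalPartial_polyAt] at this
    · exact fun K _ => (continuous_polyAt _).comp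
        ((continuous_pt i).comp (continuous_id.prodMk continuous_const))
    · exact hIm.add (hRm.comp hptm)
    · exact fun t => ENNReal.add_ne_top.2
        ⟨hHtop t, cellSum_ne_top (fun _ => ENNReal.ofReal_ne_top) _⟩
    · intro K hK t ht htab
      have e1 := enorm_affine_le_lintegral_cellSum hAA (c := 16 * c₀) (by positivity) hN0
        (fun K hK => (hbd K hK).1) hij (fun K hK => (hbd K hK).2.2 j)
        (⟨ha.trans htab.1, htab.2.trans hb⟩ : t ∈ Icc (0 : ℝ) 1) hy hK ht
      have e2 : ‖polyAt (MvPolynomial.pderiv i (p K)) (pt i t y) - A K (pt i t y)‖ₑ ≤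
          R (pt i t y) := by
        refine le_trans ?_ (le_cellSum hK _ ht)
        rw [← ofReal_norm, Real.norm_eq_abs]
        exact ENNReal.ofReal_le_ofReal ((hbd K hK).2.1 _ ht)
      calc ‖polyAt (MvPolynomial.pderiv i (p K)) (pt i t y)‖ₑ
          = ‖A K (pt i t y) + (polyAt (MvPolynomial.pderiv i (p K)) (pt i t y) -
              A K (pt i t y))‖ₑ := by rw [add_sub_cancel]
        _ ≤ _ := (enorm_add_le _ _).trans (add_le_add e1 e2)
  have hsB : 0 ≤ √δ * √B := by positivity
  -- The double integral is over the full strip of width `b - a ≤ δ`, whose area gives `√δ` by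
  -- Cauchy-Schwarz.
  have hpart1 : ∫⁻ t in Icc a b, ∫⁻ s in Icc (0 : ℝ) 1, H (pt i t s) ≤
      ENNReal.ofReal ((1 + 16 * c₀) * (√δ * √B)) := by
    rw [← setLIntegral_box i j hij a b 0 1 hHm, hH, setLIntegral_cellSum,
      ofReal_sum_mul hN0 (by positivity)]
    refine ENNReal.ofReal_le_ofReal (mul_le_mul_of_nonneg_left ?_ (by positivity))
    refine sum_mul_volume_le subset_rfl (measurableSet_box i j a b 0 1) hδ.le ?_ hB
    rw [volume_box i j hij]
    simpa using ENNReal.ofReal_le_ofReal hbδ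
  -- The interpolation error on a line gives `diam² N K` for each cell met. Shape regularity turns
  -- `diam²` into area, and these cells fill only a neighbourhood of the segment of small area.
  have hpart2 : ∫⁻ t in Icc a b, R (pt i t y) ≤ ENNReal.ofReal (96 * c₀ ^ 2 * (√δ * √B)) := by
    set s := T.cells.filter (fun K => ∃ t ∈ Icc a b, pt i t y ∈ tri K) with hs
    set S : Set Plane := {x | x i ∈ Icc (a - δ) (b + δ) ∧ x j ∈ Icc (y - δ) (y + δ)} with hS
    have hsub : ∀ K ∈ s, tri K ∩ S = tri K := by
      intro K hK
      obtain ⟨hKc, t, ht, htK⟩ := Finset.mem_filter.1 hK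
      refine inter_eq_left.2 fun x hx => ?_
      have hd := (dist_le_diam_tri hx htK).trans ((diam_tri_le_meshSize hKc).trans hmesh)
      have d1 := abs_le.1 ((abs_apply_sub_le_dist x (pt i t y) i).trans hd)
      have d2 := abs_le.1 ((abs_apply_sub_le_dist x (pt i t y) j).trans hd)
      rw [pt_apply_self] at d1
      rw [pt_apply_of_ne hij] at d2
      exact ⟨⟨by linarith [ht.1], by linarith [ht.2]⟩, ⟨by linarith, by linarith⟩⟩
    -- Cells have diameter at most `δ`, so `S` has sides at most `3 δ` and `2 δ`, and `δ² ≤ δ`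
    -- because `δ ≤ 1`.
    have hvol : volume S ≤ ENNReal.ofReal (6 * δ) := by
      rw [hS, volume_box i j hij, ← ENNReal.ofReal_mul (by linarith)]
      refine ENNReal.ofReal_le_ofReal ?_
      have : (b + δ - (a - δ)) * (y + δ - (y - δ)) = (b - a + 2 * δ) * (2 * δ) := by ring
      rw [this]
      nlinarith
    have hcs := sum_mul_volume_le (s := s) (Finset.filter_subset _ _)
      (measurableSet_box i j (a - δ) (b + δ) (y - δ) (y + δ)) (by positivity) hvol hB
    refine (lintegral_pt_cellSum_le _ i a b y).trans ?_
    calc ∑ K ∈ s, ENNReal.ofReal (2 * Metric.diam (tri K) * N K) *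
            ENNReal.ofReal (Metric.diam (tri K))
        ≤ ∑ K ∈ s, ENNReal.ofReal (32 * c₀ ^ 2 * N K) * volume (tri K ∩ S) := by
          refine Finset.sum_le_sum fun K hK => ?_
          have hKc := (Finset.mem_filter.1 hK).1
          rw [hsub K hK, ← ENNReal.ofReal_toReal (isCompact_tri K).measure_ne_top,
            ← ENNReal.ofReal_mul (mul_nonneg (mul_nonneg zero_le_two Metric.diam_nonneg) (hN0 K)),
            ← ENNReal.ofReal_mul (mul_nonneg (by positivity) (hN0 K))]
          refine ENNReal.ofReal_le_ofReal ?_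
          have h1 := sq_le_volume_of_closedBall_subset (hr K hKc) (hzr K hKc)
          have h2 : Metric.diam (tri K) ^ 2 ≤ (4 * c₀ * r K) ^ 2 :=
            pow_le_pow_left₀ Metric.diam_nonneg (hdr K hKc) 2
          have h3 : Metric.diam (tri K) ^ 2 ≤ 16 * c₀ ^ 2 * (volume (tri K)).toReal :=
            h2.trans (by nlinarith [sq_nonneg c₀])
          have h4 := mul_le_mul_of_nonneg_right h3 (hN0 K)
          nlinarith
      _ = ENNReal.ofReal (32 * c₀ ^ 2 * ∑ K ∈ s, N K * (volume (tri K ∩ S)).toReal) :=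
          ofReal_sum_mul hN0 (by positivity) S
      _ ≤ _ := by
          refine ENNReal.ofReal_le_ofReal ?_
          -- Here `96 = 32 * 3`, with 32 from twice the comparison constant `16` between `diam²` and
          -- area.
          have h6 : √(6 * δ) ≤ 3 * √δ := by
            rw [Real.sqrt_mul (by norm_num)]
            gcongr
            exact Real.sqrt_le_iff.2 ⟨by norm_num, by norm_num⟩
          calc 32 * c₀ ^ 2 * ∑ K ∈ s, N K * (volume (tri K ∩ S)).toReal
              ≤ 32 * c₀ ^ 2 * (√(6 * δ) * √B) := by gcongr
            _ ≤ 32 * c₀ ^ 2 * (3 * √δ * √B) := by gcongr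
            _ = _ := by ring
  rw [hD, lintegral_add_left hIm] at hline
  have hfin := hline.trans (add_le_add hpart1 hpart2)
  rw [← ENNReal.ofReal_add (by positivity) (by positivity), ← ofReal_norm, Real.norm_eq_abs,
    ENNReal.ofReal_le_ofReal_iff (by positivity)] at hfin
  linarith

end

section

variable {T : Triangulation} {K K' : Finset Plane} {u f w : Plane → ℝ} {p : Finset Plane → Poly}
  {α : ℕ × ℕ}

/-! ### Broken norms -/

theorem sum_integral_interior_tri {G : Plane → ℝ} (hG : IntegrableOn G openSquare)
    (hG0 : ∀ x, 0 ≤ G x) :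
    ∑ K ∈ T.cells, ∫ x in interior (tri K), G x = ∫ x in openSquare, G x := by
  have h := lintegral_openSquare_eq_sum T fun x => ENNReal.ofReal (G x)
  have hK : ∀ K ∈ T.cells, ∫⁻ x in interior (tri K), ENNReal.ofReal (G x) =
      ENNReal.ofReal (∫ x in interior (tri K), G x) := fun K hK =>
    (ofReal_integral_eq_lintegral_ofReal (hG.mono_set (interior_tri_subset_openSquare hK))
      (Eventually.of_forall hG0)).symm
  rw [Finset.sum_congr rfl hK, ← ofReal_integral_eq_lintegral_ofReal hG (Eventually.of_forall hG0),
    ← ENNReal.ofReal_sum_of_nonneg fun K _ => integral_nonneg hG0,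
    ENNReal.ofReal_eq_ofReal_iff (integral_nonneg hG0)
      (Finset.sum_nonneg fun K _ => integral_nonneg hG0)] at h
  exact h.symm

/-- The `L²` norm on the square of a function given cell by cell. -/
theorem eLpNorm_le_sqrt_of_cells {h : Plane → ℝ} {g : Finset Plane → Plane → ℝ}
    (hg : ∀ K ∈ T.cells, MemLp (g K) 2 (volume.restrict (interior (tri K))))
    (hh : ∀ K ∈ T.cells, h =ᵐ[volume.restrict (interior (tri K))] g K) {E : ℝ}
    (hE : ∑ K ∈ T.cells, ∫ x in interior (tri K), g K x ^ 2 ≤ E) :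
    eLpNorm h 2 (volume.restrict openSquare) ≤ ENNReal.ofReal √E := by
  have h0 : 0 ≤ E := le_trans
    (Finset.sum_nonneg fun K _ => integral_nonneg fun _ => sq_nonneg _) hE
  rw [eLpNorm_eq_lintegral_rpow_enorm_toReal (by norm_num) (by norm_num), ENNReal.toReal_ofNat,
    Real.sqrt_eq_rpow, ← ENNReal.ofReal_rpow_of_nonneg h0 (by norm_num)]
  gcongr
  rw [lintegral_openSquare_eq_sum T]
  calc ∑ K ∈ T.cells, ∫⁻ x in interior (tri K), ‖h x‖ₑ ^ (2 : ℝ)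
      = ∑ K ∈ T.cells, ENNReal.ofReal (∫ x in interior (tri K), g K x ^ 2) := by
        refine Finset.sum_congr rfl fun K hK => ?_
        rw [ofReal_integral_eq_lintegral_ofReal (hg K hK).integrable_sq
          (Eventually.of_forall fun _ => sq_nonneg _)]
        refine lintegral_congr_ae ?_
        filter_upwards [hh K hK] with x hx
        rw [hx, ← ofReal_norm, ENNReal.ofReal_rpow_of_nonneg (norm_nonneg _) (by norm_num)]
        congr 1
        simp
    _ = ENNReal.ofReal (∑ K ∈ T.cells, ∫ x in interior (tri K), g K x ^ 2) :=
        (ENNReal.ofReal_sum_of_nonneg fun K _ => integral_nonneg fun _ => sq_nonneg _).symm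
    _ ≤ _ := ENNReal.ofReal_le_ofReal hE

theorem IsPiecewise.memH_sub (hp : IsPiecewise T u p) (hf : MemH 3 openSquare f)
    (hK : K ∈ T.cells) : MemH 3 (interior (tri K)) fun x => f x - u x := by
  refine (hf.mono (interior_tri_subset_openSquare hK)).sub ?_
  refine (memH_polyAt 3 (isCompact_tri K) interior_subset (p K)).congr ?_
  filter_upwards [ae_restrict_mem isOpen_interior.measurableSet] with x hx
  exact (hp.eq K hK x (interior_subset hx)).symm

theorem IsPiecewise.weakDeriv_sub_ae_eq (hp : IsPiecewise T u p) (hf : MemH 3 openSquare f)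
    (hK : K ∈ T.cells) (hα : α.1 + α.2 ≤ 3) :
    weakDeriv (interior (tri K)) α (fun x => f x - u x) =ᵐ[volume.restrict (interior (tri K))]
      fun x => weakDeriv openSquare α f x - polyAt (polyDeriv α (p K)) x := by
  refine HasWeakDeriv.weakDeriv_ae_eq isOpen_interior ?_
  refine ((hf.hasWeakDeriv hα).mono (interior_tri_subset_openSquare hK)).sub ?_
  refine (hasWeakDeriv_polyAt (p K) α _).congr ?_ (ae_eq_refl _)
  filter_upwards [ae_restrict_mem isOpen_interior.measurableSet] with x hx
  exact (hp.eq K hK x (interior_subset hx)).symm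

/-- On each cell the polynomial derivative is that of `f` minus that of `f - u`, so derivatives of
`u` are bounded by a fixed quantity plus the broken error. -/
theorem IsPiecewise.sum_integral_sq_polyDeriv_le (hp : IsPiecewise T u p)
    (hf : MemH 3 openSquare f) (hα : α.1 + α.2 ≤ 3) :
    ∑ K ∈ T.cells, ∫ x in tri K, polyAt (polyDeriv α (p K)) x ^ 2 ≤
      2 * (∫ x in openSquare, weakDeriv openSquare α f x ^ 2) +
      2 * ∑ K ∈ T.cells, ∫ x in interior (tri K),
        weakDeriv (interior (tri K)) α (fun x => f x - u x) x ^ 2 := by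
  have hi := (hf.memLp_weakDeriv isOpen_openSquare hα).integrable_sq
  rw [← sum_integral_interior_tri (T := T) hi fun _ => sq_nonneg _, Finset.mul_sum, Finset.mul_sum,
    ← Finset.sum_add_distrib]
  refine Finset.sum_le_sum fun K hK => ?_
  have i1 : IntegrableOn (fun x => weakDeriv openSquare α f x ^ 2) (interior (tri K)) :=
    hi.mono_measure (Measure.restrict_mono_set _ (interior_tri_subset_openSquare hK))
  have i2 := ((hp.memH_sub hf hK).memLp_weakDeriv isOpen_interior hα).integrable_sq
  rw [← setIntegral_congr_set (interior_tri_ae_eq K), ← integral_const_mul, ← integral_const_mul,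
    ← integral_add (i1.const_mul 2) (i2.const_mul 2)]
  refine integral_mono_ae ?_ ((i1.const_mul 2).add (i2.const_mul 2)) ?_
  · exact (((continuous_polyAt _).pow 2).continuousOn.integrableOn_compact
      (isCompact_tri K)).mono_set interior_subset
  · filter_upwards [hp.weakDeriv_sub_ae_eq hf hK hα] with x hx
    simp only [hx]
    -- The difference of the two sides is exactly this square.
    nlinarith [sq_nonneg (2 * weakDeriv openSquare α f x - polyAt (polyDeriv α (p K)) x)]

theorem polyAt_pderiv (p : Poly) (i : Fin 2) :
    polyAt (MvPolynomial.pderiv i p) = polyAt (polyDeriv (unitIndex i) p) := by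
  rw [← classicalDeriv_polyAt, classicalDeriv_unitIndex, classicalPartial_polyAt]

theorem polyAt_pderiv_pderiv (p : Poly) (i j : Fin 2) :
    polyAt (MvPolynomial.pderiv j (MvPolynomial.pderiv i p)) =
      polyAt (polyDeriv (unitIndex j + unitIndex i) p) := by
  rw [← classicalDeriv_polyAt, ← classicalDeriv_classicalDeriv (contDiff_polyAt p),
    classicalDeriv_unitIndex, classicalDeriv_unitIndex, classicalPartial_polyAt,
    classicalPartial_polyAt]

/-- The square of the broken `H³` norm of a scalar function. -/
def brokenSq (T : Triangulation) (h : Plane → ℝ) : ℝ :=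
  ∑ K ∈ T.cells, sobolevNormSq 3 (interior (tri K)) h

theorem sum_integral_sq_weakDeriv_le_brokenSq (h : Plane → ℝ) (hα : α ∈ multiIndices 3) :
    ∑ K ∈ T.cells, ∫ x in interior (tri K), weakDeriv (interior (tri K)) α h x ^ 2 ≤
      brokenSq T h :=
  Finset.sum_le_sum fun _ _ => integral_sq_weakDeriv_le_sobolevNormSq hα

/-- A bound for the weighted sum of the squared derivative bounds that does not depend on the
mesh. -/
theorem exists_derivative_bounds_of_memH (hf : MemH 3 openSquare f) : ∃ B₀ : ℝ,
    ∀ (T : Triangulation) (u : Plane → ℝ) (p : Finset Plane → Poly), IsPiecewise T u p →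
      brokenSq T (fun x => f x - u x) ≤ 1 → ∃ N : Finset Plane → ℝ, (∀ K, 0 ≤ N K) ∧
      (∀ K ∈ T.cells, ∀ x ∈ tri K, ∀ i, |polyAt (MvPolynomial.pderiv i (p K)) x| ≤ N K) ∧
      (∀ K ∈ T.cells, ∀ x ∈ tri K, ∀ i j,
        |polyAt (MvPolynomial.pderiv j (MvPolynomial.pderiv i (p K))) x| ≤ N K) ∧
      ∑ K ∈ T.cells, (volume (tri K)).toReal * N K ^ 2 ≤ B₀ := by
  obtain ⟨C, hC, hCb⟩ := exists_derivative_bound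
  -- The summand `2` is twice the bound 1 on the broken error.
  set J : ℕ × ℕ → ℝ := fun α => 2 * (∫ x in openSquare, weakDeriv openSquare α f x ^ 2) + 2 with hJ
  refine ⟨C * ((∑ i, J (unitIndex i)) + ∑ i, ∑ j, J (unitIndex j + unitIndex i)),
    fun T u p hp hbr => ?_⟩
  have hS : ∀ α ∈ multiIndices 3,
      ∑ K ∈ T.cells, ∫ x in tri K, polyAt (polyDeriv α (p K)) x ^ 2 ≤ J α := fun α hα => by
    have h1 : α.1 + α.2 ≤ 3 := (Finset.mem_filter.1 hα).2
    have h2 := hp.sum_integral_sq_polyDeriv_le hf h1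
    have h3 := (sum_integral_sq_weakDeriv_le_brokenSq (T := T) (fun x => f x - u x) hα).trans hbr
    simp only [hJ]
    linarith
  have hN := fun K (hK : K ∈ T.cells) => hCb (p K) (hp.degree K hK) (tri K) (convex_tri K)
    (isCompact_tri K) ((interior_tri_nonempty hK).mono interior_subset)
  choose! N hN0 hN1 hN2 hN3 using hN
  -- Absolute values make the bound nonnegative also off the mesh, where the chosen `N` is
  -- arbitrary.
  refine ⟨fun K => |N K|, fun K => abs_nonneg _, fun K hK x hx i => ?_, fun K hK x hx i j => ?_, ?_⟩
  · exact (hN1 K hK x hx i).trans (le_abs_self _)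
  · exact (hN2 K hK x hx i j).trans (le_abs_self _)
  · simp only [sq_abs]
    refine (Finset.sum_le_sum hN3).trans ?_
    rw [← Finset.mul_sum, Finset.sum_add_distrib, Finset.sum_comm]
    refine mul_le_mul_of_nonneg_left (add_le_add ?_ ?_) hC.le
    · refine Finset.sum_le_sum fun i _ => ?_
      simp only [polyAt_pderiv _ i]
      exact hS _ (by fin_cases i <;> decide)
    · rw [Finset.sum_comm]
      refine Finset.sum_le_sum fun i _ => ?_
      rw [Finset.sum_comm]
      refine Finset.sum_le_sum fun j _ => ?_
      simp only [polyAt_pderiv_pderiv]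
      exact hS _ (by fin_cases i <;> fin_cases j <;> decide)

theorem IsPiecewise.eLpNorm_sub_le (hp : IsPiecewise T u p) (hf : MemH 3 openSquare f)
    (hw : w =ᵐ[volume.restrict openSquare] f) :
    eLpNorm (fun x => w x - u x) 2 (volume.restrict openSquare) ≤
      ENNReal.ofReal √(brokenSq T fun x => f x - u x) := by
  refine eLpNorm_le_sqrt_of_cells
    (g := fun K => weakDeriv (interior (tri K)) (0, 0) fun x => f x - u x)
    (fun K hK => (hp.memH_sub hf hK).memLp_weakDeriv isOpen_interior (by simp)) (fun K hK => ?_)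
    (sum_integral_sq_weakDeriv_le_brokenSq _ (by decide))
  have h1 := ((hp.memH_sub hf hK).hasWeakDeriv (α := (0, 0))
    (by simp)).ae_eq_of_zero isOpen_interior
  have h2 := ae_restrict_of_ae_restrict_of_subset (interior_tri_subset_openSquare hK) hw
  filter_upwards [h1, h2] with x hx hx'
  rw [hx', ← hx]

/-! ### Pointwise convergence in the broken `H³` norm -/

/-- Otherwise `|h| ≥ ε` on a square of area `δ ^ 2`, which alone contributes `ε δ` to the norm. -/
theorem exists_small_of_eLpNorm_lt {h : Plane → ℝ} {x : Plane} {δ ε : ℝ} (hδ : 0 < δ) (hε : 0 < ε)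
    (hQ : {z : Plane | z 0 ∈ Icc (x 0) (x 0 + δ) ∧ z 1 ∈ Icc (x 1) (x 1 + δ)} ⊆ openSquare)
    (hh : eLpNorm h 2 (volume.restrict openSquare) < ENNReal.ofReal (ε * δ)) :
    ∃ z : Plane, z 0 ∈ Icc (x 0) (x 0 + δ) ∧ z 1 ∈ Icc (x 1) (x 1 + δ) ∧ |h z| < ε := by
  by_contra! hcon
  set Q : Set Plane := {z : Plane | z 0 ∈ Icc (x 0) (x 0 + δ) ∧ z 1 ∈ Icc (x 1) (x 1 + δ)} with hQd
  have hQm : MeasurableSet Q := measurableSet_box 0 1 _ _ _ _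
  have hvol : volume Q = ENNReal.ofReal (δ ^ 2) := by
    rw [hQd, volume_box 0 1 (by decide), add_sub_cancel_left, add_sub_cancel_left,
      ← ENNReal.ofReal_mul hδ.le, sq]
  have h1 : eLpNorm (fun _ : Plane => ε) 2 (volume.restrict Q) ≤
      eLpNorm h 2 (volume.restrict openSquare) := by
    refine le_trans (eLpNorm_mono_ae ?_) (eLpNorm_mono_measure h (Measure.restrict_mono_set _ hQ))
    filter_upwards [ae_restrict_mem hQm] with z hz
    rw [Real.norm_eq_abs, abs_of_pos hε, Real.norm_eq_abs]
    exact hcon z hz.1 hz.2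
  rw [eLpNorm_const' _ (by norm_num) (by norm_num), Measure.restrict_apply_univ, hvol,
    ENNReal.ofReal_rpow_of_nonneg (sq_nonneg δ) (by norm_num), ← ofReal_norm, Real.norm_eq_abs,
    abs_of_pos hε, ← ENNReal.ofReal_mul hε.le, ENNReal.toReal_ofNat, ← Real.sqrt_eq_rpow,
    Real.sqrt_sq hδ.le] at h1
  exact absurd (h1.trans_lt hh) (lt_irrefl _)

theorem tendsto_of_brokenSq {T : ℕ → Triangulation} (hT : ShapeRegular T)
    (hsize : Tendsto (fun n => meshSize (T n)) atTop (𝓝 0)) (hf : MemH 3 openSquare f)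
    (hwc : ContinuousOn w openSquare) (hw : w =ᵐ[volume.restrict openSquare] f)
    {u : ℕ → Plane → ℝ} (hu : ∀ n, IsFEFunction (T n) (u n))
    (hconv : Tendsto (fun n => brokenSq (T n) fun x => f x - u n x) atTop (𝓝 0))
    {x : Plane} (hx : x ∈ openSquare) : Tendsto (fun n => u n x - w x) atTop (𝓝 0) := by
  obtain ⟨c₀, hc₀, hshape⟩ := hT
  choose p hp using fun n => (hu n).exists_isPiecewise
  obtain ⟨B₀, hB₀⟩ := exists_derivative_bounds_of_memH hf
  rw [Metric.tendsto_nhds]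
  intro ε hε
  simp only [dist_zero_right, Real.norm_eq_abs]
  set A : ℝ := 1 + 16 * c₀ + 96 * c₀ ^ 2 with hA
  -- The scale `δ` is fixed before the mesh: it makes both the oscillation of `w` near `x` and the
  -- mesh-independent increment bound small. Only then is `n` taken large.
  have hev : ∀ᶠ δ in 𝓝[>] (0 : ℝ), A * (√δ * √B₀) < ε / 4 ∧ δ < 1 ∧
      (∀ z, dist z x ≤ 2 * δ → z ∈ openSquare ∧ |w z - w x| < ε / 4) ∧ 0 < δ := by
    have e1 : ∀ᶠ δ in 𝓝 (0 : ℝ), A * (√δ * √B₀) < ε / 4 := by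
      have hc : Continuous fun δ : ℝ => A * (√δ * √B₀) := by fun_prop
      have : Tendsto (fun δ : ℝ => A * (√δ * √B₀)) (𝓝 0) (𝓝 0) := by simpa using hc.tendsto 0
      exact this.eventually_lt_const (by positivity)
    have e2 : ∀ᶠ z in 𝓝 x, z ∈ openSquare ∧ |w z - w x| < ε / 4 := by
      have hO := isOpen_openSquare.mem_nhds hx
      refine Filter.Eventually.and hO ?_
      have := Metric.tendsto_nhds.1 (hwc.continuousAt hO) (ε / 4) (by positivity)
      simpa [Real.dist_eq] using this
    obtain ⟨ρ, hρ, hb⟩ := Metric.eventually_nhds_iff.1 e2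
    filter_upwards [nhdsWithin_le_nhds e1, nhdsWithin_le_nhds (Iio_mem_nhds zero_lt_one),
      nhdsWithin_le_nhds (Iio_mem_nhds (half_pos (half_pos hρ))), self_mem_nhdsWithin]
      with δ h1 h2 h3 h4
    refine ⟨h1, h2, fun z hz => hb (hz.trans_lt ?_), h4⟩
    have : δ < ρ / 2 / 2 := h3
    linarith
  obtain ⟨δ, hδA, hδ1, hδw, hδ⟩ := hev.exists
  set Q : Set Plane := {z : Plane | z 0 ∈ Icc (x 0) (x 0 + δ) ∧ z 1 ∈ Icc (x 1) (x 1 + δ)} with hQd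
  have hQdist : ∀ z ∈ Q, dist z x ≤ 2 * δ := by
    rintro z ⟨h0, h1⟩
    rw [EuclideanSpace.dist_eq, Fin.sum_univ_two]
    refine Real.sqrt_le_iff.2 ⟨by positivity, ?_⟩
    simp only [Real.dist_eq, sq_abs]
    have a0 : (z 0 - x 0) ^ 2 ≤ δ ^ 2 := sq_le_sq' (by linarith [h0.1]) (by linarith [h0.2])
    have a1 : (z 1 - x 1) ^ 2 ≤ δ ^ 2 := sq_le_sq' (by linarith [h1.1]) (by linarith [h1.2])
    nlinarith
  have hsqrt : Tendsto (fun n => √(brokenSq (T n) fun x => f x - u n x)) atTop (𝓝 0) := by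
    simpa using hconv.sqrt
  filter_upwards [hconv.eventually_le_const one_pos, hsize.eventually_le_const hδ,
    hsqrt.eventually_lt_const (by positivity : 0 < ε / 4 * δ)] with n hn1 hn2 hn3
  obtain ⟨N, hN0, hN1, hN2, hNB⟩ := hB₀ (T n) (u n) (p n) (hp n) hn1
  have hinc := fun (i : Fin 2) {a b y : ℝ} => abs_sub_pt_le_of_isPiecewise (hp n) hc₀ (hshape n) hN0
    hN1 hN2 hNB hδ hδ1.le hn2 i (a := a) (b := b) (y := y)
  obtain ⟨z, hz0, hz1, hz⟩ := exists_small_of_eLpNorm_lt (h := fun x => w x - u n x) (x := x) hδ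
    (by positivity : 0 < ε / 4) (fun z hz => (hδw z (hQdist z hz)).1)
    (((hp n).eLpNorm_sub_le hf hw).trans_lt ((ENNReal.ofReal_lt_ofReal_iff (by positivity)).2 hn3))
  have hzQ := hδw z (hQdist z ⟨hz0, hz1⟩)
  have x0 := hx 0
  have x1 := hx 1
  have z0 := hzQ.1 0
  have z1 := hzQ.1 1
  -- Two coordinate moves through the corner `(z 0, x 1)` lead from `x` to the good point `z`;
  -- together with `w` and the error at `z` they account for four quarters of `ε`.
  have m1 := hinc 0 (a := x 0) (b := z 0) (y := x 1) x0.1.le hz0.1 z0.2.le (by linarith [hz0.2])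
    ⟨x1.1.le, x1.2.le⟩
  have m2 := hinc 1 (a := x 1) (b := z 1) (y := z 0) x1.1.le hz1.1 z1.2.le (by linarith [hz1.2])
    ⟨z0.1.le, z0.2.le⟩
  rw [pt_self 0 1 (by decide)] at m1
  rw [pt_self 1 0 (by decide), pt_swap 1 0 (by decide)] at m2
  have hzw := hzQ.2
  rw [← hA] at m1 m2
  rw [abs_le] at m1 m2
  rw [abs_lt] at hz hzw ⊢
  constructor <;> linarith

end

section

variable {T : Triangulation} {K K' : Finset Plane} {u f w : Plane → ℝ} {p : Finset Plane → Poly}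
  {i j : Fin 2}

/-! ### Finite element functions are Lipschitz -/

theorem exists_pderiv_bound (T : Triangulation) (p : Finset Plane → Poly) :
    ∃ N, 0 ≤ N ∧ ∀ K ∈ T.cells, ∀ x ∈ tri K, ∀ i,
      |polyAt (MvPolynomial.pderiv i (p K)) x| ≤ N := by
  have h : ∀ K i, ∃ C, ∀ x ∈ tri K, ‖polyAt (MvPolynomial.pderiv i (p K)) x‖ ≤ C := fun K i =>
    (isCompact_tri K).exists_bound_of_continuousOn (continuous_polyAt _).continuousOn
  choose C hC using h
  refine ⟨∑ K ∈ T.cells, ∑ i, |C K i|, by positivity, fun K hK x hx i => ?_⟩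
  calc _ ≤ |C K i| := (hC K i x hx).trans (le_abs_self _)
    _ ≤ ∑ i, |C K i| :=
      Finset.single_le_sum (f := fun i => |C K i|) (fun _ _ => abs_nonneg _) (Finset.mem_univ i)
    _ ≤ _ := Finset.single_le_sum (f := fun K => ∑ i, |C K i|)
      (fun _ _ => Finset.sum_nonneg fun _ _ => abs_nonneg _) hK

/-- The square is convex, so the cell-wise gradient can be integrated along segments crossing
finitely many cells. The constant depends on `u`; only the regularity matters later. -/
theorem IsPiecewise.exists_lipschitzOnWith (hp : IsPiecewise T u p) :
    ∃ C, LipschitzOnWith C u closedSquare := by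
  obtain ⟨N, hN, hb⟩ := exists_pderiv_bound T p
  refine ⟨Real.toNNReal (2 * N), LipschitzOnWith.of_dist_le_mul fun x hx y hy => ?_⟩
  rw [Real.coe_toNNReal _ (by positivity), dist_comm, dist_comm x, Real.dist_eq]
  have hl : ∀ t : ℝ, HasDerivAt (fun t : ℝ => AffineMap.lineMap x y t) (y - x) t := fun t =>
    AffineMap.hasDerivAt_lineMap
  have hlc : Continuous fun t : ℝ => (AffineMap.lineMap x y t : Plane) :=
    AffineMap.lineMap_continuous
  have h := abs_sub_le_integral_of_piecewise T.cells
    (fun K => (AffineMap.lineMap x y : ℝ →ᵃ[ℝ] Plane) ⁻¹' tri K)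
    (fun t => u (AffineMap.lineMap x y t)) (fun K t => polyAt (p K) (AffineMap.lineMap x y t))
    (fun K t => fderiv ℝ (polyAt (p K)) (AffineMap.lineMap x y t) (y - x))
    (fun _ => 2 * N * dist y x) zero_le_one
    (fun K _ => (isCompact_tri K).isClosed.preimage hlc)
    (fun K _ => ((convex_tri K).affine_preimage _).ordConnected)
    (fun t ht => by
      obtain ⟨K, hK, htK⟩ := exists_mem_tri T
        (convex_closedSquare.lineMap_mem hx hy ht)
      exact mem_biUnion hK htK)
    (fun K hK t ht _ => hp.eq K hK _ ht)
    (fun K _ t => (((contDiff_polyAt (p K)).differentiable (by simp)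
      _).hasFDerivAt).comp_hasDerivAt t (hl t))
    (fun K _ => by
      have := (contDiff_polyAt (p K)).continuous_fderiv (by simp)
      exact (this.comp hlc).clm_apply continuous_const)
    (continuousOn_const.integrableOn_compact isCompact_Icc)
    (fun K hK t ht _ => by
      rw [fderiv_polyAt_apply, Fin.sum_univ_two, dist_eq_norm]
      have a : ∀ i, |(y - x) i * polyAt (MvPolynomial.pderiv i (p K)) (AffineMap.lineMap x y t)| ≤
          ‖y - x‖ * N := fun i => by
        rw [abs_mul]
        exact mul_le_mul (PiLp.norm_apply_le (y - x) i) (hb K hK _ ht i) (abs_nonneg _)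
          (norm_nonneg _)
      refine (abs_add_le _ _).trans ?_
      linarith [a 0, a 1])
  simpa using h

/-- A finite element function has a weak gradient on the whole square, which is the cell-wise
gradient. -/
theorem IsPiecewise.exists_hasWeakDeriv (hp : IsPiecewise T u p) (j : Fin 2) :
    ∃ G, HasWeakDeriv openSquare (unitIndex j) u G ∧
      ∀ K ∈ T.cells, ∀ x ∈ interior (tri K), G x = polyAt (polyDeriv (unitIndex j) (p K)) x := by
  obtain ⟨C, hC⟩ := hp.exists_lipschitzOnWith
  -- A Lipschitz extension to the plane makes integration by parts with almost everywhere line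
  -- derivatives available.
  obtain ⟨F, hF, hFu⟩ := hC.extend_real
  have hloc : LocallyIntegrable (fun x => lineDeriv ℝ F x (EuclideanSpace.single j 1))
      (volume : Measure Plane) := hF.locallyIntegrable_lineDeriv _
  refine ⟨fun x => lineDeriv ℝ F x (EuclideanSpace.single j 1), ⟨?_, ?_, ?_⟩, ?_⟩
  · exact ContinuousOn.locallyIntegrableOn (hC.continuousOn.mono openSquare_subset_closedSquare)
      isOpen_openSquare.measurableSet
  · exact hloc.locallyIntegrableOn _
  · intro φ hφ hφc hφs
    obtain ⟨D, hD⟩ := hφ.lipschitzWith_of_hasCompactSupport hφc (by simp)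
    have h := hF.integral_lineDeriv_mul_eq (μ := volume) hD hφc (EuclideanSpace.single j 1)
    have e1 : ∀ x, lineDeriv ℝ φ x (-EuclideanSpace.single j 1) * F x =
        -(F x * classicalPartial j φ x) := fun x => by
      rw [(hφ.differentiable (by simp) x).lineDeriv_eq_fderiv, map_neg, classicalPartial]
      ring
    have hs := (tsupport_classicalPartial_subset j φ).trans hφs
    rw [classicalDeriv_unitIndex, neg_one_pow_unitIndex,
      setIntegral_congr_fun (g := fun x => F x * classicalPartial j φ x)
        isOpen_openSquare.measurableSet (fun x hx => by
          simp only [hFu (openSquare_subset_closedSquare hx)]),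
      setIntegral_eq_integral_of_tsupport_subset hs,
      setIntegral_eq_integral_of_tsupport_subset hφs, h]
    simp_rw [e1]
    rw [integral_neg]
    ring
  · intro K hK x hx
    rw [← polyAt_pderiv, ← classicalPartial_polyAt]
    change lineDeriv ℝ F x (EuclideanSpace.single j 1) = _
    have e : F =ᶠ[𝓝 x] polyAt (p K) := by
      filter_upwards [isOpen_interior.mem_nhds hx] with y hy
      rw [← hp.eq K hK y (interior_subset hy)]
      exact (hFu (tri_subset_closedSquare hK (interior_subset hy))).symm
    rw [e.lineDeriv_eq, DifferentiableAt.lineDeriv_eq_fderiv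
      ((contDiff_polyAt _).differentiable (by simp) _)]
    rfl

end

section

variable {T : Triangulation} {K K' : Finset Plane} {u f w : Plane → ℝ} {p : Finset Plane → Poly}
  {i j : Fin 2} {b : ℝ} {g : ℝ → Plane}

/-! ### The energy norm controls traces on curves -/

/-- The energy of a scalar function that is piecewise `H³`. -/
def brokenEnergy (b : ℝ) (T : Triangulation) (h : Plane → ℝ) : ℝ :=
  ∑ K ∈ T.cells, ∫ x in interior (tri K), energyDensity b (interior (tri K)) h h x

theorem IsPiecewise.sum_integral_le_brokenEnergy (hp : IsPiecewise T u p)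
    (hf : MemH 3 openSquare f) (hb : 0 < b) :
    ∑ K ∈ T.cells, (∫ x in interior (tri K), (f x - u x) ^ 2) ≤
        brokenEnergy b T (fun x => f x - u x) ∧
      ∀ j, ∑ K ∈ T.cells, ∫ x in interior (tri K),
        weakDeriv (interior (tri K)) (unitIndex j) (fun x => f x - u x) x ^ 2 ≤
          (3 * b)⁻¹ * brokenEnergy b T (fun x => f x - u x) := by
  have key : ∀ K ∈ T.cells, _ := fun K hK =>
    integral_le_integral_energyDensity isOpen_interior (hp.memH_sub hf hK) hb
  have n0 : ∀ K, 0 ≤ ∫ x in interior (tri K), (f x - u x) ^ 2 := fun K =>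
    integral_nonneg fun _ => sq_nonneg _
  have n1 : ∀ K α, 0 ≤ 3 * b * ∫ x in interior (tri K),
      weakDeriv (interior (tri K)) α (fun x => f x - u x) x ^ 2 := fun K α =>
    mul_nonneg (by positivity) (integral_nonneg fun _ => sq_nonneg _)
  refine ⟨Finset.sum_le_sum fun K hK => ?_, fun j => ?_⟩
  · linarith [key K hK, n1 K (1, 0), n1 K (0, 1)]
  · rw [le_inv_mul_iff₀ (by positivity), Finset.mul_sum]
    refine Finset.sum_le_sum fun K hK => ?_
    have := key K hK
    fin_cases j
    · change 3 * b * (∫ x in _, weakDeriv _ (1, 0) _ x ^ 2) ≤ _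
      linarith [n0 K, n1 K (0, 1)]
    · change 3 * b * (∫ x in _, weakDeriv _ (0, 1) _ x ^ 2) ≤ _
      linarith [n0 K, n1 K (1, 0)]

theorem IsPiecewise.brokenEnergy_nonneg (hp : IsPiecewise T u p)
    (hf : MemH 3 openSquare f) (hb : 0 < b) : 0 ≤ brokenEnergy b T (fun x => f x - u x) :=
  (Finset.sum_nonneg fun _ _ => integral_nonneg fun _ => sq_nonneg _).trans
    (hp.sum_integral_le_brokenEnergy hf hb).1

theorem IsPiecewise.eLpNorm_sub_le_sqrt_brokenEnergy (hp : IsPiecewise T u p)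
    (hf : MemH 3 openSquare f)
    (hw : w =ᵐ[volume.restrict openSquare] f) (hb : 0 < b) :
    eLpNorm (fun x => w x - u x) 2 (volume.restrict openSquare) ≤
      ENNReal.ofReal √(brokenEnergy b T fun x => f x - u x) := by
  refine eLpNorm_le_sqrt_of_cells (g := fun _ x => f x - u x)
    (fun K hK => (hp.memH_sub hf hK).memLp isOpen_interior) (fun K hK => ?_)
    (hp.sum_integral_le_brokenEnergy hf hb).1
  filter_upwards [ae_restrict_of_ae_restrict_of_subset (interior_tri_subset_openSquare hK) hw]
    with x hx
  rw [hx]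

/-- Continuity across edges leaves no singular part in the weak gradient of `u`, so the cell-wise
`H¹` bound from the energy becomes one on the whole square. -/
theorem IsPiecewise.exists_hasWeakDeriv_sub (hp : IsPiecewise T u p) (hf : MemH 3 openSquare f)
    (hw : w =ᵐ[volume.restrict openSquare] f) (hb : 0 < b) (j : Fin 2) :
    ∃ U, HasWeakDeriv openSquare (unitIndex j) (fun x => w x - u x) U ∧
      MemLp U 2 (volume.restrict openSquare) ∧
      eLpNorm U 2 (volume.restrict openSquare) ≤
        ENNReal.ofReal √((3 * b)⁻¹ * brokenEnergy b T fun x => f x - u x) := by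
  have hα : (unitIndex j).1 + (unitIndex j).2 ≤ 3 := by rw [unitIndex_add]; norm_num
  obtain ⟨G, hG, hGp⟩ := hp.exists_hasWeakDeriv j
  have hU : HasWeakDeriv openSquare (unitIndex j) (fun x => w x - u x)
      fun x => weakDeriv openSquare (unitIndex j) f x - G x :=
    ((hf.hasWeakDeriv hα).congr hw.symm (ae_eq_refl _)).sub hG
  have hle : eLpNorm (fun x => weakDeriv openSquare (unitIndex j) f x - G x) 2
      (volume.restrict openSquare) ≤
        ENNReal.ofReal √((3 * b)⁻¹ * brokenEnergy b T fun x => f x - u x) := by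
    refine eLpNorm_le_sqrt_of_cells (g := fun K =>
      weakDeriv (interior (tri K)) (unitIndex j) fun x => f x - u x)
      (fun K hK => (hp.memH_sub hf hK).memLp_weakDeriv isOpen_interior hα) (fun K hK => ?_)
      ((hp.sum_integral_le_brokenEnergy hf hb).2 j)
    filter_upwards [hp.weakDeriv_sub_ae_eq hf hK hα,
      ae_restrict_mem isOpen_interior.measurableSet] with x hx hxK
    rw [hx, hGp K hK x hxK]
  exact ⟨_, hU, ⟨hU.2.1.aestronglyMeasurable, hle.trans_lt ENNReal.ofReal_lt_top⟩, hle⟩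

theorem exists_subset_innerSquare {S : Set Plane} (hS : IsCompact S) (h : S ⊆ openSquare) :
    ∃ m, 0 < m ∧ S ⊆ innerSquare m := by
  have hc : Continuous fun x : Plane => min (min (x 0) (1 - x 0)) (min (x 1) (1 - x 1)) := by
    fun_prop
  obtain ⟨m, hm, hle⟩ := hS.exists_forall_le' hc.continuousOn (a := 0) fun x hx => by
    have h0 := h hx 0
    have h1 := h hx 1
    simp only [lt_min_iff]
    exact ⟨⟨h0.1, by linarith⟩, h1.1, by linarith⟩
  refine ⟨m, hm, fun x hx => ?_⟩
  have := hle x hx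
  simp only [le_min_iff] at this
  rw [innerSquare, mem_ofPred_eq, Fin.forall_fin_two]
  exact ⟨⟨this.1.1, by linarith [this.1.2]⟩, this.2.1, by linarith [this.2.2]⟩

/-- Some component `i` of the velocity is nonzero, so the segment is a graph over the `i`-th
coordinate and can be averaged in the other direction. The constant depends on the segment alone. -/
theorem exists_lintegral_affine_le {A : ℝ →ᵃ[ℝ] Plane} (hA : A.linear 1 ≠ 0) {t₀ t₁ : ℝ}
    (hin : ∀ θ ∈ Icc t₀ t₁, A θ ∈ openSquare) :
    ∃ C : ℝ≥0∞, C ≠ ⊤ ∧ ∃ j, ∀ u U : Plane → ℝ, ContinuousOn u openSquare →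
      MemLp u 2 (volume.restrict openSquare) → HasWeakDeriv openSquare (unitIndex j) u U →
      MemLp U 2 (volume.restrict openSquare) →
      ∫⁻ θ in Icc t₀ t₁, ‖u (A θ)‖ₑ ≤
        C * (eLpNorm u 2 (volume.restrict openSquare) +
          eLpNorm U 2 (volume.restrict openSquare)) := by
  have hAc : Continuous A := A.continuous_of_finiteDimensional
  obtain ⟨m, hm, hsub⟩ := exists_subset_innerSquare (isCompact_Icc.image hAc)
    (image_subset_iff.2 hin)
  obtain ⟨i, hi⟩ : ∃ i, A.linear 1 i ≠ 0 := by
    by_contra! h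
    exact hA (by ext k; simp [h k])
  obtain ⟨j, hj⟩ : ∃ j : Fin 2, j ≠ i := exists_ne i
  have hAθ : ∀ θ k, A θ k = A 0 k + θ * A.linear 1 k := fun θ k => by
    have := congrArg (fun z : Plane => z k) (A.map_vadd 0 θ)
    have e : A.linear θ = θ • A.linear 1 := by rw [← map_smul]; simp
    simp only [vadd_eq_add, add_zero, e, PiLp.add_apply, PiLp.smul_apply, smul_eq_mul] at this
    rw [this, add_comm]
  have hpt : ∀ θ, A θ = pt i (A 0 i + θ * A.linear 1 i) (A 0 j + θ * A.linear 1 j) := fun θ => by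
    rw [← hAθ, ← hAθ, pt_self i j hj]
  -- The bound `m / 2` keeps the band in a smaller inner square; the bound 1 lets `ε` be dropped in
  -- front of the derivative term.
  set ε := min (m / 2) 1 with hε
  have hε0 : 0 < ε := by positivity
  have hεm : ε ≤ m / 2 := min_le_left _ _
  have hin' : ∀ θ ∈ Icc t₀ t₁, ∀ s ∈ Icc (A 0 j + θ * A.linear 1 j) (A 0 j + θ * A.linear 1 j + ε),
      pt i (A 0 i + θ * A.linear 1 i) s ∈ innerSquare (m / 2) := by
    intro θ hθ s hs k
    have h := hsub (mem_image_of_mem A hθ)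
    rw [← hAθ] at hs ⊢
    by_cases hk : k = i
    · subst hk
      rw [pt_apply_self]
      exact ⟨by linarith [(h k).1], by linarith [(h k).2]⟩
    · rw [pt_apply_of_ne hk]
      exact ⟨by linarith [(h j).1, hs.1], by linarith [(h j).2, hs.2]⟩
  refine ⟨ENNReal.ofReal |(A.linear 1 i)⁻¹| / ENNReal.ofReal ε,
    ENNReal.div_ne_top ENNReal.ofReal_ne_top (by simpa using hε0), j,
    fun u U hu hu2 hU hU2 => ?_⟩
  have h := lintegral_enorm_trace_le hj hu hu2 hU hU2 hi hε0 (half_pos hm) hin'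
  simp_rw [← hpt] at h
  rw [ENNReal.mul_comm_div, ENNReal.div_eq_inv_mul, ← mul_assoc, mul_comm _ (ENNReal.ofReal ε)⁻¹,
    mul_assoc, ← ENNReal.div_eq_inv_mul, ENNReal.le_div_iff_mul_le (by simp [hε0]) (by simp)]
  refine h.trans ?_
  gcongr
  exact mul_le_of_le_one_right (by simp) (ENNReal.ofReal_le_one.2 (min_le_right _ _))

theorem lintegral_Icc_le_sum {t : ℕ → ℝ} (ht : Monotone t) (F : ℝ → ℝ≥0∞) (n : ℕ) :
    ∫⁻ θ in Icc (t 0) (t n), F θ ≤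
      ∑ k ∈ Finset.range n, ∫⁻ θ in Icc (t k) (t (k + 1)), F θ := by
  induction n with
  | zero => simp
  | succ n ih =>
    rw [← Icc_union_Icc_eq_Icc (ht (Nat.zero_le n)) (ht n.le_succ), Finset.sum_range_succ]
    exact (lintegral_union_le _ _ _).trans (by gcongr)

theorem linear_one_ne_zero_of_injOn {A : ℝ →ᵃ[ℝ] Plane} {a d : ℝ} (hg : InjOn g (Ico a d))
    {t₀ t₁ : ℝ} (h0 : a ≤ t₀) (h1 : t₁ ≤ d) (h01 : t₀ < t₁) (hA : ∀ θ ∈ Icc t₀ t₁, g θ = A θ) :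
    A.linear 1 ≠ 0 := by
  intro h
  have hl : A.linear = 0 := LinearMap.ext_ring (by simpa using h)
  obtain ⟨q, hq⟩ := (AffineMap.linear_eq_zero_iff_exists_const A).1 hl
  -- The midpoint replaces `t₁`, which may be the excluded right end of the period.
  have h2 : g t₀ = g ((t₀ + t₁) / 2) := by
    rw [hA _ ⟨le_rfl, h01.le⟩, hA _ ⟨by linarith, by linarith⟩, hq]
    simp
  have := hg ⟨h0, by linarith⟩ ⟨by linarith, by linarith⟩ h2
  linarith

/-- The trace on an injective piecewise affine closed curve is bounded in `L¹` by the energy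
norm. -/
theorem exists_lintegral_curve_le (hb : 0 < b) (hg : ∀ θ, g θ ∈ openSquare)
    (hinj : InjOn g (Ico 0 (2 * Real.pi))) (haff : PiecewiseAffine g) :
    ∃ C : ℝ≥0∞, C ≠ ⊤ ∧ ∀ (T : Triangulation) (f w u : Plane → ℝ), MemH 3 openSquare f →
      ContinuousOn w openSquare → w =ᵐ[volume.restrict openSquare] f → IsFEFunction T u →
      ∫⁻ θ, ‖w (g θ) - u (g θ)‖ₑ ∂circleMeasure ≤
        C * ENNReal.ofReal √(brokenEnergy b T fun x => f x - u x) := by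
  obtain ⟨N, t, ht, ht0, htN, hA⟩ := haff
  have piece : ∀ k : ℕ, ∃ C : ℝ≥0∞, C ≠ ⊤ ∧ (k < N → ∀ (T : Triangulation) (f w u : Plane → ℝ),
      MemH 3 openSquare f → ContinuousOn w openSquare → w =ᵐ[volume.restrict openSquare] f →
      IsFEFunction T u → ∫⁻ θ in Icc (t k) (t (k + 1)), ‖w (g θ) - u (g θ)‖ₑ ≤
        C * ENNReal.ofReal √(brokenEnergy b T fun x => f x - u x)) := by
    intro k
    by_cases hk : k < N
    swap
    · exact ⟨0, by simp, fun h => absurd h hk⟩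
    obtain ⟨A, hgA⟩ := hA k hk
    -- The subdivision is only weakly monotone; a degenerate piece is a single point and has measure
    -- zero.
    rcases (ht k.le_succ).eq_or_lt with heq | hlt
    · refine ⟨0, by simp, fun _ T f w u _ _ _ _ => ?_⟩
      change ∫⁻ θ in Icc (t k) (t k.succ), _ ≤ _
      rw [← heq]
      simp
    have hl := linear_one_ne_zero_of_injOn hinj (by rw [← ht0]; exact ht (Nat.zero_le k))
      (by rw [← htN]; exact ht (Nat.succ_le_of_lt hk)) hlt hgA
    obtain ⟨C, hC, j, hCj⟩ := exists_lintegral_affine_le hl (t₀ := t k) (t₁ := t (k + 1))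
      fun θ hθ => hgA θ hθ ▸ hg θ
    refine ⟨C * (1 + ENNReal.ofReal √((3 * b)⁻¹)),
      ENNReal.mul_ne_top hC (ENNReal.add_ne_top.2 ⟨ENNReal.one_ne_top, ENNReal.ofReal_ne_top⟩),
      fun _ T f w u hf hwc hw hu => ?_⟩
    obtain ⟨p, hp⟩ := hu.exists_isPiecewise
    obtain ⟨U, hU, hU2, hUle⟩ := hp.exists_hasWeakDeriv_sub hf hw hb j
    have hule := hp.eLpNorm_sub_le_sqrt_brokenEnergy hf hw hb
    obtain ⟨L, hL⟩ := hp.exists_lipschitzOnWith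
    have huc : ContinuousOn (fun x => w x - u x) openSquare :=
      hwc.sub (hL.continuousOn.mono openSquare_subset_closedSquare)
    have h := hCj _ U huc ⟨huc.aestronglyMeasurable isOpen_openSquare.measurableSet,
      hule.trans_lt ENNReal.ofReal_lt_top⟩ hU hU2
    rw [setLIntegral_congr_fun measurableSet_Icc fun θ hθ => by rw [hgA θ hθ]]
    refine h.trans ?_
    rw [mul_assoc, add_mul, one_mul, ← ENNReal.ofReal_mul (Real.sqrt_nonneg _),
      ← Real.sqrt_mul (by positivity)]
    gcongr
  choose C hC hCk using piece
  refine ⟨∑ k ∈ Finset.range N, C k, ENNReal.sum_ne_top.2 fun k _ => hC k,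
    fun T f w u hf hwc hw hu => ?_⟩
  rw [circleMeasure, ← ht0, ← htN, Finset.sum_mul]
  exact (lintegral_Icc_le_sum ht _ N).trans (Finset.sum_le_sum fun k hk =>
    hCk k (Finset.mem_range.1 hk) T f w u hf hwc hw hu)

end

section

variable {T : ℕ → Triangulation} {v w : Plane → Plane} {vh : ℕ → Plane → Plane} {b : ℝ}
  {g : ℝ → Plane}

/-! ### Vector fields -/

theorem exists_continuous_vector_representative
    (hv : ∀ i : Fin 2, MemH 3 openSquare fun x => v x i) :
    ∃ w : Plane → Plane, ContinuousOn w openSquare ∧ w =ᵐ[volume.restrict openSquare] v := by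
  choose w hwc hw using fun i => exists_continuous_representative (hv i)
  refine ⟨fun x => WithLp.toLp 2 fun i => w i x, ?_, ?_⟩
  · exact (PiLp.continuous_toLp 2 _).comp_continuousOn (continuousOn_pi.2 hwc)
  · filter_upwards [hw 0, hw 1] with x h0 h1
    ext i
    fin_cases i
    · exact h0
    · exact h1

theorem tendsto_of_tendsto_sqrt {a : ℕ → ℝ} (ha : ∀ n, 0 ≤ a n)
    (h : Tendsto (fun n => √(a n)) atTop (𝓝 0)) : Tendsto a atTop (𝓝 0) := by
  have := h.pow 2
  simpa [Real.sq_sqrt (ha _)] using this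

theorem tendsto_of_brokenNorm (hT : ShapeRegular T)
    (hsize : Tendsto (fun n => meshSize (T n)) atTop (𝓝 0))
    (hv : ∀ i : Fin 2, MemH 3 openSquare fun x => v x i) (hwc : ContinuousOn w openSquare)
    (hw : w =ᵐ[volume.restrict openSquare] v) (hvh : ∀ n, IsVectorFEFunction (T n) (vh n))
    (hconv : Tendsto (fun n => brokenNorm 3 (T n) fun x => v x - vh n x) atTop (𝓝 0))
    {x : Plane} (hx : x ∈ openSquare) : Tendsto (fun n => vh n x - w x) atTop (𝓝 0) := by
  have hsq := tendsto_of_tendsto_sqrt (fun n => Finset.sum_nonneg fun K _ =>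
    Finset.sum_nonneg fun i _ => sobolevNormSq_nonneg) hconv
  have hi : ∀ i, Tendsto (fun n => vh n x i - w x i) atTop (𝓝 0) := fun i => by
    refine tendsto_of_brokenSq hT hsize (hv i)
      (((PiLp.continuous_apply 2 _ i).comp_continuousOn hwc))
      (hw.mono fun y hy => by simp only [Function.comp, hy]) (fun n => hvh n i) ?_ hx
    refine squeeze_zero (fun n => Finset.sum_nonneg fun K _ => sobolevNormSq_nonneg)
      (fun n => Finset.sum_le_sum fun K _ => ?_) hsq
    exact Finset.single_le_sum (f := fun i => sobolevNormSq 3 (interior (tri K))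
      fun x => (v x - vh n x) i) (fun _ _ => sobolevNormSq_nonneg) (Finset.mem_univ i)
  exact ((PiLp.continuous_toLp 2 fun _ : Fin 2 => ℝ).tendsto 0).comp (tendsto_pi_nhds.2 hi)

/-- The trace bound for both components gives convergence in `L¹` of the circle, hence in measure,
hence almost everywhere along a subsequence. -/
theorem exists_subseq_tendsto_of_energyNorm (hb : 0 < b)
    (hv : ∀ i : Fin 2, MemH 3 openSquare fun x => v x i) (hwc : ContinuousOn w openSquare)
    (hw : w =ᵐ[volume.restrict openSquare] v) (hvh : ∀ n, IsVectorFEFunction (T n) (vh n))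
    (hg : Continuous g) (hgs : ∀ θ, g θ ∈ openSquare)
    (hinj : InjOn g (Ico 0 (2 * Real.pi))) (haff : PiecewiseAffine g)
    (hconv : Tendsto (fun n => energyNorm b (T n) fun x => v x - vh n x) atTop (𝓝 0)) :
    ∃ k : ℕ → ℕ, StrictMono k ∧
      ∀ᵐ θ ∂circleMeasure, Tendsto (fun j => vh (k j) (g θ) - w (g θ)) atTop (𝓝 0) := by
  obtain ⟨C, hC, hCle⟩ := exists_lintegral_curve_le hb hgs hinj haff
  have hE0 : ∀ n i, 0 ≤ brokenEnergy b (T n) fun x => v x i - vh n x i := fun n i => by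
    obtain ⟨p, hp⟩ := (hvh n i).exists_isPiecewise
    exact hp.brokenEnergy_nonneg (hv i) hb
  have hEle : ∀ n i, √(brokenEnergy b (T n) fun x => v x i - vh n x i) ≤
      energyNorm b (T n) fun x => v x - vh n x := fun n i =>
    Real.sqrt_le_sqrt (Finset.single_le_sum
      (f := fun i => brokenEnergy b (T n) fun x => v x i - vh n x i)
      (fun i _ => hE0 n i) (Finset.mem_univ i))
  have hvc : ∀ n, Continuous fun θ => vh n (g θ) := fun n => by
    have : Continuous fun θ => fun i => vh n (g θ) i := continuous_pi fun i => by
      obtain ⟨p, hp⟩ := (hvh n i).exists_isPiecewise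
      obtain ⟨L, hL⟩ := hp.exists_lipschitzOnWith
      exact (hL.continuousOn.mono openSquare_subset_closedSquare).comp_continuous hg hgs
    exact (PiLp.continuous_toLp 2 _).comp this
  have hwg : Continuous fun θ => w (g θ) := hwc.comp_continuous hg hgs
  have hle : ∀ n, eLpNorm ((fun θ => vh n (g θ)) - fun θ => w (g θ)) 1 circleMeasure ≤
      C * ENNReal.ofReal (energyNorm b (T n) fun x => v x - vh n x) +
      C * ENNReal.ofReal (energyNorm b (T n) fun x => v x - vh n x) := fun n => by
    have hi : ∀ i, ∫⁻ θ, ‖w (g θ) i - vh n (g θ) i‖ₑ ∂circleMeasure ≤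
        C * ENNReal.ofReal (energyNorm b (T n) fun x => v x - vh n x) := fun i => by
      refine (hCle (T n) _ _ _ (hv i) ((PiLp.continuous_apply 2 _ i).comp_continuousOn hwc)
        (hw.mono fun y hy => by simp only [Function.comp, hy]) (hvh n i)).trans ?_
      gcongr
      exact hEle n i
    rw [eLpNorm_one_eq_lintegral_enorm]
    refine le_trans ?_ (add_le_add (hi 0) (hi 1))
    rw [← lintegral_add_left (by
      exact (((PiLp.continuous_apply 2 _ 0).comp hwg).sub
        ((PiLp.continuous_apply 2 _ 0).comp (hvc n))).enorm.measurable)]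
    refine lintegral_mono fun θ => ?_
    simp only [Pi.sub_apply, ← ofReal_norm, Real.norm_eq_abs]
    rw [← ENNReal.ofReal_add (abs_nonneg _) (abs_nonneg _), norm_sub_rev]
    refine ENNReal.ofReal_le_ofReal ?_
    rw [EuclideanSpace.norm_eq, Fin.sum_univ_two, Real.sqrt_le_left (by positivity)]
    simp only [PiLp.sub_apply, Real.norm_eq_abs]
    nlinarith [abs_nonneg (w (g θ) 0 - vh n (g θ) 0), abs_nonneg (w (g θ) 1 - vh n (g θ) 1)]
  have hlim : Tendsto (fun n => eLpNorm ((fun θ => vh n (g θ)) - fun θ => w (g θ)) 1 circleMeasure)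
      atTop (𝓝 0) := by
    have h1 : Tendsto (fun n => C * ENNReal.ofReal (energyNorm b (T n) fun x => v x - vh n x))
        atTop (𝓝 0) := by
      simpa using ENNReal.Tendsto.const_mul (ENNReal.tendsto_ofReal hconv) (Or.inr hC)
    refine tendsto_of_tendsto_of_tendsto_of_le_of_le tendsto_const_nhds
      (by simpa using h1.add h1) (fun _ => zero_le) hle
  obtain ⟨k, hk, hae⟩ := (tendstoInMeasure_of_tendsto_eLpNorm one_ne_zero
    (fun n => (hvc n).aestronglyMeasurable) hwg.aestronglyMeasurable hlim).exists_seq_tendsto_ae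
  exact ⟨k, hk, hae.mono fun θ hθ => by simpa using hθ.sub_const (w (g θ))⟩

end

end TriHelmholtz

end

/-! ### The main theorem. -/

open TriHelmholtz in
theorem mainTheorem4
    (b : ℝ) (hb : 0 < b)
    -- a shape-regular, quasi-uniform sequence of triangulations with mesh size tending to zero
    (T : ℕ → Triangulation)
    (hT_shape : ShapeRegular T) (hT_quasi : QuasiUniform T)
    (hT_size : Tendsto (fun n => meshSize (T n)) atTop (𝓝 0))
    -- `v ∈ H³(Ω)²` and finite element functions `vh n` over `T n`
    (v : Plane → Plane) (hv : ∀ i : Fin 2, MemH 3 openSquare fun x => v x i)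
    (vh : ℕ → Plane → Plane) (hvh : ∀ n, IsVectorFEFunction (T n) (vh n))
    -- a closed continuous curve away from the boundary that consists of interior mesh edges
    (g : ℝ → Plane) (hg_cont : Continuous g) (hg_per : Function.Periodic g (2 * Real.pi))
    (hg_int : ∀ θ, g θ ∈ openSquare)
    (hg_edges : ∀ n, ComprisedOfInteriorEdges (T n) g) :
    -- `v` is evaluated on the curve through its continuous representative `w`
    ∃ w : Plane → Plane, ContinuousOn w openSquare ∧ w =ᵐ[volume.restrict openSquare] v ∧
      (Tendsto (fun n => brokenNorm 3 (T n) fun x => v x - vh n x) atTop (𝓝 0) →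
        ∀ᵐ θ ∂circleMeasure, Tendsto (fun n => vh n (g θ) - w (g θ)) atTop (𝓝 0)) ∧
      (Tendsto (fun n => energyNorm b (T n) fun x => v x - vh n x) atTop (𝓝 0) →
        InjOn g (Ico 0 (2 * Real.pi)) → PiecewiseAffine g →
        ∃ k : ℕ → ℕ, StrictMono k ∧
          ∀ᵐ θ ∂circleMeasure, Tendsto (fun j => vh (k j) (g θ) - w (g θ)) atTop (𝓝 0)) := by
  obtain ⟨w, hwc, hw⟩ := exists_continuous_vector_representative hv
  exact ⟨w, hwc, hw,
    -- Convergence holds at every point of the curve, not only almost everywhere.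
    fun h => Eventually.of_forall fun θ =>
      tendsto_of_brokenNorm hT_shape hT_size hv hwc hw hvh h (hg_int θ),
    fun h hinj haff =>
      exists_subseq_tendsto_of_energyNorm hb hv hwc hw hvh hg_cont hg_int hinj haff h⟩
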